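/- Let $k$ be an algebraically closed field of characteristic $0$ and let $(H,\mathcal R)$ be a finite-dimensional coquasitriangular pointed Hopf algebra over $k$; that is, every simple subcoalgebra of $H$ is one-dimensional, and $\mathcal R:H\otimes H\to k$ is a convolution-invertible linear form with $$\mathcal R(ab,c)=\mathcal R(a,c_1)\mathcal R(b,c_2),\qquad \mathcal R(a,bc)=\mathcal R(a_1,c)\mathcal R(a_2,b),\qquad b_1a_1\mathcal R(a_2,b_2)=\mathcal R(a_1,b_1)a_2b_2$$ for all $a,b,c\in H$ (Sweedler notation). Let $G$ be the group of group-like elements of $H$. For $a,b\in G$ let $P_{a,b}=\{x\in H:\Delta(x)=x\otimes a+b\otimes x\}$ be the space of $(a,b)$-primitive elements. The quiver of $H$ has vertex set $G$ and $\dim_k P_{a,b}/k(a-b)$ arrows from $a$ to $b$. Assume that $H$ is connected, i.e. this quiver is connected as an undirected graph, and that $G\neq\{1\}$. Let $g_1,\dots,g_t$ be the distinct elements $g\in G$ for which the quiver has an arrow from $1$ to $g$, and let $R_i=\dim_k P_{1,g_i}/k(1-g_i)\ge 1$. Then $g_1,\dots,g_t$ (in some order) generate $G$, and there are $(1,g_i)$-primitive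 elements $x_{i,i'}$ $(1\le i\le t,\ 1\le i'\le R_i)$ and scalars $\mu_{i,i'},\lambda_{i,i',j,j'}\in k$ such that $H$ is generated as an algebra by all the $g_i$ and $x_{i,i'}$ with the defining relations $$\text{the defining relations of } G \text{ by the } g_i,$$ $$x_{j,j'}g_i=\mathcal R(g_i,g_j)\,g_ix_{j,j'}\quad\text{for all } i,j,j',$$ $$x_{i,i'}^2=\mu_{i,i'}(1-g_i^2)\quad\text{for all } i,i',$$ $$x_{j,j'}x_{i,i'}-\mathcal R(g_i,g_j)\,x_{i,i'}x_{j,j'}=\lambda_{i,i',j,j'}(1-g_ig_j)\quad\text{for all }(i,i')\ne(j,j').$$ Moreover, the elements $$g\,x_{1,1}^{\sigma_{1,1}}\cdots x_{1,R_1}^{\sigma_{1,R_1}}\cdots x_{t,1}^{\sigma_{t,1}}\cdots x_{t,R_t}^{\sigma_{t,R_t}},\qquad g\in G,\ \sigma_{i,i'}\in\{0,1\},$$ form a basis of $H$. -/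

import Mathlib

open scoped TensorProduct

section CoalgebraNotions

variable (k : Type*) {H : Type*} [Field k] [AddCommGroup H] [Module k H] [Coalgebra k H]

/-- `D` is a subcoalgebra: `Δ(D) ⊆ D ⊗ D`, the latter viewed inside `H ⊗ H`. -/
def IsSubcoalgebra (D : Submodule k H) : Prop :=
  ∀ x ∈ D, Coalgebra.comul (R := k) x ∈ LinearMap.range (TensorProduct.map D.subtype D.subtype)

/-- `D` is a simple subcoalgebra: a nonzero subcoalgebra without proper nonzero subcoalgebras. -/
structure IsSimpleSubcoalgebra (D : Submodule k H) : Prop where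
  isSubcoalgebra : IsSubcoalgebra k D
  ne_bot : D ≠ ⊥
  eq_bot_or_eq : ∀ E : Submodule k H, E ≤ D → IsSubcoalgebra k E → E = ⊥ ∨ E = D

variable (H) in
/-- A coalgebra is pointed if all of its simple subcoalgebras are one-dimensional. -/
def IsPointedCoalgebra : Prop :=
  ∀ D : Submodule k H, IsSimpleSubcoalgebra k D → Module.finrank k D = 1

/-- The space `P_{a,b}` of `(a,b)`-primitive elements: `Δ(x) = x ⊗ a + b ⊗ x`. -/
def skewPrimitives (a b : H) : Submodule k H where
  carrier := {x | Coalgebra.comul (R := k) x = x ⊗ₜ[k] a + b ⊗ₜ[k] x}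
  zero_mem' := by simp
  add_mem' := by
    intro x y hx hy
    simp only [Set.mem_ofPred_eq] at hx hy ⊢
    rw [map_add, hx, hy, TensorProduct.add_tmul, TensorProduct.tmul_add]
    abel
  smul_mem' := by
    intro c x hx
    simp only [Set.mem_ofPred_eq] at hx ⊢
    rw [map_smul, hx, smul_add, TensorProduct.smul_tmul', TensorProduct.tmul_smul]

/-- The space spanned by the arrows from `a` to `b` in the quiver of a pointed coalgebra:
the `(a,b)`-primitive elements modulo the trivial ones, that is, `P_{a,b} / k(a - b)`. -/
abbrev ArrowSpace (a b : H) : Type _ :=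
  skewPrimitives k a b ⧸ (Submodule.span k {a - b}).submoduleOf (skewPrimitives k a b)

variable (H) in
/-- The quiver of the pointed coalgebra `H` (vertices: group-like elements; number of arrows from
`a` to `b`: the dimension of `P_{a,b} / k(a - b)`) is connected as an undirected graph. -/
def HasConnectedQuiver : Prop :=
  ∀ a b : GroupLike k H,
    Relation.EqvGen (fun c d : GroupLike k H => Nontrivial (ArrowSpace k (c : H) (d : H))) a b

end CoalgebraNotions

section Coquasitriangular

variable {k H : Type*} [Field k] [Ring H] [HopfAlgebra k H]

/-- `R : H ⊗ H → k` is a universal `R`-form (coquasitriangular structure) on `H`. -/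
structure IsCoquasitriangular (R : H ⊗[k] H →ₗ[k] k) : Prop where
  /-- `R` is invertible for the convolution product on linear maps `H ⊗ H → k`. -/
  isUnit : IsUnit (WithConv.toConv R)
  /-- `R(ab, c) = R(a, c₁) R(b, c₂)`. -/
  mul_left : ∀ a b c : H, R ((a * b) ⊗ₜ[k] c) =
    LinearMap.mul' k k (TensorProduct.map
      (R ∘ₗ TensorProduct.mk k H H a) (R ∘ₗ TensorProduct.mk k H H b)
      (Coalgebra.comul (R := k) c))
  /-- `R(a, bc) = R(a₁, c) R(a₂, b)`. -/
  mul_right : ∀ a b c : H, R (a ⊗ₜ[k] (b * c)) =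
    LinearMap.mul' k k (TensorProduct.map
      (R ∘ₗ (TensorProduct.mk k H H).flip c) (R ∘ₗ (TensorProduct.mk k H H).flip b)
      (Coalgebra.comul (R := k) a))
  /-- `b₁ a₁ R(a₂, b₂) = R(a₁, b₁) a₂ b₂`, as an identity between convolution products of
  linear maps `H ⊗ H → H` evaluated at `a ⊗ b`. -/
  comm : WithConv.toConv (LinearMap.mul' k H ∘ₗ (TensorProduct.comm k H H).toLinearMap) *
      WithConv.toConv (Algebra.linearMap k H ∘ₗ R) =
    WithConv.toConv (Algebra.linearMap k H ∘ₗ R) * WithConv.toConv (LinearMap.mul' k H)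

end Coquasitriangular

section Presentation

variable {k G : Type*} [Field k] [Group G] {t : ℕ} {r : Fin t → ℕ}

/-- The free algebra on symbols `g_i` (`i < t`) and `x_{i,i'}` (`i < t`, `i' < r i`). -/
abbrev PresGen (k : Type*) [Field k] {t : ℕ} (r : Fin t → ℕ) : Type _ :=
  FreeAlgebra k (Fin t ⊕ (Σ i : Fin t, Fin (r i)))

/-- The symbol `g_i`. -/
def symG (k : Type*) [Field k] {t : ℕ} (r : Fin t → ℕ) (i : Fin t) : PresGen k r :=
  FreeAlgebra.ι k (Sum.inl i)

/-- The symbol `x_p`, for `p = (i,i')`. -/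
def symX (k : Type*) [Field k] {t : ℕ} {r : Fin t → ℕ} (p : Σ i : Fin t, Fin (r i)) :
    PresGen k r :=
  FreeAlgebra.ι k (Sum.inr p)

/-- The relations imposed on the symbols `g_i` and `x_p`. Here `g` lists the elements of the finite
group `G` denoted by the symbols `g_i`, and `q i j`, `μ p`, `lam p p'` are scalars. -/
inductive PresRel (g : Fin t → G) (q : Fin t → Fin t → k)
    (μ : (Σ i : Fin t, Fin (r i)) → k)
    (lam : (Σ i : Fin t, Fin (r i)) → (Σ i : Fin t, Fin (r i)) → k) :
    PresGen k r → PresGen k r → Prop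
  /-- The relations of `G`: two words in the `g_i` which have the same value in `G` are equal. -/
  | group (v w : List (Fin t)) (h : (v.map g).prod = (w.map g).prod) :
      PresRel g q μ lam (v.map (symG k r)).prod (w.map (symG k r)).prod
  /-- `x_{j,j'} g_i = q_{ij} g_i x_{j,j'}`. -/
  | cross (i : Fin t) (p : Σ i : Fin t, Fin (r i)) :
      PresRel g q μ lam (symX k p * symG k r i) (q i p.1 • (symG k r i * symX k p))
  /-- `x_{i,i'}² = μ_{i,i'} (1 - g_i²)`. -/
  | square (p : Σ i : Fin t, Fin (r i)) :
      PresRel g q μ lam (symX k p ^ 2) (μ p • (1 - symG k r p.1 ^ 2))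
  /-- `x_{j,j'} x_{i,i'} - q_{ij} x_{i,i'} x_{j,j'} = λ_{i,i',j,j'} (1 - g_i g_j)`
  for `(i,i') ≠ (j,j')`. -/
  | link (p p' : Σ i : Fin t, Fin (r i)) (h : p ≠ p') :
      PresRel g q μ lam (symX k p' * symX k p - q p.1 p'.1 • (symX k p * symX k p'))
        (lam p p' • (1 - symG k r p.1 * symG k r p'.1))

/-- The ordered monomial
`x_{1,1}^σ_{1,1} ⋯ x_{1,r_1}^σ_{1,r_1} ⋯ x_{t,1}^σ_{t,1} ⋯ x_{t,r_t}^σ_{t,r_t}`. -/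
def orderedMonomial {H : Type*} [Ring H] (x : (Σ i : Fin t, Fin (r i)) → H)
    (σ : (Σ i : Fin t, Fin (r i)) → Fin 2) : H :=
  (List.ofFn fun i : Fin t =>
    (List.ofFn fun i' : Fin (r i) => x ⟨i, i'⟩ ^ (σ ⟨i, i'⟩ : ℕ)).prod).prod

end Presentation

/-! Work in the convolution algebra `DualAlg k H` of linear forms. Let J be the ideal of forms
vanishing on G; `radPow k H m` is J^m and `corad k H m` is its orthogonal, so `corad k H 1` is kG.
Pointedness puts J inside the Jacobson radical, so J is nilpotent. The theorem follows from counting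
dimensions: with n the total number of arrows out of 1, both H and the presented algebra have
dimension |G|·2^n.

The engine is `dual_apply_eq_zero_of_comul`. Suppose z is skew-primitive of degree γ modulo lower
terms and commutes with γ modulo lower terms. If z were indecomposable, some form ω would act like a
derivation with ω(z) = 1, so ω^m(z^m) = m!. This is nonzero in characteristic 0, although ω^m = 0
for large m.

The engine is used twice. In the first layer, comparing the two commutation rules given by R yields
R(g,g)² = 1 for every arrow from 1 to g, and the engine excludes R(g,g) = 1. Thus R(g,g) = -1, and
the condition R(x,g) = 0 selects representatives of the arrows for which the relations are a direct
evaluation of the axiom `comm`. In the second layer every new degree would be γ = g_p g_q, for which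
R(γ,γ) = 1; the engine then shows that this layer consists of products (`corad_three_le`).

Dually, the forms ξ_p dual to the x_p generate J modulo J² together with the forms dual to G. Since
the second layer is decomposable, they satisfy ξ_p ξ_q = R(g_p,g_q) ξ_q ξ_p and ξ_p² = 0 modulo J³.
Straightening words bounds dim H by |G|·2^n (`finrank_le`). Conversely the ξ_p act on products of
the x_p as skew derivations, so ordered squarefree products are independent
(`le_finrank_subwordSpace`). Finally the relations straighten every word of the presented algebra,
whose dimension is therefore at most |G|·2^n, and its surjection onto H is an isomorphism. -/

section CoquasitriangularPointed

open Coalgebra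

/-! ### Contractions of tensors with linear forms -/

section TensorContraction

variable {k : Type*} [Field k] {V W : Type*} [AddCommGroup V] [Module k V]
  [AddCommGroup W] [Module k W]

/-- Contraction of the right tensor factor with a linear form. -/
noncomputable def pairRight (f : W →ₗ[k] k) : V ⊗[k] W →ₗ[k] V :=
  (TensorProduct.rid k V).toLinearMap ∘ₗ LinearMap.lTensor V f

/-- Contraction of the left tensor factor with a linear form. -/
noncomputable def pairLeft (f : V →ₗ[k] k) : V ⊗[k] W →ₗ[k] W :=
  (TensorProduct.lid k W).toLinearMap ∘ₗ LinearMap.rTensor W f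

@[simp] lemma pairRight_tmul (f : W →ₗ[k] k) (v : V) (w : W) :
    pairRight f (v ⊗ₜ[k] w) = f w • v := by simp [pairRight]

@[simp] lemma pairLeft_tmul (f : V →ₗ[k] k) (v : V) (w : W) :
    pairLeft f (v ⊗ₜ[k] w) = f v • w := by simp [pairLeft]

lemma pairRight_basis_sum {ι : Type*} [Fintype ι] (b : Module.Basis ι k W) (t : V ⊗[k] W) :
    ∑ i, pairRight (b.coord i) t ⊗ₜ[k] b i = t := by
  induction t with
  | zero => simp
  | tmul v w =>
    simp only [pairRight_tmul, TensorProduct.smul_tmul, ← TensorProduct.tmul_sum,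
      Module.Basis.coord_apply, b.sum_repr]
  | add s t hs ht => simp only [map_add, TensorProduct.add_tmul, Finset.sum_add_distrib, hs, ht]

lemma pairLeft_basis_sum {ι : Type*} [Fintype ι] (b : Module.Basis ι k V) (t : V ⊗[k] W) :
    ∑ i, b i ⊗ₜ[k] pairLeft (b.coord i) t = t := by
  induction t with
  | zero => simp
  | tmul v w =>
    simp only [pairLeft_tmul, ← TensorProduct.smul_tmul, ← TensorProduct.sum_tmul,
      Module.Basis.coord_apply, b.sum_repr]
  | add s t hs ht => simp only [map_add, TensorProduct.tmul_add, Finset.sum_add_distrib, hs, ht]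

lemma pairRight_map {V' W' : Type*} [AddCommGroup V'] [Module k V'] [AddCommGroup W']
    [Module k W'] (f : W' →ₗ[k] k) (φ : V →ₗ[k] V') (ψ : W →ₗ[k] W') (t : V ⊗[k] W) :
    pairRight f (TensorProduct.map φ ψ t) = φ (pairRight (f ∘ₗ ψ) t) := by
  induction t with
  | zero => simp
  | tmul v w => simp
  | add s t hs ht => simp [hs, ht]

lemma pairLeft_map {V' W' : Type*} [AddCommGroup V'] [Module k V'] [AddCommGroup W']
    [Module k W'] (f : V' →ₗ[k] k) (φ : V →ₗ[k] V') (ψ : W →ₗ[k] W') (t : V ⊗[k] W) :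
    pairLeft f (TensorProduct.map φ ψ t) = ψ (pairLeft (f ∘ₗ φ) t) := by
  induction t with
  | zero => simp
  | tmul v w => simp
  | add s t hs ht => simp [hs, ht]

lemma exists_projection_onto (U : Submodule k V) :
    ∃ p : V →ₗ[k] V, (∀ v, p v ∈ U) ∧ ∀ v ∈ U, p v = v := by
  obtain ⟨q, hq⟩ := U.subtype.exists_leftInverse_of_injective (by simp)
  refine ⟨U.subtype ∘ₗ q, fun v => (q v).2, fun v hv => ?_⟩
  have := LinearMap.congr_fun hq ⟨v, hv⟩
  simpa using congrArg Subtype.val this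

/-- A tensor all of whose contractions lie in given subspaces lies in their tensor product. -/
lemma mem_range_map_of_contract_mem [FiniteDimensional k V] [FiniteDimensional k W]
    {U : Submodule k V} {U' : Submodule k W} {t : V ⊗[k] W}
    (h₁ : ∀ f, pairRight f t ∈ U) (h₂ : ∀ f, pairLeft f t ∈ U') :
    t ∈ LinearMap.range (TensorProduct.map U.subtype U'.subtype) := by
  obtain ⟨p, hp, hp'⟩ := exists_projection_onto U
  obtain ⟨q, hq, hq'⟩ := exists_projection_onto U'
  have e₁ : TensorProduct.map p LinearMap.id t = t := by
    rw [← pairRight_basis_sum (Module.finBasis k W) (TensorProduct.map p LinearMap.id t)]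
    conv_rhs => rw [← pairRight_basis_sum (Module.finBasis k W) t]
    refine Finset.sum_congr rfl fun i _ => ?_
    rw [pairRight_map, LinearMap.comp_id, hp' _ (h₁ _)]
  have e₂ : TensorProduct.map LinearMap.id q t = t := by
    rw [← pairLeft_basis_sum (Module.finBasis k V) (TensorProduct.map LinearMap.id q t)]
    conv_rhs => rw [← pairLeft_basis_sum (Module.finBasis k V) t]
    refine Finset.sum_congr rfl fun i _ => ?_
    rw [pairLeft_map, LinearMap.comp_id, hq' _ (h₂ _)]
  refine ⟨TensorProduct.map (p.codRestrict U hp) (q.codRestrict U' hq) t, ?_⟩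
  rw [← LinearMap.comp_apply, ← TensorProduct.map_comp, LinearMap.subtype_comp_codRestrict,
    LinearMap.subtype_comp_codRestrict]
  conv_rhs => rw [← e₁]
  conv_rhs => rw [← e₂]
  rw [← LinearMap.comp_apply, ← TensorProduct.map_comp]
  rfl

lemma pairRight_mem_of_mem_range {U : Submodule k V} {U' : Submodule k W} {t : V ⊗[k] W}
    (ht : t ∈ LinearMap.range (TensorProduct.map U.subtype U'.subtype)) (f : W →ₗ[k] k) :
    pairRight f t ∈ U := by
  obtain ⟨s, rfl⟩ := ht
  rw [pairRight_map]
  exact Subtype.property _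

lemma pairLeft_mem_of_mem_range {U : Submodule k V} {U' : Submodule k W} {t : V ⊗[k] W}
    (ht : t ∈ LinearMap.range (TensorProduct.map U.subtype U'.subtype)) (f : V →ₗ[k] k) :
    pairLeft f t ∈ U' := by
  obtain ⟨s, rfl⟩ := ht
  rw [pairLeft_map]
  exact Subtype.property _

end TensorContraction

/-! ### Orthogonality between subspaces of H and of its dual -/

section DualSpace

variable {k H : Type*} [Field k] [AddCommGroup H] [Module k H]

variable (k H) in
/-- The dual algebra of a coalgebra. -/
abbrev DualAlg : Type _ := WithConv (H →ₗ[k] k)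

lemma eq_of_forall_dual {y z : H} (h : ∀ f : DualAlg k H, f y = f z) : y = z := by
  rw [← sub_eq_zero, ← Module.forall_dual_apply_eq_zero_iff k]
  intro f
  have := h (.toConv f)
  simpa [sub_eq_zero] using this

instance [FiniteDimensional k H] : FiniteDimensional k (DualAlg k H) :=
  Module.Finite.equiv (WithConv.linearEquiv k (H →ₗ[k] k)).symm

/-- The vectors annihilated by a space of linear forms. -/
def perp (S : Submodule k (DualAlg k H)) : Submodule k H where
  carrier := {y | ∀ f ∈ S, f y = 0}
  zero_mem' := fun f _ => map_zero _
  add_mem' := fun ha hb f hf => by rw [map_add, ha f hf, hb f hf, add_zero]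
  smul_mem' := fun c a ha f hf => by rw [map_smul, ha f hf, smul_zero]

/-- The linear forms annihilating a subspace. -/
def ann (D : Submodule k H) : Submodule k (DualAlg k H) where
  carrier := {f | ∀ y ∈ D, f y = 0}
  zero_mem' := fun y _ => rfl
  add_mem' := fun {f g} ha hb y hy => by
    change f y + g y = 0
    rw [ha y hy, hb y hy, add_zero]
  smul_mem' := fun c f ha y hy => by
    change c • f y = 0
    rw [ha y hy, smul_zero]

lemma mem_perp {S : Submodule k (DualAlg k H)} {y : H} : y ∈ perp S ↔ ∀ f ∈ S, f y = 0 := Iff.rfl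

lemma perp_ann (D : Submodule k H) : perp (ann D) = D := by
  refine le_antisymm (fun y hy => ?_) fun y hy f hf => hf y hy
  rw [← Subspace.forall_mem_dualAnnihilator_apply_eq_zero_iff]
  intro φ hφ
  exact hy (.toConv φ) fun z hz => (Submodule.mem_dualAnnihilator φ).1 hφ z hz

lemma ann_perp [FiniteDimensional k H] (S : Submodule k (DualAlg k H)) : ann (perp S) = S := by
  refine le_antisymm (fun f hf => ?_) fun f hf y hy => hy f hf
  let e := WithConv.linearEquiv k (H →ₗ[k] k)
  have h := Subspace.dualCoannihilator_dualAnnihilator_eq (W := S.map e.toLinearMap)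
  have : e f ∈ S.map e.toLinearMap := by
    rw [← h, Submodule.mem_dualAnnihilator]
    intro y hy
    refine hf y fun f' hf' => ?_
    exact (Submodule.mem_dualCoannihilator _).1 hy (e f') (Submodule.mem_map_of_mem hf')
  obtain ⟨f', hf', h'⟩ := this
  exact e.injective h' ▸ hf'

end DualSpace

/-! ### The two translation actions of the dual algebra -/

section DualAlgebra

variable {k H : Type*} [Field k] [AddCommGroup H] [Module k H] [Coalgebra k H]

/-- The right translate `f ⇀ y = y₁ f(y₂)`. -/
noncomputable def actRight (f : DualAlg k H) : H →ₗ[k] H := pairRight f.ofConv ∘ₗ comul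

/-- The left translate `y ↼ f = f(y₁) y₂`. -/
noncomputable def actLeft (f : DualAlg k H) : H →ₗ[k] H := pairLeft f.ofConv ∘ₗ comul

lemma actRight_apply (f : DualAlg k H) (y : H) :
    actRight f y = pairRight f.ofConv (comul (R := k) y) := rfl

lemma actLeft_apply (f : DualAlg k H) (y : H) :
    actLeft f y = pairLeft f.ofConv (comul (R := k) y) := rfl

lemma dual_mul_eq_actRight (f g : DualAlg k H) (y : H) : (f * g) y = f (actRight g y) := by
  rw [LinearMap.convMul_apply, actRight_apply]
  induction (comul (R := k) y) with
  | zero => simp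
  | tmul a b => simp [mul_comm]
  | add s t hs ht => simp only [map_add, hs, ht]

lemma dual_mul_eq_actLeft (f g : DualAlg k H) (y : H) : (f * g) y = g (actLeft f y) := by
  rw [LinearMap.convMul_apply, actLeft_apply]
  induction (comul (R := k) y) with
  | zero => simp
  | tmul a b => simp
  | add s t hs ht => simp only [map_add, hs, ht]

lemma actRight_actRight (f g : DualAlg k H) (y : H) :
    actRight f (actRight g y) = actRight (f * g) y :=
  eq_of_forall_dual fun h => by
    rw [← dual_mul_eq_actRight, ← dual_mul_eq_actRight, ← dual_mul_eq_actRight, mul_assoc]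

lemma actLeft_actLeft (f g : DualAlg k H) (y : H) :
    actLeft f (actLeft g y) = actLeft (g * f) y :=
  eq_of_forall_dual fun h => by
    rw [← dual_mul_eq_actLeft, ← dual_mul_eq_actLeft, ← dual_mul_eq_actLeft, mul_assoc]

lemma actRight_actLeft (f g : DualAlg k H) (y : H) :
    actRight f (actLeft g y) = actLeft g (actRight f y) :=
  eq_of_forall_dual fun h => by
    rw [← dual_mul_eq_actRight, ← dual_mul_eq_actLeft, ← dual_mul_eq_actLeft,
      ← dual_mul_eq_actRight, mul_assoc]

@[simp] lemma actRight_one (y : H) : actRight (1 : DualAlg k H) y = y :=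
  eq_of_forall_dual fun h => by rw [← dual_mul_eq_actRight, mul_one]

@[simp] lemma actLeft_one (y : H) : actLeft (1 : DualAlg k H) y = y :=
  eq_of_forall_dual fun h => by rw [← dual_mul_eq_actLeft, one_mul]

lemma actRight_sub (f g : DualAlg k H) (y : H) :
    actRight (f - g) y = actRight f y - actRight g y :=
  eq_of_forall_dual fun h => by
    rw [← dual_mul_eq_actRight, mul_sub, map_sub, ← dual_mul_eq_actRight, ← dual_mul_eq_actRight]
    rfl

lemma actRight_smul (c : k) (f : DualAlg k H) (y : H) :
    actRight (c • f) y = c • actRight f y :=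
  eq_of_forall_dual fun h => by
    rw [← dual_mul_eq_actRight, mul_smul_comm, map_smul, ← dual_mul_eq_actRight]
    rfl

lemma actLeft_sub (f g : DualAlg k H) (y : H) :
    actLeft (f - g) y = actLeft f y - actLeft g y :=
  eq_of_forall_dual fun h => by
    rw [← dual_mul_eq_actLeft, sub_mul, map_sub, ← dual_mul_eq_actLeft, ← dual_mul_eq_actLeft]
    rfl

lemma actLeft_smul (c : k) (f : DualAlg k H) (y : H) :
    actLeft (c • f) y = c • actLeft f y :=
  eq_of_forall_dual fun h => by
    rw [← dual_mul_eq_actLeft, smul_mul_assoc, map_smul, ← dual_mul_eq_actLeft]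
    rfl

@[simp] lemma actRight_groupLike (f : DualAlg k H) (g : GroupLike k H) :
    actRight f (g : H) = f (g : H) • (g : H) := by
  simp [actRight_apply, g.2.comul_eq_tmul_self]

@[simp] lemma actLeft_groupLike (f : DualAlg k H) (g : GroupLike k H) :
    actLeft f (g : H) = f (g : H) • (g : H) := by
  simp [actLeft_apply, g.2.comul_eq_tmul_self]

lemma dual_mul_groupLike (f f' : DualAlg k H) (g : GroupLike k H) :
    (f * f') (g : H) = f (g : H) * f' (g : H) := by
  rw [dual_mul_eq_actRight, actRight_groupLike, map_smul, smul_eq_mul, mul_comm]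

lemma dual_one_groupLike (g : GroupLike k H) : (1 : DualAlg k H) (g : H) = 1 := by
  simp [g.2.counit_eq_one]

end DualAlgebra

/-! ### Subcoalgebras and two-sided ideals of the dual algebra -/

section Subcoalgebras

variable {k H : Type*} [Field k] [AddCommGroup H] [Module k H] [Coalgebra k H]
  [FiniteDimensional k H]

lemma isSubcoalgebra_perp {P : Submodule k (DualAlg k H)}
    (hl : ∀ f, ∀ p ∈ P, f * p ∈ P) (hr : ∀ f, ∀ p ∈ P, p * f ∈ P) :
    IsSubcoalgebra k (perp P) := by
  intro x hx
  refine mem_range_map_of_contract_mem (fun f p hp => ?_) (fun f p hp => ?_)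
  · exact (dual_mul_eq_actRight p (.toConv f) x).symm.trans (hx _ (hr _ p hp))
  · exact (dual_mul_eq_actLeft (.toConv f) p x).symm.trans (hx _ (hl _ p hp))

omit [FiniteDimensional k H] in
lemma IsSubcoalgebra.mul_mem_ann_left {E : Submodule k H} (hE : IsSubcoalgebra k E)
    (f : DualAlg k H) {p : DualAlg k H} (hp : p ∈ ann E) : f * p ∈ ann E := fun y hy => by
  rw [dual_mul_eq_actLeft]
  exact hp _ (pairLeft_mem_of_mem_range (hE y hy) _)

omit [FiniteDimensional k H] in
lemma IsSubcoalgebra.mul_mem_ann_right {E : Submodule k H} (hE : IsSubcoalgebra k E)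
    (f : DualAlg k H) {p : DualAlg k H} (hp : p ∈ ann E) : p * f ∈ ann E := fun y hy => by
  rw [dual_mul_eq_actRight]
  exact hp _ (pairRight_mem_of_mem_range (hE y hy) _)

/-- Kernels of maps from the dual algebra onto simple rings are orthogonal to simple
subcoalgebras. -/
lemma isSimpleSubcoalgebra_perp_ker {S : Type*} [Ring S] [IsSimpleRing S]
    (ρ : DualAlg k H →+* S) (hρ : Function.Surjective ρ) (P : Submodule k (DualAlg k H))
    (hP : ∀ f, f ∈ P ↔ ρ f = 0) : IsSimpleSubcoalgebra k (perp P) where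
  isSubcoalgebra := isSubcoalgebra_perp
    (fun f p hp => by rw [hP, map_mul, (hP p).1 hp, mul_zero])
    (fun f p hp => by rw [hP, map_mul, (hP p).1 hp, zero_mul])
  ne_bot h := by
    have : (1 : DualAlg k H) ∈ ann (perp P) := by
      rw [h]
      intro y hy
      rw [(Submodule.mem_bot k).1 hy, map_zero]
    rw [ann_perp, hP, map_one] at this
    exact one_ne_zero this
  eq_bot_or_eq E hE hsub := by
    have hPE : P ≤ ann E := fun f hf y hy => hE hy f hf
    by_cases hEP : ann E ≤ P
    · right
      rw [← perp_ann E, le_antisymm hEP hPE]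
    · left
      obtain ⟨b, hb, hbP⟩ := Set.not_subset.1 hEP
      have hb0 : ρ b ≠ 0 := fun h => hbP ((hP b).2 h)
      -- The orthogonal of a subcoalgebra is a two-sided ideal, and so is its image under the
      -- surjection ρ. A nonzero image is all of `S`; since `ann E` contains the kernel, it then
      -- contains 1, which forces `E = ⊥`.
      let I : TwoSidedIdeal S := TwoSidedIdeal.mk' (ρ '' (ann E : Set (DualAlg k H)))
        ⟨0, Submodule.zero_mem _, map_zero _⟩
        (by
          rintro _ _ ⟨x, hx, rfl⟩ ⟨y, hy, rfl⟩
          exact ⟨x + y, Submodule.add_mem _ hx hy, map_add _ _ _⟩)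
        (by
          rintro _ ⟨x, hx, rfl⟩
          exact ⟨-x, Submodule.neg_mem _ hx, map_neg _ _⟩)
        (by
          rintro s _ ⟨y, hy, rfl⟩
          obtain ⟨x, rfl⟩ := hρ s
          exact ⟨x * y, hsub.mul_mem_ann_left x hy, map_mul _ _ _⟩)
        (by
          rintro _ s ⟨y, hy, rfl⟩
          obtain ⟨x, rfl⟩ := hρ s
          exact ⟨y * x, hsub.mul_mem_ann_right x hy, map_mul _ _ _⟩)
      have h1 : (1 : S) ∈ I := IsSimpleRing.one_mem_of_ne_zero_mem I hb0 
        ((TwoSidedIdeal.mem_mk' _ _ _ _ _ _ _).2 ⟨b, hb, rfl⟩)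
      obtain ⟨c, hc, hc1⟩ := (TwoSidedIdeal.mem_mk' _ _ _ _ _ _ _).1 h1
      have hone : (1 : DualAlg k H) ∈ ann E := by
        have : (1 - c : DualAlg k H) ∈ ann E := hPE ((hP _).2 (by
          rw [map_sub, map_one, hc1, sub_self]))
        have := Submodule.add_mem _ this hc
        rwa [sub_add_cancel] at this
      rw [eq_bot_iff, ← perp_ann E]
      intro y hy
      rw [Submodule.mem_bot]
      refine eq_of_forall_dual (k := k) fun f => ?_
      rw [map_zero]
      have := hsub.mul_mem_ann_left f hone
      rw [mul_one] at this
      exact hy f this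

omit [FiniteDimensional k H] in
/-- A one-dimensional subcoalgebra contains a group-like element. -/
lemma IsSubcoalgebra.exists_groupLike {D : Submodule k H} (hD : IsSubcoalgebra k D)
    (h1 : Module.finrank k D = 1) : ∃ g : GroupLike k H, D = Submodule.span k {(g : H)} := by
  obtain ⟨d, hd0, hd⟩ := finrank_eq_one_iff'.1 h1
  have key : ∀ s : D ⊗[k] D, ∃ c : k, TensorProduct.map D.subtype D.subtype s =
      c • ((d : H) ⊗ₜ[k] (d : H)) := by
    intro s
    induction s with
    | zero => exact ⟨0, by simp⟩
    | tmul a b =>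
      obtain ⟨ca, rfl⟩ := hd a
      obtain ⟨cb, rfl⟩ := hd b
      exact ⟨ca * cb, by
        simp [TensorProduct.smul_tmul', TensorProduct.tmul_smul, smul_smul, mul_comm]⟩
    | add s t hs ht =>
      obtain ⟨a, ha⟩ := hs
      obtain ⟨b, hb⟩ := ht
      exact ⟨a + b, by rw [map_add, ha, hb, add_smul]⟩
  obtain ⟨s, hs⟩ := hD d d.2
  obtain ⟨c, hc⟩ := key s
  rw [hs] at hc
  have hd0' : (d : H) ≠ 0 := fun h => hd0 (Subtype.ext h)
  have hcounit : c * counit (R := k) (d : H) = 1 := by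
    have h := rTensor_counit_comul (R := k) (d : H)
    rw [hc, map_smul, LinearMap.rTensor_tmul] at h
    have h' := congrArg (TensorProduct.lid k H) h
    simp only [map_smul, TensorProduct.lid_tmul, one_smul, smul_smul] at h'
    have : (c * counit (R := k) (d : H) - 1) • (d : H) = 0 := by rw [sub_smul, h', one_smul, sub_self]
    exact sub_eq_zero.1 ((smul_eq_zero.1 this).resolve_right hd0')
  have hc0 : c ≠ 0 := fun h => by simp [h] at hcounit
  refine ⟨⟨c • (d : H), by simpa using hcounit, ?_⟩, ?_⟩
  · rw [map_smul, hc, TensorProduct.smul_tmul', TensorProduct.tmul_smul]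
  · change D = Submodule.span k {c • (d : H)}
    rw [Submodule.span_singleton_smul_eq (IsUnit.mk0 c hc0)]
    refine le_antisymm (fun x hx => ?_) ?_
    · obtain ⟨a, ha⟩ := hd ⟨x, hx⟩
      exact Submodule.mem_span_singleton.2 ⟨a, congrArg Subtype.val ha⟩
    · rw [Submodule.span_singleton_le_iff_mem]
      exact d.2

end Subcoalgebras

/-! ### Pointedness and nilpotency of the ideal of forms vanishing on G -/

section Radical

instance isSimpleRing_moduleEnd {D V : Type*} [DivisionRing D] [AddCommGroup V] [Module D V]
    [Module.Finite D V] [Nontrivial V] : IsSimpleRing (Module.End D V) := by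
  let b := Module.finBasis D V
  have : Nonempty (Fin (Module.finrank D V)) := b.index_nonempty
  have : IsSimpleRing (Module.End D D) :=
    IsSimpleRing.of_ringEquiv (RingEquiv.moduleEndSelf D) inferInstance
  exact IsSimpleRing.of_ringEquiv
    ((endVecRingEquivMatrixEnd (Fin (Module.finrank D V)) D D).symm.trans
      (LinearEquiv.conjRingEquiv b.equivFun).symm) inferInstance

variable {k H : Type*} [Field k] [AddCommGroup H] [Module k H] [Coalgebra k H]

variable (k H) in
/-- The linear forms vanishing on all group-like elements. -/
def groupAnn : Submodule k (DualAlg k H) :=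
  ann (Submodule.span k (Set.range (GroupLike.val : GroupLike k H → H)))

lemma mem_groupAnn {f : DualAlg k H} :
    f ∈ groupAnn k H ↔ ∀ g : GroupLike k H, f (g : H) = 0 := by
  refine ⟨fun h g => h _ (Submodule.subset_span ⟨g, rfl⟩), fun h y hy => ?_⟩
  have : Submodule.span k (Set.range (GroupLike.val : GroupLike k H → H)) ≤
      LinearMap.ker f.ofConv := by
    rw [Submodule.span_le]
    rintro _ ⟨g, rfl⟩
    exact h g
  exact this hy

variable [FiniteDimensional k H]

/-- For a maximal left ideal `M`, density maps the dual algebra onto the endomorphism ring of the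
simple module `S` over its own endomorphism division ring, which is a simple ring. The orthogonal of
the kernel is thus a simple subcoalgebra, hence the line of a group-like element; a form vanishing
on G annihilates `S` and so lies in `M`. -/
lemma groupAnn_le_jacobson (hp : IsPointedCoalgebra k H) {f : DualAlg k H}
    (hf : f ∈ groupAnn k H) : f ∈ Ring.jacobson (DualAlg k H) := by
  classical
  rw [Ring.jacobson_eq_sInf_isMaximal, Submodule.mem_sInf]
  intro (M : Ideal (DualAlg k H)) hM
  have hM' : M.IsMaximal := hM
  let S := DualAlg k H ⧸ M
  have : IsSimpleModule (DualAlg k H) S := isSimpleModule_iff_isCoatom.2 hM'.out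
  have : Nontrivial S := IsSimpleModule.nontrivial (DualAlg k H) S
  have : Module.Finite k S := Module.Finite.of_surjective
    ((Submodule.mkQ M).restrictScalars k) (Submodule.mkQ_surjective M)
  have : Module.Finite (Module.End (DualAlg k H) S) S :=
    Module.Finite.of_restrictScalars_finite k _ S
  let ρ := Module.toModuleEnd (Module.End (DualAlg k H) S) (S := DualAlg k H) S
  have hρ : Function.Surjective ρ := Module.Finite.toModuleEnd_moduleEnd_surjective
  let P : Submodule k (DualAlg k H) :=
    { carrier := {f | ∀ s : S, f • s = 0}
      zero_mem' := fun s => zero_smul (DualAlg k H) s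
      add_mem' := fun {a b} ha hb s => by rw [add_smul, ha, hb, add_zero]
      smul_mem' := fun c a ha s => (smul_assoc c a s).trans (by rw [ha s, smul_zero]) }
  have hsimple := isSimpleSubcoalgebra_perp_ker ρ hρ P fun f =>
    ⟨fun h => LinearMap.ext h, fun h s => LinearMap.congr_fun h s⟩
  obtain ⟨g, hg⟩ := hsimple.isSubcoalgebra.exists_groupLike (hp _ hsimple)
  have hfP : f ∈ P := by
    rw [← ann_perp P, hg]
    intro y hy
    obtain ⟨c, rfl⟩ := Submodule.mem_span_singleton.1 hy
    rw [map_smul, mem_groupAnn.1 hf g, smul_zero]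
  have h0 := hfP (Submodule.Quotient.mk 1)
  rw [← Submodule.Quotient.mk_smul, smul_eq_mul, mul_one] at h0
  exact (Submodule.Quotient.mk_eq_zero M).1 h0

/-- In a pointed coalgebra the forms vanishing on the group-likes form a nilpotent ideal. -/
lemma exists_groupAnn_pow_eq_bot (hp : IsPointedCoalgebra k H) : ∃ n, groupAnn k H ^ n = ⊥ := by
  have : IsArtinianRing (DualAlg k H) := IsArtinianRing.of_finite k _
  obtain ⟨n, hn⟩ := IsArtinianRing.isNilpotent_jacobson_bot (R := DualAlg k H)
  rw [Ideal.jacobson_bot] at hn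
  have key : ∀ m, ∀ f ∈ groupAnn k H ^ m, f ∈ Ring.jacobson (DualAlg k H) ^ m := by
    intro m
    induction m with
    | zero => intro f _; rw [Submodule.pow_zero, Ideal.one_eq_top]; trivial
    | succ m ih =>
      have : groupAnn k H ^ (m + 1) ≤
          (Ring.jacobson (DualAlg k H) ^ (m + 1)).restrictScalars k := by
        rw [Submodule.pow_succ, Submodule.mul_le]
        intro a ha b hb
        rw [Submodule.restrictScalars_mem, Submodule.pow_succ]
        exact Ideal.mul_mem_mul (ih a ha) (groupAnn_le_jacobson hp hb)
      exact fun f hf => this hf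
  refine ⟨n, eq_bot_iff.2 fun f hf => ?_⟩
  have := key n f hf
  rw [hn] at this
  exact this

end Radical

/-! ### Powers of J and the coradical filtration -/

section CoradicalFiltration

variable {k H : Type*} [Field k] [AddCommGroup H] [Module k H] [Coalgebra k H]

variable (k H) in
/-- The powers of the ideal `groupAnn`, the zeroth power being the whole dual algebra. -/
noncomputable def radPow (m : ℕ) : Submodule k (DualAlg k H) := ⊤ * groupAnn k H ^ m

variable (k H) in
/-- The coradical filtration, shifted by one: `corad 0 = 0` and `corad 1` is the coradical. -/
noncomputable def corad (m : ℕ) : Submodule k H := perp (radPow k H m)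

lemma dual_submodule_mul_assoc (S T U : Submodule k (DualAlg k H)) : S * T * U = S * (T * U) :=
  mul_assoc S T U

lemma top_mul_groupAnn : (⊤ : Submodule k (DualAlg k H)) * groupAnn k H = groupAnn k H := by
  refine le_antisymm (Submodule.mul_le.2 fun f _ g hg => ?_) fun f hf => ?_
  · rw [mem_groupAnn] at hg ⊢
    intro a
    rw [dual_mul_groupLike, hg, mul_zero]
  · simpa using Submodule.mul_mem_mul (Submodule.mem_top (x := (1 : DualAlg k H))) hf

lemma groupAnn_mul_top : groupAnn k H * (⊤ : Submodule k (DualAlg k H)) = groupAnn k H := by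
  refine le_antisymm (Submodule.mul_le.2 fun f hf g _ => ?_) fun f hf => ?_
  · rw [mem_groupAnn] at hf ⊢
    intro a
    rw [dual_mul_groupLike, hf, zero_mul]
  · simpa using Submodule.mul_mem_mul hf (Submodule.mem_top (x := (1 : DualAlg k H)))

lemma radPow_zero : radPow k H 0 = ⊤ := by
  rw [radPow, Submodule.pow_zero]
  exact Submodule.mul_one _

lemma radPow_succ (m : ℕ) : radPow k H (m + 1) = radPow k H m * groupAnn k H := by
  rw [radPow, radPow, Submodule.pow_succ, dual_submodule_mul_assoc]

lemma radPow_one : radPow k H 1 = groupAnn k H := by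
  rw [radPow_succ, radPow_zero, top_mul_groupAnn]

lemma radPow_mul_top (m : ℕ) : radPow k H m * ⊤ = radPow k H m := by
  cases m with
  | zero =>
    rw [radPow_zero, eq_top_iff]
    intro f _
    simpa using Submodule.mul_mem_mul (Submodule.mem_top (x := f))
      (Submodule.mem_top (x := (1 : DualAlg k H)))
  | succ m => rw [radPow_succ, dual_submodule_mul_assoc, groupAnn_mul_top]

lemma radPow_add (m n : ℕ) : radPow k H (m + n) = radPow k H m * radPow k H n := by
  induction n with
  | zero => rw [radPow_zero, radPow_mul_top, add_zero]
  | succ n ih => rw [← add_assoc, radPow_succ, radPow_succ, ih, dual_submodule_mul_assoc]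

lemma radPow_succ_le (m : ℕ) : radPow k H (m + 1) ≤ radPow k H m := by
  rw [radPow_succ]
  calc radPow k H m * groupAnn k H ≤ radPow k H m * ⊤ := mul_le_mul_right le_top _
    _ = _ := radPow_mul_top m

lemma radPow_antitone : Antitone (radPow k H) := antitone_nat_of_succ_le radPow_succ_le

lemma radPow_eq_bot {n : ℕ} (h : groupAnn k H ^ n = ⊥) : radPow k H n = ⊥ := by
  rw [radPow, h, Submodule.mul_bot]

lemma mul_mem_radPow {m n : ℕ} {f g : DualAlg k H} (hf : f ∈ radPow k H m)
    (hg : g ∈ radPow k H n) : f * g ∈ radPow k H (m + n) := by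
  rw [radPow_add]
  exact Submodule.mul_mem_mul hf hg

lemma mem_radPow_zero (f : DualAlg k H) : f ∈ radPow k H 0 := by
  rw [radPow_zero]
  trivial

lemma mem_radPow_one {f : DualAlg k H} :
    f ∈ radPow k H 1 ↔ ∀ g : GroupLike k H, f (g : H) = 0 := by
  rw [radPow_one, mem_groupAnn]

lemma corad_zero : corad k H 0 = ⊥ := by
  rw [eq_bot_iff]
  intro y hy
  refine eq_of_forall_dual (k := k) fun f => ?_
  rw [map_zero, hy f (mem_radPow_zero f)]

lemma corad_mono : Monotone (corad k H) := fun _ _ h _ hy f hf => hy f (radPow_antitone h hf)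

lemma corad_one :
    corad k H 1 = Submodule.span k (Set.range (GroupLike.val : GroupLike k H → H)) := by
  rw [corad, radPow_one, groupAnn, perp_ann]

lemma groupLike_mem_corad_one (g : GroupLike k H) : (g : H) ∈ corad k H 1 := by
  rw [corad_one]
  exact Submodule.subset_span ⟨g, rfl⟩

lemma groupLike_mem_corad (g : GroupLike k H) {m : ℕ} (hm : 1 ≤ m) : (g : H) ∈ corad k H m :=
  corad_mono hm (groupLike_mem_corad_one g)

lemma mem_radPow_iff [FiniteDimensional k H] {m : ℕ} {f : DualAlg k H} :
    f ∈ radPow k H m ↔ ∀ y ∈ corad k H m, f y = 0 := by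
  conv_lhs => rw [← ann_perp (radPow k H m)]
  rfl

lemma actRight_mem_corad {m j : ℕ} {f : DualAlg k H} (hf : f ∈ radPow k H j) {y : H}
    (hy : y ∈ corad k H (m + j)) : actRight f y ∈ corad k H m := fun g hg => by
  rw [← dual_mul_eq_actRight]
  exact hy _ (mul_mem_radPow hg hf)

lemma actLeft_mem_corad {m j : ℕ} {f : DualAlg k H} (hf : f ∈ radPow k H j) {y : H}
    (hy : y ∈ corad k H (m + j)) : actLeft f y ∈ corad k H m := fun g hg => by
  rw [← dual_mul_eq_actLeft]
  exact hy _ (by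
    rw [add_comm]
    exact mul_mem_radPow hf hg)

lemma actRight_mem_corad_self {m : ℕ} (f : DualAlg k H) {y : H} (hy : y ∈ corad k H m) :
    actRight f y ∈ corad k H m := actRight_mem_corad (mem_radPow_zero f) hy

lemma actLeft_mem_corad_self {m : ℕ} (f : DualAlg k H) {y : H} (hy : y ∈ corad k H m) :
    actLeft f y ∈ corad k H m := actLeft_mem_corad (mem_radPow_zero f) hy

lemma mem_corad_succ {m : ℕ} {y : H} :
    y ∈ corad k H (m + 1) ↔ ∀ f ∈ radPow k H 1, actRight f y ∈ corad k H m := by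
  refine ⟨fun hy f hf => actRight_mem_corad hf hy, fun h => ?_⟩
  rw [corad, mem_perp, radPow_succ, ← radPow_one]
  intro f hf
  induction hf using Submodule.mul_induction_on' with
  | mem_mul_mem a ha b hb =>
    rw [dual_mul_eq_actRight]
    exact h b hb a ha
  | add a _ b _ ha hb =>
    change a y + b y = 0
    rw [ha, hb, add_zero]

instance [FiniteDimensional k H] : Finite (GroupLike k H) :=
  (linearIndep_groupLikeVal (R := k) (A := H)).finite

variable (k H) in
open Classical in
lemma exists_dual_groupLike : ∃ e : GroupLike k H → DualAlg k H,
    ∀ g h : GroupLike k H, e g (h : H) = if g = h then 1 else 0 := by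
  have li := linearIndep_groupLikeVal (R := k) (A := H)
  choose e he using fun g : GroupLike k H =>
    LinearMap.exists_extend ((Finsupp.lapply g) ∘ₗ li.repr)
  refine ⟨fun g => .toConv (e g), fun g h => ?_⟩
  have := LinearMap.congr_fun (he g) ⟨h, Submodule.subset_span ⟨h, rfl⟩⟩
  simp only [LinearMap.comp_apply, Submodule.subtype_apply, li.repr_eq_single h ⟨(h : H), _⟩ rfl,
    Finsupp.lapply_apply, Finsupp.single_apply] at this
  simpa [eq_comm] using this

variable (k H) in
/-- A linear form on a coalgebra taking the value `1` at `g` and `0` at all other group-likes. -/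
noncomputable def groupDual : GroupLike k H → DualAlg k H := (exists_dual_groupLike k H).choose

open Classical in
lemma groupDual_apply (g h : GroupLike k H) :
    groupDual k H g (h : H) = if g = h then 1 else 0 :=
  (exists_dual_groupLike k H).choose_spec g h

lemma groupDual_self (g : GroupLike k H) : groupDual k H g (g : H) = 1 := by
  rw [groupDual_apply, if_pos rfl]

lemma groupDual_ne {g h : GroupLike k H} (hgh : g ≠ h) : groupDual k H g (h : H) = 0 := by
  rw [groupDual_apply, if_neg hgh]

omit [Coalgebra k H] in
lemma dual_sum_apply {ι : Type*} (s : Finset ι) (f : ι → DualAlg k H) (y : H) :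
    (∑ i ∈ s, f i) y = ∑ i ∈ s, f i y := by
  rw [WithConv.ofConv_sum, LinearMap.sum_apply]

lemma sum_groupDual_sub_one_mem [Fintype (GroupLike k H)] :
    ∑ g : GroupLike k H, groupDual k H g - 1 ∈ radPow k H 1 := by
  classical
  rw [mem_radPow_one]
  intro h
  change (∑ g : GroupLike k H, groupDual k H g) (h : H) - (1 : DualAlg k H) (h : H) = 0
  rw [dual_sum_apply, dual_one_groupLike]
  simp [groupDual_apply]

omit [Coalgebra k H] in
variable (k) in
/-- A basis consisting of vectors of `U` and of vectors whose coordinate forms vanish on `U`. -/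
lemma exists_adapted_basis [FiniteDimensional k H] (U : Submodule k H) :
    ∃ (ι : Type) (_ : Fintype ι) (b : Module.Basis ι k H),
      ∀ i, b i ∈ U ∨ (WithConv.toConv (b.coord i) : DualAlg k H) ∈ ann U := by
  obtain ⟨V, hV⟩ := Submodule.exists_isCompl U
  let b := ((Module.finBasis k U).prod (Module.finBasis k V)).map
    (Submodule.prodEquivOfIsCompl U V hV)
  refine ⟨_, inferInstance, b, ?_⟩
  rintro (i | i)
  · left
    simp [b]
  · right
    intro y hy
    change b.coord (Sum.inr i) y = 0
    simp only [b, Module.Basis.coord_apply, Module.Basis.map_repr, LinearEquiv.trans_apply]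
    have : (Submodule.prodEquivOfIsCompl U V hV).symm y = (⟨y, hy⟩, 0) := by
      rw [LinearEquiv.symm_apply_eq]
      simp
    rw [this]
    simp

end CoradicalFiltration

/-! ### Compatibility of the coradical filtration with multiplication -/

section Multiplicative

variable {k H : Type*} [Field k] [Ring H] [HopfAlgebra k H]

/-- The linear form `y ↦ f (x * y)`. -/
noncomputable def dualMulLeft (x : H) (f : DualAlg k H) : DualAlg k H :=
  .toConv (f.ofConv ∘ₗ LinearMap.mulLeft k x)

/-- The linear form `y ↦ f (y * x)`. -/
noncomputable def dualMulRight (x : H) (f : DualAlg k H) : DualAlg k H :=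
  .toConv (f.ofConv ∘ₗ LinearMap.mulRight k x)

@[simp] lemma dualMulLeft_apply (x : H) (f : DualAlg k H) (y : H) :
    dualMulLeft x f y = f (x * y) := rfl

@[simp] lemma dualMulRight_apply (x : H) (f : DualAlg k H) (y : H) :
    dualMulRight x f y = f (y * x) := rfl

lemma pairRight_tmul_mul (f : DualAlg k H) (a c : H) (t : H ⊗[k] H) :
    pairRight f.ofConv ((a ⊗ₜ[k] c) * t) = a * pairRight (dualMulLeft c f).ofConv t := by
  induction t with
  | zero => simp
  | tmul v w => simp
  | add s t hs ht => simp only [mul_add, map_add, hs, ht]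

lemma actRight_mul (f : DualAlg k H) (x y : H) :
    actRight f (x * y) = pairRight f.ofConv (comul (R := k) x * comul (R := k) y) := by
  rw [actRight_apply, Bialgebra.comul_mul]

lemma actRight_mul_basis {ι : Type*} [Fintype ι] (b : Module.Basis ι k H) (f : DualAlg k H)
    (x y : H) : actRight f (x * y) =
      ∑ i, actRight (.toConv (b.coord i)) x * actRight (dualMulLeft (b i) f) y := by
  rw [actRight_mul]
  conv_lhs => rw [← pairRight_basis_sum b (comul (R := k) x), Finset.sum_mul, map_sum]
  exact Finset.sum_congr rfl fun i _ => pairRight_tmul_mul _ _ _ _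

lemma actRight_groupLike_mul (f : DualAlg k H) (g : GroupLike k H) (y : H) :
    actRight f ((g : H) * y) = (g : H) * actRight (dualMulLeft (g : H) f) y := by
  rw [actRight_mul, g.2.comul_eq_tmul_self, pairRight_tmul_mul]
  rfl

/-- Left multiplication by a group-like element is a coalgebra map, so its transpose is
multiplicative. -/
lemma dualMulLeft_mul (g : GroupLike k H) (f f' : DualAlg k H) :
    dualMulLeft (g : H) (f * f') = dualMulLeft (g : H) f * dualMulLeft (g : H) f' := by
  ext y
  change (f * f') ((g : H) * y) = _
  rw [dual_mul_eq_actRight, actRight_groupLike_mul]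
  exact (dual_mul_eq_actRight (dualMulLeft (g : H) f) _ y).symm

lemma dualMulLeft_one (g : GroupLike k H) :
    dualMulLeft (g : H) (1 : DualAlg k H) = 1 := by
  ext y
  change (1 : DualAlg k H) ((g : H) * y) = (1 : DualAlg k H) y
  simp [g.2.counit_eq_one]

lemma pairRight_mul_comul_mem {U U' V : Submodule k H} {s : H ⊗[k] H}
    (hs : s ∈ LinearMap.range (TensorProduct.map U.subtype U'.subtype)) (f : DualAlg k H) (y : H)
    (h : ∀ u ∈ U, ∀ v ∈ U', u * actRight (dualMulLeft v f) y ∈ V) :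
    pairRight f.ofConv (s * comul (R := k) y) ∈ V := by
  obtain ⟨s, rfl⟩ := hs
  induction s with
  | zero => simp
  | tmul u v =>
    rw [TensorProduct.map_tmul, pairRight_tmul_mul]
    exact h u u.2 v v.2
  | add s t hs ht =>
    rw [map_add, add_mul, map_add]
    exact V.add_mem hs ht

lemma corad_one_mul_mem {x y : H} (hx : x ∈ corad k H 1) (hy : y ∈ corad k H 1) :
    x * y ∈ corad k H 1 := by
  have : corad k H 1 * corad k H 1 ≤ corad k H 1 := by
    rw [corad_one, Submodule.span_mul_span, Submodule.span_le]
    rintro _ ⟨_, ⟨g, rfl⟩, _, ⟨h, rfl⟩, rfl⟩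
    exact Submodule.subset_span ⟨g * h, rfl⟩
  exact this (Submodule.mul_mem_mul hx hy)

lemma dualMulLeft_mem_radPow_one {x : H} (hx : x ∈ corad k H 1) {f : DualAlg k H}
    (hf : f ∈ radPow k H 1) : dualMulLeft x f ∈ radPow k H 1 := by
  rw [mem_radPow_one]
  intro g
  exact corad_one_mul_mem hx (groupLike_mem_corad_one g) f hf

variable [FiniteDimensional k H]

/-- With the index shift this is the usual rule that filtration degrees add. Acting by a form of J
on `x * y` lowers one factor: expanding over a basis adapted to kG, either the basis vector is in kG
and `y` drops, or its coordinate form is in J and `x` drops. -/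
lemma mul_mem_corad {a b c : ℕ} (h : a + b ≤ c + 1) {x y : H} (hx : x ∈ corad k H a)
    (hy : y ∈ corad k H b) : x * y ∈ corad k H c := by
  induction c generalizing a b x y with
  | zero =>
    rcases Nat.eq_zero_or_pos a with rfl | ha
    · rw [corad_zero, Submodule.mem_bot] at hx
      simp [hx]
    · obtain rfl : b = 0 := by omega
      rw [corad_zero, Submodule.mem_bot] at hy
      simp [hy]
  | succ c ih =>
    rcases a with _ | a
    · rw [corad_zero, Submodule.mem_bot] at hx
      simp [hx]
    rcases b with _ | b
    · rw [corad_zero, Submodule.mem_bot] at hy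
      simp [hy]
    rw [mem_corad_succ]
    intro f hf
    obtain ⟨ι, _, B, hB⟩ := exists_adapted_basis k (corad k H 1)
    rw [actRight_mul_basis B]
    refine Submodule.sum_mem _ fun i _ => ?_
    rcases hB i with hi | hi
    · exact ih (a := a + 1) (b := b) (by omega) (actRight_mem_corad_self _ hx)
        (actRight_mem_corad (dualMulLeft_mem_radPow_one hi hf) hy)
    · exact ih (a := a) (b := b + 1) (by omega) (actRight_mem_corad (mem_radPow_iff.2 hi) hx)
        (actRight_mem_corad_self _ hy)

lemma groupLike_mul_mem_corad (g : GroupLike k H) {m : ℕ} {y : H} (hy : y ∈ corad k H m) :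
    (g : H) * y ∈ corad k H m :=
  mul_mem_corad (by omega) (groupLike_mem_corad_one g) hy

lemma mul_groupLike_mem_corad (g : GroupLike k H) {m : ℕ} {y : H} (hy : y ∈ corad k H m) :
    y * (g : H) ∈ corad k H m :=
  mul_mem_corad le_rfl hy (groupLike_mem_corad_one g)

end Multiplicative

/-! ### Skew-primitives commuting with their degree, modulo lower terms, are decomposable -/

section Nilpotency

variable {k H : Type*} [Field k] [Ring H] [HopfAlgebra k H]

lemma actRight_mul_of_comul {z b : H} {γ : GroupLike k H} {s : H ⊗[k] H}
    (hz : comul (R := k) z = z ⊗ₜ[k] (1 : H) + (γ : H) ⊗ₜ[k] z + s) (f : DualAlg k H) :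
    actRight f (z * b) = z * actRight f b + (γ : H) * actRight (dualMulLeft z f) b +
      pairRight f.ofConv (s * comul (R := k) b) := by
  rw [actRight_mul, hz, add_mul, add_mul, map_add, map_add, pairRight_tmul_mul,
    pairRight_tmul_mul]
  congr 3
  change pairRight (dualMulLeft 1 f).ofConv _ = pairRight f.ofConv _
  congr 2
  ext y
  simp [dualMulLeft]

variable [FiniteDimensional k H]

variable {z : H} {γ : GroupLike k H} {d : ℕ} {s : H ⊗[k] H} {ω : DualAlg k H}

/-- A Leibniz rule modulo lower terms. The form y ↦ ω(zy) is 1 on G, hence congruent to the unit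
modulo J; the terms from `s` are small because y ↦ ω(vy) lies in J^d for v in `corad k H d`. -/
lemma actRight_mul_sub_mem_corad
    (hz : comul (R := k) z = z ⊗ₜ[k] (1 : H) + (γ : H) ⊗ₜ[k] z + s)
    (hs : s ∈ LinearMap.range
      (TensorProduct.map (corad k H d).subtype (corad k H d).subtype))
    (hω : ∀ a ∈ corad k H d, ∀ b ∈ corad k H d, ω (a * b) = 0)
    (hω' : ∀ h : GroupLike k H, ω (z * h) = 1) {m : ℕ} {b : H} (hb : b ∈ corad k H (m + 1)) :
    actRight ω (z * b) - z * actRight ω b - (γ : H) * b ∈ corad k H m := by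
  rw [actRight_mul_of_comul hz]
  have e : z * actRight ω b + (γ : H) * actRight (dualMulLeft z ω) b +
      pairRight ω.ofConv (s * comul (R := k) b) - z * actRight ω b - (γ : H) * b =
      (γ : H) * actRight (dualMulLeft z ω - 1) b +
        pairRight ω.ofConv (s * comul (R := k) b) := by
    rw [actRight_sub, actRight_one, mul_sub]
    abel
  rw [e]
  refine Submodule.add_mem _ (groupLike_mul_mem_corad _ (actRight_mem_corad ?_ hb))
    (pairRight_mul_comul_mem hs ω b fun u hu v hv => ?_)
  · rw [mem_radPow_one]
    intro h
    change ω (z * h) - (1 : DualAlg k H) (h : H) = 0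
    rw [hω', dual_one_groupLike, sub_self]
  · have hv' : dualMulLeft v ω ∈ radPow k H d := mem_radPow_iff.2 fun y hy => hω v hv y hy
    rcases le_or_gt d (m + 1) with hd | hd
    · have hb' : b ∈ corad k H ((m + 1 - d) + d) := by rwa [Nat.sub_add_cancel hd]
      exact mul_mem_corad (by omega) hu (actRight_mem_corad hv' hb')
    -- Here `d` exceeds the filtration index of `b`, so a form in J^d acts on `b` as zero.
    · have hb' : b ∈ corad k H (0 + d) := corad_mono (by omega) hb
      have := actRight_mem_corad hv' hb'
      rw [corad_zero, Submodule.mem_bot] at this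
      rw [this, mul_zero]
      exact Submodule.zero_mem _

lemma pow_mem_corad (hz : z ∈ corad k H (d + 1)) (m : ℕ) : z ^ m ∈ corad k H (d * m + 1) := by
  induction m with
  | zero => simpa using groupLike_mem_corad_one (1 : GroupLike k H)
  | succ m ih =>
    rw [pow_succ']
    exact mul_mem_corad (by rw [Nat.mul_succ]; omega) hz ih

/-- The derivative of z^(m+1): the Leibniz rule yields m+1 terms, which coincide modulo lower terms
once γ is moved to the front by `hcomm`. -/
lemma actRight_pow_sub_mem_corad (hzd : z ∈ corad k H (d + 1))
    (hz : comul (R := k) z = z ⊗ₜ[k] (1 : H) + (γ : H) ⊗ₜ[k] z + s)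
    (hs : s ∈ LinearMap.range
      (TensorProduct.map (corad k H d).subtype (corad k H d).subtype))
    (hd : 1 ≤ d)
    (hcomm : z * (γ : H) - (γ : H) * z ∈ corad k H d)
    (hω : ∀ a ∈ corad k H d, ∀ b ∈ corad k H d, ω (a * b) = 0)
    (hω' : ∀ h : GroupLike k H, ω (z * h) = 1) (m : ℕ) :
    actRight ω (z ^ (m + 1)) - ((m + 1 : ℕ) : k) • ((γ : H) * z ^ m) ∈ corad k H (d * m) := by
  induction m with
  | zero =>
    have h1 : ω (1 : H) = 0 := by
      have := hω 1 (groupLike_mem_corad 1 hd) 1 (groupLike_mem_corad 1 hd)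
      simpa using this
    have h2 : actRight ω (1 : H) = 0 := by
      have := actRight_groupLike ω (1 : GroupLike k H)
      rw [GroupLike.val_one] at this
      rw [this, h1, zero_smul]
    have := actRight_mul_sub_mem_corad hz hs hω hω' (m := 0) (b := 1)
      (groupLike_mem_corad_one (1 : GroupLike k H))
    simpa [h2] using this
  | succ m ih =>
    have key := actRight_mul_sub_mem_corad hz hs hω hω' (m := d * (m + 1))
      (pow_mem_corad hzd (m + 1))
    have h1 : z * (actRight ω (z ^ (m + 1)) - ((m + 1 : ℕ) : k) • ((γ : H) * z ^ m)) ∈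
        corad k H (d * (m + 1)) := mul_mem_corad (by rw [Nat.mul_succ]; omega) hzd ih
    have h2 : ((m + 1 : ℕ) : k) • ((z * (γ : H) - (γ : H) * z) * z ^ m) ∈
        corad k H (d * (m + 1)) := Submodule.smul_mem _ _
      (mul_mem_corad (by rw [Nat.mul_succ]; omega) hcomm (pow_mem_corad hzd m))
    have := Submodule.add_mem _ (Submodule.add_mem _ key h1) h2
    convert this using 1
    rw [pow_succ' z (m + 1), pow_succ' z m, sub_mul, smul_sub, mul_sub, mul_smul_comm]
    simp only [mul_assoc, Nat.cast_add, Nat.cast_one, add_smul, one_smul]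
    abel

/-- Iterated pairing of products of linear forms with powers of `z`. -/
lemma prod_apply_pow (hzd : z ∈ corad k H (d + 1))
    (hz : comul (R := k) z = z ⊗ₜ[k] (1 : H) + (γ : H) ⊗ₜ[k] z + s)
    (hs : s ∈ LinearMap.range
      (TensorProduct.map (corad k H d).subtype (corad k H d).subtype))
    (hd : 1 ≤ d)
    (hcomm : z * (γ : H) - (γ : H) * z ∈ corad k H d) (m : ℕ) (l : List (DualAlg k H))
    (hl : l.length = m)
    (hω : ∀ ω ∈ l, (∀ a ∈ corad k H d, ∀ b ∈ corad k H d, ω (a * b) = 0) ∧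
      ∀ h : GroupLike k H, ω (z * h) = 1) :
    l.prod ∈ radPow k H (d * m) ∧ l.prod (z ^ m) = (m.factorial : k) := by
  induction m generalizing l with
  | zero =>
    rw [List.length_eq_zero_iff] at hl
    subst hl
    refine ⟨mem_radPow_zero _, ?_⟩
    simp
  | succ m ih =>
    rcases List.eq_nil_or_concat' l with rfl | ⟨l', ω, rfl⟩
    · simp at hl
    have hl' : l'.length = m := by simpa using hl
    have hPω := hω ω (by simp)
    have hPl' := fun ω' (h : ω' ∈ l') => hω ω' (by simp [h])
    obtain ⟨ih1, -⟩ := ih l' hl' hPl'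
    have hωd : ω ∈ radPow k H d := mem_radPow_iff.2 fun y hy => by
      have := hPω.1 1 (groupLike_mem_corad 1 hd) y hy
      simpa using this
    rw [List.prod_append, List.prod_singleton]
    refine ⟨by rw [Nat.mul_succ]; exact mul_mem_radPow ih1 hωd, ?_⟩
    have h1 := mem_radPow_iff.1 ih1 _
      (actRight_pow_sub_mem_corad hzd hz hs hd hcomm hPω.1 hPω.2 m)
    rw [map_sub, map_smul, sub_eq_zero] at h1
    rw [dual_mul_eq_actRight, h1]
    -- The factor γ left by the derivative is absorbed by translating every form in the list.
    -- Translated forms satisfy the same hypotheses but need not equal the original ones, hence the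
    -- induction over lists rather than powers of one form.
    have hprod : ∀ l : List (DualAlg k H),
        dualMulLeft (γ : H) l.prod = (l.map (dualMulLeft (γ : H))).prod := by
      intro l
      induction l with
      | nil => exact dualMulLeft_one γ
      | cons a l ih => rw [List.prod_cons, dualMulLeft_mul, ih, List.map_cons, List.prod_cons]
    have h2 := (ih (l'.map (dualMulLeft (γ : H))) (by simpa using hl') (by
      intro ω' hω'
      obtain ⟨ω₀, h₀, rfl⟩ := List.mem_map.1 hω'
      obtain ⟨hP1, hP2⟩ := hPl' ω₀ h₀
      refine ⟨fun a ha b hb => ?_, fun h => ?_⟩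
      · rw [dualMulLeft_apply, ← mul_assoc]
        exact hP1 _ (groupLike_mul_mem_corad γ ha) b hb
      · have e : (γ : H) * (z * h) =
            z * ((γ * h : GroupLike k H) : H) - (z * (γ : H) - (γ : H) * z) * (h : H) := by
          rw [GroupLike.val_mul]
          noncomm_ring
        rw [dualMulLeft_apply, e, map_sub, hP2,
          hP1 _ hcomm _ (groupLike_mem_corad h hd), sub_zero])).2
    rw [← hprod, dualMulLeft_apply] at h2
    rw [h2, Nat.factorial_succ, Nat.cast_mul, smul_eq_mul]

/-- In a finite-dimensional pointed Hopf algebra over a field of characteristic zero, an element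
which is skew-primitive modulo lower terms and commutes with its group-like modulo lower terms
is decomposable. -/
theorem dual_apply_eq_zero_of_comul [CharZero k] (hp : IsPointedCoalgebra k H)
    (hzd : z ∈ corad k H (d + 1))
    (hz : comul (R := k) z = z ⊗ₜ[k] (1 : H) + (γ : H) ⊗ₜ[k] z + s)
    (hs : s ∈ LinearMap.range
      (TensorProduct.map (corad k H d).subtype (corad k H d).subtype))
    (hd : 1 ≤ d)
    (hcomm : z * (γ : H) - (γ : H) * z ∈ corad k H d)
    (f : DualAlg k H) (hf : ∀ a ∈ corad k H d, ∀ b ∈ corad k H d, f (a * b) = 0) :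
    f z = 0 := by
  classical
  by_contra hfz
  have := Fintype.ofFinite (GroupLike k H)
  let f₁ : DualAlg k H := (f z)⁻¹ • f
  have hf₁ : ∀ a ∈ corad k H d, ∀ b ∈ corad k H d, f₁ (a * b) = 0 := fun a ha b hb => by
    change (f z)⁻¹ • f (a * b) = 0
    rw [hf a ha b hb, smul_zero]
  have hf₁z : f₁ z = 1 := inv_mul_cancel₀ hfz
  have hf₁d : ∀ a ∈ corad k H d, f₁ a = 0 := fun a ha => by
    simpa using hf₁ a ha 1 (groupLike_mem_corad 1 hd)
  -- The form `f₁` is normalized only at `z`, whereas the value 1 is needed at every z·h. Acting by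
  -- `groupDual k H h` isolates right degree h, and multiplication by h⁻¹ brings it back to degree
  -- 1.
  let ω : DualAlg k H := ∑ h : GroupLike k H,
    dualMulRight ((h⁻¹ : GroupLike k H) : H) f₁ * groupDual k H h
  have hω : ∀ y, ω y = ∑ h : GroupLike k H,
      f₁ (actRight (groupDual k H h) y * ((h⁻¹ : GroupLike k H) : H)) := fun y => by
    rw [dual_sum_apply]
    exact Finset.sum_congr rfl fun h _ => dual_mul_eq_actRight _ _ _
  have h1 : ∀ a ∈ corad k H d, ∀ b ∈ corad k H d, ω (a * b) = 0 := fun a ha b hb => by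
    rw [hω]
    refine Finset.sum_eq_zero fun h _ => ?_
    obtain ⟨ι, _, B, -⟩ := exists_adapted_basis k (⊤ : Submodule k H)
    rw [actRight_mul_basis B, Finset.sum_mul, map_sum]
    refine Finset.sum_eq_zero fun i _ => ?_
    rw [mul_assoc]
    exact hf₁ _ (actRight_mem_corad_self _ ha) _
      (mul_groupLike_mem_corad _ (actRight_mem_corad_self _ hb))
  have h2 : ∀ h : GroupLike k H, ω (z * h) = 1 := fun h => by
    have key : ∀ h' : GroupLike k H,
        f₁ (actRight (groupDual k H h') (z * h) * ((h'⁻¹ : GroupLike k H) : H)) =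
          if h' = h then 1 else 0 := fun h' => by
      have hr : pairRight (groupDual k H h').ofConv (s * comul (R := k) (h : H)) ∈
          corad k H d :=
        pairRight_mul_comul_mem hs _ _ fun u hu v hv => by
          rw [actRight_groupLike, mul_smul_comm]
          exact Submodule.smul_mem _ _ (mul_groupLike_mem_corad h hu)
      rw [actRight_mul_of_comul hz, add_mul, map_add, hf₁d _ (mul_groupLike_mem_corad _ hr),
        add_zero, actRight_groupLike, actRight_groupLike, groupDual_apply, add_mul, map_add]
      have h3 : f₁ ((γ : H) * (dualMulLeft z (groupDual k H h')) (h : H) • (h : H) *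
          ((h'⁻¹ : GroupLike k H) : H)) = 0 := by
        refine hf₁d _ (mul_groupLike_mem_corad _ (groupLike_mul_mem_corad _ ?_))
        exact Submodule.smul_mem _ _ (groupLike_mem_corad h hd)
      rw [h3, add_zero]
      split_ifs with hh
      · subst hh
        rw [one_smul, mul_assoc, ← GroupLike.val_mul, mul_inv_cancel, GroupLike.val_one, mul_one,
          hf₁z]
      · simp
    rw [hω, Finset.sum_congr rfl fun h' _ => key h', Finset.sum_ite_eq' Finset.univ h]
    simp
  -- The power ω^n lies in J^(dn) ⊆ J^n = 0, yet takes the value n! at z^n.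
  obtain ⟨n, hn⟩ := exists_groupAnn_pow_eq_bot hp
  obtain ⟨h3, h4⟩ := prod_apply_pow hzd hz hs hd hcomm n (List.replicate n ω) (by simp)
    (fun ω' hω' => by
      rw [List.eq_of_mem_replicate hω']
      exact ⟨h1, h2⟩)
  have h5 := radPow_antitone (Nat.le_mul_of_pos_left n hd) h3
  rw [radPow_eq_bot hn, Submodule.mem_bot] at h5
  rw [h5] at h4
  exact Nat.cast_ne_zero.2 n.factorial_ne_zero h4.symm

end Nilpotency

/-! ### Homogeneous components of the layers -/

section HomogeneousComponents

variable {k H : Type*} [Field k]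

lemma eq_of_forall_pairRight {V W : Type*} [AddCommGroup V] [Module k V] [AddCommGroup W]
    [Module k W] [FiniteDimensional k W] {s t : V ⊗[k] W}
    (h : ∀ f : W →ₗ[k] k, pairRight f s = pairRight f t) : s = t := by
  rw [← pairRight_basis_sum (Module.finBasis k W) s, ← pairRight_basis_sum (Module.finBasis k W) t]
  simp only [h]

lemma dual_pairRight_eq {V W : Type*} [AddCommGroup V] [Module k V] [AddCommGroup W]
    [Module k W] (f : V →ₗ[k] k) (f' : W →ₗ[k] k) (t : V ⊗[k] W) :
    f (pairRight f' t) = f' (pairLeft f t) := by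
  induction t with
  | zero => simp
  | tmul v w => simp [mul_comm]
  | add s t hs ht => simp only [map_add, hs, ht]

variable [Ring H] [HopfAlgebra k H]

lemma actRight_mul_groupLike (f : DualAlg k H) (g : GroupLike k H) (y : H) :
    actRight f (y * (g : H)) = actRight (dualMulRight (g : H) f) y * (g : H) := by
  rw [actRight_apply, Bialgebra.comul_mul, g.2.comul_eq_tmul_self, actRight_apply]
  induction comul (R := k) y with
  | zero => simp
  | tmul a b => simp
  | add s t hs ht => simp only [map_add, add_mul, hs, ht]

lemma actLeft_mul_groupLike (f : DualAlg k H) (g : GroupLike k H) (y : H) :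
    actLeft f (y * (g : H)) = actLeft (dualMulRight (g : H) f) y * (g : H) := by
  rw [actLeft_apply, Bialgebra.comul_mul, g.2.comul_eq_tmul_self, actLeft_apply]
  induction comul (R := k) y with
  | zero => simp
  | tmul a b => simp
  | add s t hs ht => simp only [map_add, add_mul, hs, ht]

/-- `z` lies in the `m`-th layer of the coradical filtration and, modulo lower terms, in its
`(1, g)`-component. -/
structure IsLayerPrimitive (m : ℕ) (g : GroupLike k H) (z : H) : Prop where
  mem : z ∈ corad k H (m + 1)
  right : ∀ f : DualAlg k H, actRight f z - f (1 : H) • z ∈ corad k H m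
  left : ∀ f : DualAlg k H, actLeft f z - f (g : H) • z ∈ corad k H m

variable [FiniteDimensional k H]

/-- The forms dual to a and b are idempotent modulo J and so project a layer onto its
(a,b)-component; right multiplication by a⁻¹ moves this to degree (1, ba⁻¹). -/
lemma isLayerPrimitive_component {m : ℕ} {y : H} (hy : y ∈ corad k H (m + 1))
    (a b : GroupLike k H) :
    IsLayerPrimitive m (b * a⁻¹) (actLeft (groupDual k H b) (actRight (groupDual k H a) y) *
      ((a⁻¹ : GroupLike k H) : H)) where
  mem := mul_groupLike_mem_corad _ (actLeft_mem_corad_self _ (actRight_mem_corad_self _ hy))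
  right f := by
    set f' := dualMulRight ((a⁻¹ : GroupLike k H) : H) f with hf'
    have hfa : f (1 : H) = f' (a : H) := by
      rw [hf', dualMulRight_apply, ← GroupLike.val_mul, mul_inv_cancel, GroupLike.val_one]
    rw [actRight_mul_groupLike, ← smul_mul_assoc, ← sub_mul, hfa, actRight_actLeft,
      actRight_actRight, ← map_smul, ← actRight_smul, ← map_sub, ← actRight_sub]
    refine mul_groupLike_mem_corad _ (actLeft_mem_corad_self _ (actRight_mem_corad ?_ hy))
    rw [mem_radPow_one]
    intro g
    change (f' * groupDual k H a) (g : H) - f' (a : H) * (groupDual k H a) (g : H) = 0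
    rw [dual_mul_groupLike, groupDual_apply]
    split_ifs with h
    · rw [h, sub_self]
    · simp
  left f := by
    set f' := dualMulRight ((a⁻¹ : GroupLike k H) : H) f with hf'
    have hfa : f ((b * a⁻¹ : GroupLike k H) : H) = f' (b : H) := by
      rw [hf', dualMulRight_apply, ← GroupLike.val_mul]
    rw [actLeft_mul_groupLike, ← smul_mul_assoc, ← sub_mul, hfa,
      actLeft_actLeft, ← actLeft_smul, ← actLeft_sub]
    refine mul_groupLike_mem_corad _ (actLeft_mem_corad ?_ (actRight_mem_corad_self _ hy))
    rw [mem_radPow_one]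
    intro g
    change (groupDual k H b * f') (g : H) - f' (b : H) * (groupDual k H b) (g : H) = 0
    rw [dual_mul_groupLike, groupDual_apply]
    split_ifs with h
    · rw [h, one_mul, mul_one, sub_self]
    · simp

/-- The layers of the coradical filtration are spanned by translates of their homogeneous
components. -/
lemma corad_succ_le_of_isLayerPrimitive {m : ℕ} {Q : Submodule k H} (hm : corad k H m ≤ Q)
    (hQ : ∀ (g : GroupLike k H), ∀ y ∈ Q, y * (g : H) ∈ Q)
    (h : ∀ (g : GroupLike k H) (z : H), IsLayerPrimitive m g z → z ∈ Q) :
    corad k H (m + 1) ≤ Q := by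
  intro y hy
  have := Fintype.ofFinite (GroupLike k H)
  -- Since `E` is congruent to 1 modulo J, acting by it on both sides changes `y` only by lower
  -- terms, and the result is the sum of the components.
  set E : DualAlg k H := ∑ g : GroupLike k H, groupDual k H g with hE
  have h1 : actRight (E - 1) y ∈ Q :=
    hm (actRight_mem_corad sum_groupDual_sub_one_mem hy)
  have h2 : actLeft (E - 1) (actRight E y) ∈ Q :=
    hm (actLeft_mem_corad sum_groupDual_sub_one_mem (actRight_mem_corad_self _ hy))
  have h3 : actLeft E (actRight E y) ∈ Q := by
    have e1 : actRight E y = ∑ g : GroupLike k H, actRight (groupDual k H g) y :=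
      eq_of_forall_dual (k := k) fun f => by
        rw [← dual_mul_eq_actRight, hE, Finset.mul_sum, dual_sum_apply, map_sum]
        exact Finset.sum_congr rfl fun g _ => dual_mul_eq_actRight _ _ _
    have e2 : ∀ w : H, actLeft E w = ∑ g : GroupLike k H, actLeft (groupDual k H g) w := fun w =>
      eq_of_forall_dual (k := k) fun f => by
        rw [← dual_mul_eq_actLeft, hE, Finset.sum_mul, dual_sum_apply, map_sum]
        exact Finset.sum_congr rfl fun g _ => dual_mul_eq_actLeft _ _ _
    rw [e2, e1]
    refine Submodule.sum_mem _ fun b _ => ?_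
    rw [map_sum]
    refine Submodule.sum_mem _ fun a _ => ?_
    have := hQ a _ (h _ _ (isLayerPrimitive_component hy a b))
    rwa [mul_assoc, ← GroupLike.val_mul, inv_mul_cancel, GroupLike.val_one, mul_one] at this
  rw [actLeft_sub, actLeft_one] at h2
  rw [actRight_sub, actRight_one] at h1
  have h4 := Submodule.sub_mem _ (Submodule.sub_mem _ h3 h2) h1
  simpa using h4

lemma IsLayerPrimitive.exists_comul {m : ℕ} (hm : 1 ≤ m) {g : GroupLike k H} {z : H}
    (hz : IsLayerPrimitive m g z) : ∃ s ∈ LinearMap.range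
      (TensorProduct.map (corad k H m).subtype (corad k H m).subtype),
      comul (R := k) z = z ⊗ₜ[k] (1 : H) + (g : H) ⊗ₜ[k] z + s := by
  refine ⟨comul (R := k) z - (z ⊗ₜ[k] (1 : H) + (g : H) ⊗ₜ[k] z),
    mem_range_map_of_contract_mem (fun f => ?_) (fun f => ?_), by abel⟩
  · rw [map_sub, map_add, pairRight_tmul, pairRight_tmul, ← sub_sub]
    exact Submodule.sub_mem _ (hz.right (.toConv f))
      (Submodule.smul_mem _ _ (groupLike_mem_corad g hm))
  · rw [map_sub, map_add, pairLeft_tmul, pairLeft_tmul, add_comm, ← sub_sub]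
    exact Submodule.sub_mem _ (hz.left (.toConv f))
      (Submodule.smul_mem _ _ (groupLike_mem_corad (1 : GroupLike k H) hm))

lemma mem_skewPrimitives_iff_actRight {x : H} {g : H} :
    x ∈ skewPrimitives k (1 : H) g ↔
      ∀ f : DualAlg k H, actRight f x = f (1 : H) • x + f x • g := by
  refine ⟨fun hx f => ?_, fun h => ?_⟩
  · have hx' : comul (R := k) x = x ⊗ₜ[k] (1 : H) + g ⊗ₜ[k] x := hx
    rw [actRight_apply, hx', map_add, pairRight_tmul, pairRight_tmul]
  · change comul (R := k) x = x ⊗ₜ[k] (1 : H) + g ⊗ₜ[k] x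
    refine eq_of_forall_pairRight fun f => ?_
    rw [map_add, pairRight_tmul, pairRight_tmul]
    exact h (.toConv f)

/-- A first-layer component is skew-primitive up to the coradical. -/
lemma IsLayerPrimitive.exists_skewPrimitive {g : GroupLike k H} {z : H}
    (hz : IsLayerPrimitive 1 g z) :
    ∃ x ∈ skewPrimitives k (1 : H) (g : H), x - z ∈ corad k H 1 := by
  obtain ⟨s, hs, hΔ⟩ := hz.exists_comul le_rfl
  set e := groupDual k H g with he
  -- The error `s` lies in kG ⊗ kG. Contracting it against the form dual to g gives the correction
  -- in kG that makes z + c exactly skew-primitive.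
  set c := pairLeft e.ofConv s with hc
  have hcs : ∀ φ : DualAlg k H, e (pairRight φ.ofConv s) = φ c := fun φ =>
    dual_pairRight_eq _ _ _
  have hact : ∀ φ : DualAlg k H,
      actRight φ z = φ (1 : H) • z + φ z • (g : H) + pairRight φ.ofConv s := fun φ => by
    rw [actRight_apply, hΔ, map_add, map_add, pairRight_tmul, pairRight_tmul]
  refine ⟨z + c, ?_, by simpa using pairLeft_mem_of_mem_range hs _⟩
  rw [mem_skewPrimitives_iff_actRight]
  intro f
  refine eq_of_forall_dual (k := k) fun f' => ?_
  have h1 : (f' * f) (1 : H) = f' (1 : H) * f (1 : H) :=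
    dual_mul_groupLike f' f (1 : GroupLike k H)
  have h2 : (f' * f) z = f (1 : H) * f' z + f z * f' (g : H) + f' (pairRight f.ofConv s) := by
    rw [dual_mul_eq_actRight, hact]
    simp only [map_add, map_smul, smul_eq_mul]
  have h3 : ∀ w ∈ corad k H 1, (e * f') w = e w * f' (g : H) := by
    intro w hw
    rw [corad_one] at hw
    induction hw using Submodule.span_induction with
    | mem w hw =>
      obtain ⟨h, rfl⟩ := hw
      rw [dual_mul_groupLike, he, groupDual_apply]
      split_ifs with hgh
      · rw [hgh]
      · simp
    | zero => simp
    | add x y _ _ hx hy => rw [map_add, map_add, hx, hy, add_mul]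
    | smul a x _ hx => rw [map_smul, map_smul, hx, smul_eq_mul, smul_eq_mul, mul_assoc]
  have h4 : (e * (f' * f)) z =
      (f' * f) (1 : H) * e z + (f' * f) z + (f' * f) c := by
    rw [dual_mul_eq_actRight, hact, map_add, map_add, map_smul, map_smul, hcs, he,
      groupDual_self, smul_eq_mul, smul_eq_mul, mul_one]
  have h5 : ((e * f') * f) z = f (1 : H) * (f' (1 : H) * e z + f' z + f' c) +
      f z * f' (g : H) + f c * f' (g : H) := by
    rw [dual_mul_eq_actRight, hact, map_add, map_add, map_smul, map_smul,
      h3 _ (pairRight_mem_of_mem_range hs _), hcs, dual_mul_groupLike,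
      dual_mul_eq_actRight e f' z, hact, map_add, map_add, map_smul, map_smul, hcs, he,
      groupDual_self]
    simp only [smul_eq_mul, mul_one, one_mul]
  -- Associativity of e * f' * f, that is coassociativity, is exactly the identity required of z +
  -- c.
  rw [mul_assoc, h4, h1, h2] at h5
  rw [map_add, hact, map_add, map_add, map_add, map_add, map_smul, map_smul, map_smul, map_smul,
    map_add, ← dual_mul_eq_actRight f' f c]
  simp only [smul_eq_mul]
  rw [map_add]
  linear_combination h5

end HomogeneousComponents

/-! ### Arrows of the quiver and skew-primitives outside kG -/

section SkewPrimitives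

variable {k H : Type*} [Field k] [Ring H] [HopfAlgebra k H]

lemma skewPrimitives_mem_corad {x : H} {g : GroupLike k H} [FiniteDimensional k H]
    (hx : x ∈ skewPrimitives k (1 : H) (g : H)) : x ∈ corad k H 2 := by
  rw [mem_corad_succ]
  intro f hf
  have h1 : f (1 : H) = 0 := mem_radPow_one.1 hf (1 : GroupLike k H)
  rw [mem_skewPrimitives_iff_actRight.1 hx, h1, zero_smul, zero_add]
  exact Submodule.smul_mem _ _ (groupLike_mem_corad_one g)

/-- Acting by the form e dual to 1 gives e(x)·1 because x is in kG, and x + e(x)·g because x is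
skew-primitive. -/
lemma mem_span_of_mem_skewPrimitives [FiniteDimensional k H] {x : H} {g : GroupLike k H}
    (hx : x ∈ skewPrimitives k (1 : H) (g : H)) (hx' : x ∈ corad k H 1) :
    x ∈ Submodule.span k {(1 : H) - (g : H)} := by
  set e := groupDual k H 1
  have h1 : actRight e x = e x • (1 : H) := by
    rw [corad_one] at hx'
    clear hx
    induction hx' using Submodule.span_induction with
    | mem w hw =>
      obtain ⟨h, rfl⟩ := hw
      rw [actRight_groupLike, groupDual_apply]
      split_ifs with hh
      · rw [← hh, GroupLike.val_one]
      · simp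
    | zero => simp
    | add x y _ _ hx hy => rw [map_add, map_add, hx, hy, add_smul]
    | smul a x _ hx => rw [map_smul, map_smul, hx, smul_assoc]
  rw [mem_skewPrimitives_iff_actRight.1 hx] at h1
  have h2 : e (1 : H) = 1 := groupDual_self (1 : GroupLike k H)
  rw [h2, one_smul] at h1
  refine Submodule.mem_span_singleton.2 ⟨e x, ?_⟩
  rw [smul_sub, ← h1, add_sub_cancel_right]

lemma one_sub_mem_skewPrimitives (g : GroupLike k H) :
    (1 : H) - (g : H) ∈ skewPrimitives k (1 : H) (g : H) := by
  change comul (R := k) ((1 : H) - (g : H)) = _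
  rw [map_sub, Bialgebra.comul_one, g.2.comul_eq_tmul_self, TensorProduct.sub_tmul,
    TensorProduct.tmul_sub, Algebra.TensorProduct.one_def]
  abel

lemma nontrivial_arrowSpace_iff {a b : H} :
    Nontrivial (ArrowSpace k a b) ↔ ¬ skewPrimitives k a b ≤ Submodule.span k {a - b} := by
  rw [Submodule.Quotient.nontrivial_iff, Ne, Submodule.submoduleOf_eq_top]

lemma nontrivial_arrowSpace_one_iff [FiniteDimensional k H] {g : GroupLike k H} :
    Nontrivial (ArrowSpace k (1 : H) (g : H)) ↔
      ∃ x ∈ skewPrimitives k (1 : H) (g : H), x ∉ corad k H 1 := by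
  rw [nontrivial_arrowSpace_iff, SetLike.not_le_iff_exists]
  refine exists_congr fun x => and_congr_right fun hx => not_congr
    ⟨fun h => ?_, fun h => mem_span_of_mem_skewPrimitives hx h⟩
  refine (Submodule.span_singleton_le_iff_mem _ _).2 ?_ h
  exact Submodule.sub_mem _ (groupLike_mem_corad_one (1 : GroupLike k H))
    (groupLike_mem_corad_one g)

lemma mul_groupLike_mem_skewPrimitives {x a b : H} (hx : x ∈ skewPrimitives k a b)
    (g : GroupLike k H) : x * (g : H) ∈ skewPrimitives k (a * g) (b * g) := by
  have hx' : comul (R := k) x = x ⊗ₜ[k] a + b ⊗ₜ[k] x := hx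
  change comul (R := k) (x * (g : H)) = _
  rw [Bialgebra.comul_mul, hx', g.2.comul_eq_tmul_self]
  simp [add_mul]

lemma nontrivial_arrowSpace_translate {a b : GroupLike k H}
    (h : Nontrivial (ArrowSpace k (a : H) (b : H))) :
    Nontrivial (ArrowSpace k (1 : H) ((b * a⁻¹ : GroupLike k H) : H)) := by
  rw [nontrivial_arrowSpace_iff, SetLike.not_le_iff_exists] at h ⊢
  obtain ⟨x, hx, hx'⟩ := h
  have ha : (a : H) * ((a⁻¹ : GroupLike k H) : H) = 1 := by
    rw [← GroupLike.val_mul, mul_inv_cancel, GroupLike.val_one]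
  have ha' : ((a⁻¹ : GroupLike k H) : H) * (a : H) = 1 := by
    rw [← GroupLike.val_mul, inv_mul_cancel, GroupLike.val_one]
  refine ⟨x * ((a⁻¹ : GroupLike k H) : H), ?_, fun h => hx' ?_⟩
  · have := mul_groupLike_mem_skewPrimitives hx a⁻¹
    rwa [ha] at this
  · obtain ⟨c, hc⟩ := Submodule.mem_span_singleton.1 h
    refine Submodule.mem_span_singleton.2 ⟨c, ?_⟩
    have := congrArg (· * (a : H)) hc
    simp only [mul_assoc, ha', mul_one, smul_mul_assoc, sub_mul, one_mul, GroupLike.val_mul] at this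
    exact this

end SkewPrimitives

/-! ### The R-form on group-like elements -/

section UniversalRForm

variable {k H : Type*} [Field k] [Ring H] [HopfAlgebra k H] {R : H ⊗[k] H →ₗ[k] k}

/-- The linear form `R(-, h)`. -/
noncomputable def rightForm (R : H ⊗[k] H →ₗ[k] k) (h : H) : DualAlg k H :=
  .toConv (R ∘ₗ (TensorProduct.mk k H H).flip h)

/-- The linear form `R(h, -)`. -/
noncomputable def leftForm (R : H ⊗[k] H →ₗ[k] k) (h : H) : DualAlg k H :=
  .toConv (R ∘ₗ TensorProduct.mk k H H h)

lemma rightForm_apply (h x : H) : rightForm R h x = R (x ⊗ₜ[k] h) := rfl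
lemma leftForm_apply (h x : H) : leftForm R h x = R (h ⊗ₜ[k] x) := rfl

namespace IsCoquasitriangular

variable (hR : IsCoquasitriangular R)
include hR

/-- Evaluation at the group-like element g ⊗ h is multiplicative for convolution, so it sends the
unit R to a unit. -/
lemma apply_groupLike_ne_zero (g h : GroupLike k H) : R ((g : H) ⊗ₜ[k] (h : H)) ≠ 0 := by
  obtain ⟨u, hu⟩ := hR.isUnit.exists_right_inv
  let gh : GroupLike k (H ⊗[k] H) := ⟨(g : H) ⊗ₜ[k] (h : H), by simp, by
    rw [TensorProduct.comul_tmul, g.2.comul_eq_tmul_self, h.2.comul_eq_tmul_self]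
    simp⟩
  have h1 := dual_mul_groupLike (WithConv.toConv R) u gh
  rw [hu, dual_one_groupLike] at h1
  intro h0
  have : (WithConv.toConv R : WithConv (H ⊗[k] H →ₗ[k] k)) (gh : H ⊗[k] H) = 0 := h0
  rw [this, zero_mul] at h1
  exact one_ne_zero h1

lemma mul_left_groupLike (a b : H) (g : GroupLike k H) :
    R ((a * b) ⊗ₜ[k] (g : H)) = R (a ⊗ₜ[k] (g : H)) * R (b ⊗ₜ[k] (g : H)) := by
  rw [hR.mul_left, g.2.comul_eq_tmul_self]
  simp

lemma mul_right_groupLike (a b : H) (g : GroupLike k H) :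
    R ((g : H) ⊗ₜ[k] (a * b)) = R ((g : H) ⊗ₜ[k] b) * R ((g : H) ⊗ₜ[k] a) := by
  rw [hR.mul_right, g.2.comul_eq_tmul_self]
  simp

lemma one_left_groupLike (g : GroupLike k H) : R ((1 : H) ⊗ₜ[k] (g : H)) = 1 := by
  have h := hR.mul_left_groupLike 1 1 g
  rw [mul_one] at h
  exact (mul_eq_left₀ (hR.apply_groupLike_ne_zero 1 g)).1 h.symm

lemma one_right_groupLike (g : GroupLike k H) : R ((g : H) ⊗ₜ[k] (1 : H)) = 1 := by
  have h := hR.mul_right_groupLike 1 1 g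
  rw [mul_one] at h
  exact (mul_eq_left₀ (hR.apply_groupLike_ne_zero g 1)).1 h.symm

/-- The axiom `comm` at a ⊗ h; `actRight_mul_groupLike_eq` is the same axiom at h ⊗ a. Together they
give two independent rules for commuting h past an element. -/
lemma groupLike_mul_actRight (h : GroupLike k H) (a : H) :
    (h : H) * actRight (rightForm R (h : H)) a = actLeft (rightForm R (h : H)) a * (h : H) := by
  have := congrArg (fun F : WithConv (H ⊗[k] H →ₗ[k] H) => F (a ⊗ₜ[k] (h : H))) hR.comm
  simp only [LinearMap.convMul_apply, TensorProduct.comul_tmul, h.2.comul_eq_tmul_self] at this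
  rw [actRight_apply, actLeft_apply]
  generalize comul (R := k) a = t at this ⊢
  have e1 : ∀ t : H ⊗[k] H, (h : H) * pairRight (rightForm R (h : H)).ofConv t =
      LinearMap.mul' k H (TensorProduct.map
        (LinearMap.mul' k H ∘ₗ (TensorProduct.comm k H H).toLinearMap)
        (Algebra.linearMap k H ∘ₗ R)
        (TensorProduct.AlgebraTensorModule.tensorTensorTensorComm k k k k H H H H
          (t ⊗ₜ[k] ((h : H) ⊗ₜ[k] (h : H))))) := by
    intro t
    induction t with
    | zero => simp
    | tmul x y =>
      simp [rightForm, Algebra.smul_def, Algebra.commutes, mul_assoc]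
    | add s t hs ht => simp only [map_add, mul_add, TensorProduct.add_tmul, hs, ht]
  have e2 : ∀ t : H ⊗[k] H, pairLeft (rightForm R (h : H)).ofConv t * (h : H) =
      LinearMap.mul' k H (TensorProduct.map
        (Algebra.linearMap k H ∘ₗ R) (LinearMap.mul' k H)
        (TensorProduct.AlgebraTensorModule.tensorTensorTensorComm k k k k H H H H
          (t ⊗ₜ[k] ((h : H) ⊗ₜ[k] (h : H))))) := by
    intro t
    induction t with
    | zero => simp
    | tmul x y => simp [rightForm, Algebra.smul_def, mul_assoc]
    | add s t hs ht => simp only [map_add, add_mul, TensorProduct.add_tmul, hs, ht]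
  rw [e1, e2]
  exact this

lemma actRight_mul_groupLike_eq (h : GroupLike k H) (a : H) :
    actRight (leftForm R (h : H)) a * (h : H) = (h : H) * actLeft (leftForm R (h : H)) a := by
  have := congrArg (fun F : WithConv (H ⊗[k] H →ₗ[k] H) => F ((h : H) ⊗ₜ[k] a)) hR.comm
  simp only [LinearMap.convMul_apply, TensorProduct.comul_tmul, h.2.comul_eq_tmul_self] at this
  rw [actRight_apply, actLeft_apply]
  generalize comul (R := k) a = t at this ⊢
  have e1 : ∀ t : H ⊗[k] H, pairRight (leftForm R (h : H)).ofConv t * (h : H) =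
      LinearMap.mul' k H (TensorProduct.map
        (LinearMap.mul' k H ∘ₗ (TensorProduct.comm k H H).toLinearMap)
        (Algebra.linearMap k H ∘ₗ R)
        (TensorProduct.AlgebraTensorModule.tensorTensorTensorComm k k k k H H H H
          (((h : H) ⊗ₜ[k] (h : H)) ⊗ₜ[k] t))) := by
    intro t
    induction t with
    | zero => simp
    | tmul x y =>
      simp [leftForm, Algebra.smul_def, ← Algebra.commutes, mul_assoc]
    | add s t hs ht => simp only [map_add, add_mul, TensorProduct.tmul_add, hs, ht]
  have e2 : ∀ t : H ⊗[k] H, (h : H) * pairLeft (leftForm R (h : H)).ofConv t =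
      LinearMap.mul' k H (TensorProduct.map
        (Algebra.linearMap k H ∘ₗ R) (LinearMap.mul' k H)
        (TensorProduct.AlgebraTensorModule.tensorTensorTensorComm k k k k H H H H
          (((h : H) ⊗ₜ[k] (h : H)) ⊗ₜ[k] t))) := by
    intro t
    induction t with
    | zero => simp
    | tmul x y =>
      simp only [leftForm, pairLeft_tmul, LinearMap.comp_apply, TensorProduct.mk_apply,
        TensorProduct.AlgebraTensorModule.tensorTensorTensorComm_tmul, TensorProduct.map_tmul,
        LinearMap.mul'_apply, Algebra.linearMap_apply, mul_smul_comm, ← Algebra.smul_def]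
    | add s t hs ht => simp only [map_add, mul_add, TensorProduct.tmul_add, hs, ht]
  rw [e1, e2]
  exact this

lemma groupLike_mul_comm (g h : GroupLike k H) : g * h = h * g := by
  have := hR.groupLike_mul_actRight h (g : H)
  rw [actRight_groupLike, actLeft_groupLike, mul_smul_comm, smul_mul_assoc] at this
  have h0 : rightForm R (h : H) (g : H) ≠ 0 := hR.apply_groupLike_ne_zero g h
  have := smul_right_injective H h0 this
  exact GroupLike.val_injective this.symm

end IsCoquasitriangular

end UniversalRForm

/-! ### Parity of arrows and relations between normalized skew-primitives -/

section SkewPrimitiveRelations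

variable {k H : Type*} [Field k] [Ring H] [HopfAlgebra k H] {R : H ⊗[k] H →ₗ[k] k}

lemma actLeft_skewPrimitive {x : H} {g : H} (hx : x ∈ skewPrimitives k (1 : H) g)
    (f : DualAlg k H) : actLeft f x = f x • (1 : H) + f g • x := by
  have hx' : comul (R := k) x = x ⊗ₜ[k] (1 : H) + g ⊗ₜ[k] x := hx
  rw [actLeft_apply, hx', map_add, pairLeft_tmul, pairLeft_tmul]

variable [FiniteDimensional k H]

namespace IsCoquasitriangular

variable (hR : IsCoquasitriangular R)
include hR

lemma groupLike_mul_skewPrimitive (h : GroupLike k H) {g : GroupLike k H} {x : H}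
    (hx : x ∈ skewPrimitives k (1 : H) (g : H)) :
    (h : H) * x = R ((g : H) ⊗ₜ[k] (h : H)) • (x * (h : H)) +
      R (x ⊗ₜ[k] (h : H)) • ((h : H) - (h : H) * (g : H)) := by
  have := hR.groupLike_mul_actRight h x
  rw [mem_skewPrimitives_iff_actRight.1 hx, actLeft_skewPrimitive hx, rightForm_apply,
    rightForm_apply, rightForm_apply, hR.one_left_groupLike, one_smul, mul_add, add_mul,
    mul_smul_comm, smul_mul_assoc, smul_mul_assoc, one_mul] at this
  rw [smul_sub, eq_sub_of_add_eq this]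
  abel

lemma skewPrimitive_mul_groupLike (h : GroupLike k H) {g : GroupLike k H} {x : H}
    (hx : x ∈ skewPrimitives k (1 : H) (g : H)) :
    x * (h : H) = R ((h : H) ⊗ₜ[k] (g : H)) • ((h : H) * x) +
      R ((h : H) ⊗ₜ[k] x) • ((h : H) - (g : H) * (h : H)) := by
  have := hR.actRight_mul_groupLike_eq h x
  rw [mem_skewPrimitives_iff_actRight.1 hx, actLeft_skewPrimitive hx, leftForm_apply,
    leftForm_apply, leftForm_apply, hR.one_right_groupLike, one_smul, mul_add, add_mul,
    mul_smul_comm, smul_mul_assoc, mul_smul_comm, mul_one] at this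
  rw [smul_sub, eq_sub_of_add_eq this]
  abel

/-- Applying both commutation rules in turn multiplies xh by R(g,h)R(h,g) modulo kG, and xh is not
in kG. -/
lemma apply_mul_apply_swap {g : GroupLike k H} {x : H}
    (hx : x ∈ skewPrimitives k (1 : H) (g : H)) (hx' : x ∉ corad k H 1) (h : GroupLike k H) :
    R ((g : H) ⊗ₜ[k] (h : H)) * R ((h : H) ⊗ₜ[k] (g : H)) = 1 := by
  by_contra hne
  have h1 := hR.skewPrimitive_mul_groupLike h hx
  rw [hR.groupLike_mul_skewPrimitive h hx, smul_add, smul_smul] at h1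
  have h2 : (1 - R ((g : H) ⊗ₜ[k] (h : H)) * R ((h : H) ⊗ₜ[k] (g : H))) • (x * (h : H)) ∈
      corad k H 1 := by
    rw [sub_smul, one_smul, mul_comm]
    have hh := groupLike_mem_corad_one h
    have e : x * (h : H) - (R ((h : H) ⊗ₜ[k] (g : H)) * R ((g : H) ⊗ₜ[k] (h : H))) •
        (x * (h : H)) = R ((h : H) ⊗ₜ[k] (g : H)) • R (x ⊗ₜ[k] (h : H)) •
          ((h : H) - (h : H) * (g : H)) + R ((h : H) ⊗ₜ[k] x) • ((h : H) - (g : H) * (h : H)) := by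
      rw [sub_eq_iff_eq_add]
      refine h1.trans ?_
      abel
    rw [e]
    exact Submodule.add_mem _
      (Submodule.smul_mem _ _ (Submodule.smul_mem _ _ (Submodule.sub_mem _ hh
        (mul_groupLike_mem_corad g hh))))
      (Submodule.smul_mem _ _ (Submodule.sub_mem _ hh (groupLike_mul_mem_corad g hh)))
  have h3 := (Submodule.smul_mem_iff _ (sub_ne_zero.2 (Ne.symm hne))).1 h2
  have h4 := mul_groupLike_mem_corad h⁻¹ h3
  rw [mul_assoc, ← GroupLike.val_mul, mul_inv_cancel, GroupLike.val_one, mul_one] at h4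
  exact hx' h4

/-- A group-like element which is the target of an arrow starting at `1` has odd parity. -/
lemma apply_self_eq_neg_one [CharZero k] (hp : IsPointedCoalgebra k H) {g : GroupLike k H} {x : H}
    (hx : x ∈ skewPrimitives k (1 : H) (g : H)) (hx' : x ∉ corad k H 1) :
    R ((g : H) ⊗ₜ[k] (g : H)) = -1 := by
  -- If R(g,g) = 1, then x commutes with g modulo kG, and the nilpotency argument with d = 1 and s =
  -- 0 puts x in kG.
  refine (mul_self_eq_one_iff.1 (hR.apply_mul_apply_swap hx hx' g)).resolve_left fun h1 => hx' ?_
  have hΔ : comul (R := k) x = x ⊗ₜ[k] (1 : H) + (g : H) ⊗ₜ[k] x + 0 := by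
    rw [add_zero]
    exact hx
  have hcomm : x * (g : H) - (g : H) * x ∈ corad k H 1 := by
    have hg := groupLike_mem_corad_one g
    rw [hR.groupLike_mul_skewPrimitive g hx, h1, one_smul, sub_add_cancel_left]
    exact Submodule.neg_mem _ (Submodule.smul_mem _ _ (Submodule.sub_mem _ hg
        (mul_groupLike_mem_corad g hg)))
  rw [← perp_ann (corad k H 1)]
  intro f hf
  exact dual_apply_eq_zero_of_comul hp (d := 1) (skewPrimitives_mem_corad hx) hΔ
    (Submodule.zero_mem _) le_rfl hcomm f fun a ha b hb => hf _ (corad_one_mul_mem ha hb)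

end IsCoquasitriangular

/-- The `(1, g)`-primitive elements `x` with `R(x, g) = 0`. -/
noncomputable def normalizedPrimitives (R : H ⊗[k] H →ₗ[k] k) (g : GroupLike k H) : Submodule k H :=
  skewPrimitives k (1 : H) (g : H) ⊓ LinearMap.ker (rightForm R (g : H)).ofConv

omit [FiniteDimensional k H] in
lemma mem_normalizedPrimitives {g : GroupLike k H} {x : H} :
    x ∈ normalizedPrimitives R g ↔
      x ∈ skewPrimitives k (1 : H) (g : H) ∧ R (x ⊗ₜ[k] (g : H)) = 0 := Iff.rfl

namespace IsCoquasitriangular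

variable (hR : IsCoquasitriangular R) {g : GroupLike k H}
include hR

omit [FiniteDimensional k H] in
-- Expanding R(x, gh) = R(x, hg) both ways gives R(x,h) = R(g,g)R(x,h) = -R(x,h).
lemma apply_normalized (hg : R ((g : H) ⊗ₜ[k] (g : H)) = -1) [CharZero k] {x : H}
    (hx : x ∈ normalizedPrimitives R g) (h : GroupLike k H) : R (x ⊗ₜ[k] (h : H)) = 0 := by
  obtain ⟨hx1, hx2⟩ := mem_normalizedPrimitives.1 hx
  have hΔ : comul (R := k) x = x ⊗ₜ[k] (1 : H) + (g : H) ⊗ₜ[k] x := hx1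
  have e : ∀ a b : GroupLike k H, R (x ⊗ₜ[k] ((a : H) * (b : H))) =
      R (x ⊗ₜ[k] (b : H)) + R ((g : H) ⊗ₜ[k] (b : H)) * R (x ⊗ₜ[k] (a : H)) := by
    intro a b
    rw [hR.mul_right, hΔ]
    simp [hR.one_left_groupLike]
  have h1 := e g h
  have h2 := e h g
  rw [← GroupLike.val_mul] at h1 h2
  rw [hR.groupLike_mul_comm g h, h2, hx2, hg] at h1
  have h3 : (2 : k) * R (x ⊗ₜ[k] (h : H)) = 0 := by linear_combination -h1
  exact (mul_eq_zero.1 h3).resolve_left two_ne_zero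

lemma groupLike_mul_normalized (hg : R ((g : H) ⊗ₜ[k] (g : H)) = -1) [CharZero k] {x : H}
    (hx : x ∈ normalizedPrimitives R g) (h : GroupLike k H) :
    (h : H) * x = R ((g : H) ⊗ₜ[k] (h : H)) • (x * (h : H)) := by
  rw [hR.groupLike_mul_skewPrimitive h hx.1, hR.apply_normalized hg hx, zero_smul, add_zero]

omit [FiniteDimensional k H] in
lemma ne_one_of_apply_self (hg : R ((g : H) ⊗ₜ[k] (g : H)) = -1) [CharZero k] : g ≠ 1 := by
  rintro rfl
  rw [GroupLike.val_one, show R ((1 : H) ⊗ₜ[k] (1 : H)) = 1 from hR.one_left_groupLike 1] at hg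
  have : (2 : k) = 0 := by linear_combination hg
  exact two_ne_zero this

/-- The two commutation rules now agree except for the term R(h,x)(h - gh), and h ≠ gh because g ≠
1. -/
lemma apply_normalized' (hg : R ((g : H) ⊗ₜ[k] (g : H)) = -1) [CharZero k]
    (hsymm : ∀ h : GroupLike k H, R ((g : H) ⊗ₜ[k] (h : H)) * R ((h : H) ⊗ₜ[k] (g : H)) = 1)
    {x : H} (hx : x ∈ normalizedPrimitives R g) (h : GroupLike k H) :
    R ((h : H) ⊗ₜ[k] x) = 0 := by
  have h1 := hR.skewPrimitive_mul_groupLike h hx.1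
  rw [hR.groupLike_mul_normalized hg hx, smul_smul, mul_comm (R _), hsymm, one_smul,
    left_eq_add, smul_eq_zero] at h1
  refine h1.resolve_right fun h2 => hR.ne_one_of_apply_self hg ?_
  rw [sub_eq_zero, ← GroupLike.val_mul, GroupLike.val_inj] at h2
  exact right_eq_mul.1 h2

/-- Skew-commutation of normalized skew-primitive elements. -/
lemma normalized_mul_normalized [CharZero k] {h : GroupLike k H}
    (hg : R ((g : H) ⊗ₜ[k] (g : H)) = -1) (hh : R ((h : H) ⊗ₜ[k] (h : H)) = -1)
    (hsymm : ∀ g' : GroupLike k H, R ((h : H) ⊗ₜ[k] (g' : H)) * R ((g' : H) ⊗ₜ[k] (h : H)) = 1)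
    {x y : H} (hx : x ∈ normalizedPrimitives R g) (hy : y ∈ normalizedPrimitives R h) :
    y * x - R ((g : H) ⊗ₜ[k] (h : H)) • (x * y) =
      R (x ⊗ₜ[k] y) • (1 - (g : H) * (h : H)) := by
  have hx1 : comul (R := k) x = x ⊗ₜ[k] (1 : H) + (g : H) ⊗ₜ[k] x := hx.1
  have hy1 : comul (R := k) y = y ⊗ₜ[k] (1 : H) + (h : H) ⊗ₜ[k] y := hy.1
  -- Normalization kills every value of R in the expansion of `comm` except R(1,1), R(g,h) and
  -- R(x,y).
  have h1 := congrArg (fun F : WithConv (H ⊗[k] H →ₗ[k] H) => F (x ⊗ₜ[k] y)) hR.comm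
  simp only [LinearMap.convMul_apply, TensorProduct.comul_tmul, hx1, hy1,
    TensorProduct.add_tmul, TensorProduct.tmul_add, map_add,
    TensorProduct.AlgebraTensorModule.tensorTensorTensorComm_tmul, TensorProduct.map_tmul,
    LinearMap.mul'_apply, LinearMap.comp_apply, LinearEquiv.coe_coe, TensorProduct.comm_tmul,
    Algebra.linearMap_apply] at h1
  have r1 : R ((1 : H) ⊗ₜ[k] (1 : H)) = 1 := hR.one_left_groupLike 1
  have r2 : R (x ⊗ₜ[k] (1 : H)) = 0 := hR.apply_normalized hg hx 1
  have r3 : R ((1 : H) ⊗ₜ[k] y) = 0 := hR.apply_normalized' hh hsymm hy 1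
  have r4 : R (x ⊗ₜ[k] (h : H)) = 0 := hR.apply_normalized hg hx h
  have r5 : R ((g : H) ⊗ₜ[k] y) = 0 := hR.apply_normalized' hh hsymm hy g
  simp only [r1, r2, r3, r4, r5, map_zero, map_one, zero_mul, mul_zero, add_zero, zero_add,
    mul_one] at h1
  simp only [← Algebra.commutes (R := k) (A := H), ← Algebra.smul_def] at h1
  rw [Algebra.algebraMap_eq_smul_one] at h1
  have hgh : (h : H) * (g : H) = (g : H) * (h : H) := by
    rw [← GroupLike.val_mul, hR.groupLike_mul_comm, GroupLike.val_mul]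
  rw [hgh] at h1
  rw [smul_sub, eq_sub_of_add_eq h1]
  abel

omit [FiniteDimensional k H] in
-- The value is nonzero, so R(-, g) splits off the line k(1 - g) and its kernel in the
-- (1,g)-primitives represents the arrows.
lemma apply_one_sub (hg : R ((g : H) ⊗ₜ[k] (g : H)) = -1) :
    R (((1 : H) - (g : H)) ⊗ₜ[k] (g : H)) = 2 := by
  rw [TensorProduct.sub_tmul, map_sub, hR.one_left_groupLike, hg]
  norm_num

omit [FiniteDimensional k H] in
/-- The arrows from `1` to `g` are represented by normalized skew-primitive elements. -/
lemma nonempty_normalizedPrimitives_equiv [CharZero k] (hg : R ((g : H) ⊗ₜ[k] (g : H)) = -1) :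
    Nonempty (normalizedPrimitives R g ≃ₗ[k] ArrowSpace k (1 : H) (g : H)) := by
  have h2 := hR.apply_one_sub hg
  let φ : normalizedPrimitives R g →ₗ[k] ArrowSpace k (1 : H) (g : H) :=
    Submodule.mkQ _ ∘ₗ Submodule.inclusion inf_le_left
  refine ⟨LinearEquiv.ofBijective φ ⟨?_, fun q => ?_⟩⟩
  · rw [← LinearMap.ker_eq_bot, LinearMap.ker_eq_bot']
    rintro ⟨x, hx⟩ hφ
    have h3 : x ∈ Submodule.span k {(1 : H) - (g : H)} := by
      have := (Submodule.Quotient.mk_eq_zero _).1 hφ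
      exact this
    obtain ⟨c, rfl⟩ := Submodule.mem_span_singleton.1 h3
    have h4 := (mem_normalizedPrimitives.1 hx).2
    rw [← TensorProduct.smul_tmul', map_smul, h2, smul_eq_mul, mul_eq_zero] at h4
    have h5 := h4.resolve_right two_ne_zero
    ext
    simp [h5]
  · obtain ⟨⟨x, hx⟩, rfl⟩ := Submodule.mkQ_surjective _ q
    have hone := one_sub_mem_skewPrimitives (k := k) g
    refine ⟨⟨x - (R (x ⊗ₜ[k] (g : H)) / 2) • ((1 : H) - (g : H)), mem_normalizedPrimitives.2
      ⟨Submodule.sub_mem _ hx (Submodule.smul_mem _ _ hone), ?_⟩⟩, ?_⟩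
    · rw [TensorProduct.sub_tmul, map_sub, ← TensorProduct.smul_tmul', map_smul, h2, smul_eq_mul,
        div_mul_cancel₀ _ two_ne_zero, sub_self]
    · refine (Submodule.Quotient.eq _).2 ?_
      change x - (R (x ⊗ₜ[k] (g : H)) / 2) • ((1 : H) - (g : H)) - x ∈
        Submodule.span k {(1 : H) - (g : H)}
      rw [sub_sub_cancel_left]
      exact Submodule.neg_mem _ (Submodule.smul_mem _ _ (Submodule.mem_span_singleton_self _))

end IsCoquasitriangular

end SkewPrimitiveRelations

/-! ### Systems of skew-primitives with dual forms -/

section SkewPrimitiveSystems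

variable {k H : Type*} [Field k] [Ring H] [HopfAlgebra k H]

/-- A system of normalized skew-primitive elements `x p`, of group-like degrees `g p`, together with
linear forms `ξ p` dual to them, which spans the first layer of the coradical filtration. -/
structure SkewPrimitiveSystem (R : H ⊗[k] H →ₗ[k] k) {ι : Type*} [DecidableEq ι]
    (g : ι → GroupLike k H) (x : ι → H) (ξ : ι → DualAlg k H) : Prop where
  apply_self : ∀ p, R ((g p : H) ⊗ₜ[k] (g p : H)) = -1
  symm : ∀ p (h : GroupLike k H),
    R ((g p : H) ⊗ₜ[k] (h : H)) * R ((h : H) ⊗ₜ[k] (g p : H)) = 1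
  mem : ∀ p, x p ∈ normalizedPrimitives R (g p)
  dual_groupLike : ∀ p (h : GroupLike k H), ξ p (h : H) = 0
  dual_mul : ∀ p q (h : GroupLike k H), ξ p (x q * h) = if p = q then 1 else 0
  corad_two_le : corad k H 2 ≤ Submodule.span k
    (Set.range (GroupLike.val : GroupLike k H → H) ∪
      Set.range fun ph : ι × GroupLike k H => x ph.1 * (ph.2 : H))

lemma actRight_skewPrimitive_mul [FiniteDimensional k H] {x : H} {g : H}
    (hx : x ∈ skewPrimitives k (1 : H) g)
    (f : DualAlg k H) (h : GroupLike k H) :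
    actRight f (x * h) = f (h : H) • (x * h) + f (x * h) • (g * h) := by
  rw [actRight_mul_groupLike, mem_skewPrimitives_iff_actRight.1 hx, add_mul, smul_mul_assoc,
    smul_mul_assoc, dualMulRight_apply, dualMulRight_apply, one_mul]

/-- Linear forms on a Hopf algebra dual to a family of skew-primitive elements and invariant under
right translation by group-like elements. -/
lemma exists_invariant_dual [FiniteDimensional k H] (g : GroupLike k H)
    (f : DualAlg k H) (hf : f ∈ radPow k H 1) :
    ∃ ξ : DualAlg k H, (∀ h : GroupLike k H, ξ (h : H) = 0) ∧
      (∀ y ∈ skewPrimitives k (1 : H) (g : H), ∀ h : GroupLike k H, ξ (y * h) = f y) ∧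
      (∀ g' : GroupLike k H, g' ≠ g → ∀ y ∈ skewPrimitives k (1 : H) (g' : H),
        ∀ h : GroupLike k H, ξ (y * h) = 0) := by
  classical
  have := Fintype.ofFinite (GroupLike k H)
  have hf' := mem_radPow_one.1 hf
  -- Left multiplication by the form dual to g keeps the value of f on (1,g)-primitives and kills
  -- those of any other degree. The sum ξ below then averages over G to make the values invariant
  -- under right translation.
  set f₁ := groupDual k H g * f with hf₁
  have hf₁0 : ∀ h : GroupLike k H, f₁ (h : H) = 0 := fun h => by
    rw [hf₁, dual_mul_groupLike, hf', mul_zero]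
  have hf₁y : ∀ g' : GroupLike k H, ∀ y ∈ skewPrimitives k (1 : H) (g' : H),
      f₁ y = if g = g' then f y else 0 := fun g' y hy => by
    have h1 : f (1 : H) = 0 := hf' 1
    rw [hf₁, dual_mul_eq_actLeft, actLeft_skewPrimitive hy, map_add, map_smul, map_smul, h1,
      smul_zero, zero_add, groupDual_apply]
    split_ifs <;> simp
  let ξ : DualAlg k H := ∑ h : GroupLike k H,
    dualMulRight ((h⁻¹ : GroupLike k H) : H) f₁ * groupDual k H h
  have hξ : ∀ y, ξ y = ∑ h : GroupLike k H,
      f₁ (actRight (groupDual k H h) y * ((h⁻¹ : GroupLike k H) : H)) := fun y => by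
    rw [dual_sum_apply]
    exact Finset.sum_congr rfl fun h _ => dual_mul_eq_actRight _ _ _
  have key : ∀ g' : GroupLike k H, ∀ y ∈ skewPrimitives k (1 : H) (g' : H),
      ∀ h : GroupLike k H, ξ (y * h) = f₁ y := fun g' y hy h => by
    rw [hξ, Finset.sum_eq_single h]
    · rw [actRight_skewPrimitive_mul hy, groupDual_self, one_smul, add_mul, smul_mul_assoc,
        mul_assoc, ← GroupLike.val_mul, ← GroupLike.val_mul, ← GroupLike.val_mul, mul_inv_cancel,
        GroupLike.val_one, mul_one, map_add, map_smul, hf₁0, smul_zero, add_zero]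
    · intro h' _ hne
      rw [actRight_skewPrimitive_mul hy, groupDual_ne hne, zero_smul, zero_add, smul_mul_assoc,
        map_smul, ← GroupLike.val_mul, ← GroupLike.val_mul, hf₁0, smul_zero]
    · simp
  refine ⟨ξ, fun h => ?_, fun y hy h => ?_, fun g' hg' y hy h => ?_⟩
  · rw [hξ]
    refine Finset.sum_eq_zero fun h' _ => ?_
    rw [actRight_groupLike, smul_mul_assoc, map_smul, ← GroupLike.val_mul, hf₁0, smul_zero]
  · rw [key g y hy, hf₁y g y hy, if_pos rfl]
  · rw [key g' y hy, hf₁y g' y hy, if_neg (Ne.symm hg')]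

end SkewPrimitiveSystems

/-! ### The structure of J modulo J² -/

section SystemConsequences

variable {k H : Type*} [Field k] [Ring H] [HopfAlgebra k H] [FiniteDimensional k H]
  {R : H ⊗[k] H →ₗ[k] k} {ι : Type*} [DecidableEq ι]
  {g : ι → GroupLike k H} {x : ι → H} {ξ : ι → DualAlg k H}

namespace SkewPrimitiveSystem

variable (hS : SkewPrimitiveSystem R g x ξ)
include hS

omit [FiniteDimensional k H] in
lemma dual_mem (p : ι) : ξ p ∈ radPow k H 1 := mem_radPow_one.2 (hS.dual_groupLike p)

lemma mem_corad (p : ι) : x p ∈ corad k H 2 := skewPrimitives_mem_corad (hS.mem p).1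

lemma mem_radPow_two_iff (f : DualAlg k H) : f ∈ radPow k H 2 ↔
    (∀ h : GroupLike k H, f (h : H) = 0) ∧ ∀ p (h : GroupLike k H), f (x p * h) = 0 := by
  rw [mem_radPow_iff]
  refine ⟨fun hf => ⟨fun h => hf _ (groupLike_mem_corad h (by norm_num)),
    fun p h => hf _ (mul_groupLike_mem_corad h (hS.mem_corad p))⟩, fun hf y hy => ?_⟩
  have : Submodule.span k (Set.range (GroupLike.val : GroupLike k H → H) ∪
      Set.range fun ph : ι × GroupLike k H => x ph.1 * (ph.2 : H)) ≤ LinearMap.ker f.ofConv := by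
    rw [Submodule.span_le]
    rintro _ (⟨h, rfl⟩ | ⟨⟨p, h⟩, rfl⟩)
    · exact hf.1 h
    · exact hf.2 p h
  exact this (hS.corad_two_le hy)

lemma dual_mul_groupDual_apply (p q : ι) (h h' : GroupLike k H) :
    (ξ p * groupDual k H h) (x q * h') =
      (groupDual k H h) (h' : H) * if p = q then 1 else 0 := by
  rw [dual_mul_eq_actRight, actRight_skewPrimitive_mul (hS.mem q).1, map_add, map_smul, map_smul,
    hS.dual_mul, ← GroupLike.val_mul, hS.dual_groupLike, smul_zero, add_zero, smul_eq_mul]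

/-- Dual to the fact that x_p has left degree g_p and right degree 1: the idempotents modulo J pass
through ξ_p with a shift by g_p. -/
lemma groupDual_mul_dual_sub_mem (p : ι) (h : GroupLike k H) :
    groupDual k H h * ξ p - ξ p * groupDual k H ((g p)⁻¹ * h) ∈ radPow k H 2 := by
  classical
  rw [hS.mem_radPow_two_iff]
  refine ⟨fun h' => ?_, fun q h' => ?_⟩
  · change (groupDual k H h * ξ p) (h' : H) - (ξ p * groupDual k H ((g p)⁻¹ * h)) (h' : H) = 0
    rw [dual_mul_groupLike, dual_mul_groupLike, hS.dual_groupLike, mul_zero, zero_mul, sub_zero]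
  · change (groupDual k H h * ξ p) (x q * h') -
      (ξ p * groupDual k H ((g p)⁻¹ * h)) (x q * h') = 0
    rw [hS.dual_mul_groupDual_apply, dual_mul_eq_actRight, actRight_skewPrimitive_mul (hS.mem q).1,
      hS.dual_groupLike, zero_smul, zero_add, map_smul, hS.dual_mul, ← GroupLike.val_mul,
      groupDual_apply, groupDual_apply, smul_eq_mul]
    by_cases hpq : p = q
    · subst hpq
      simp [inv_mul_eq_iff_eq_mul]
    · simp [hpq]

lemma sub_sum_mem_radPow_two [Fintype ι] [Fintype (GroupLike k H)] {f : DualAlg k H}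
    (hf : f ∈ radPow k H 1) :
    f - ∑ p, ∑ h : GroupLike k H, f (x p * h) • (ξ p * groupDual k H h) ∈ radPow k H 2 := by
  classical
  have e : ∀ y, (f - ∑ p, ∑ h : GroupLike k H, f (x p * h) • (ξ p * groupDual k H h)) y =
      f y - ∑ p, ∑ h : GroupLike k H, f (x p * h) * (ξ p * groupDual k H h) y := by
    intro y
    rw [WithConv.ofConv_sub, LinearMap.sub_apply, dual_sum_apply]
    congr 1
    refine Finset.sum_congr rfl fun p _ => ?_
    rw [dual_sum_apply]
    rfl
  rw [hS.mem_radPow_two_iff]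
  refine ⟨fun h' => ?_, fun q h' => ?_⟩
  · rw [e, mem_radPow_one.1 hf]
    simp [dual_mul_groupLike, hS.dual_groupLike, -LinearMap.convMul_apply]
  · rw [e]
    simp only [hS.dual_mul_groupDual_apply, groupDual_apply]
    simp

end SkewPrimitiveSystem

end SystemConsequences

/-! ### Spaces spanned by words and by subwords of a fixed word -/

section WordSpaces

variable {k A : Type*} [Field k] [Ring A] [Algebra k A] {ι : Type*}

/-- Left multiples of the elements of `E` by words of length `m` in the `y p`. -/
def wordSpace (E : Submodule k A) (y : ι → A) : ℕ → Submodule k A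
  | 0 => E
  | m + 1 => ⨆ p, (wordSpace E y m).map (LinearMap.mulLeft k (y p))

/-- Left multiples of the elements of `E` by subwords of length `m` of a given word in the `y p`. -/
def subwordLayer (E : Submodule k A) (y : ι → A) : List ι → ℕ → Submodule k A
  | [], 0 => E
  | [], _ + 1 => ⊥
  | _ :: L, 0 => subwordLayer E y L 0
  | a :: L, m + 1 => subwordLayer E y L (m + 1) ⊔
      (subwordLayer E y L m).map (LinearMap.mulLeft k (y a))

/-- Left multiples of the elements of `E` by subwords of a given word in the `y p`. -/
def subwordSpace (E : Submodule k A) (y : ι → A) : List ι → Submodule k A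
  | [] => E
  | a :: L => subwordSpace E y L ⊔ (subwordSpace E y L).map (LinearMap.mulLeft k (y a))

variable {E : Submodule k A} {y : ι → A}

lemma subwordLayer_zero (L : List ι) : subwordLayer E y L 0 = E := by
  induction L with
  | nil => rfl
  | cons a L ih => exact ih

lemma subwordLayer_le_subwordSpace (L : List ι) (m : ℕ) :
    subwordLayer E y L m ≤ subwordSpace E y L := by
  induction L generalizing m with
  | nil =>
    cases m with
    | zero => exact le_rfl
    | succ m => exact bot_le
  | cons a L ih =>
    cases m with
    | zero => exact (ih 0).trans le_sup_left
    | succ m => exact sup_le_sup (ih _) (Submodule.map_mono (ih _))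

lemma le_subwordSpace (L : List ι) : E ≤ subwordSpace E y L := by
  conv_lhs => rw [← subwordLayer_zero (E := E) (y := y) L]
  exact (subwordLayer_le_subwordSpace L 0 : subwordLayer E y L 0 ≤ subwordSpace E y L)

instance finiteDimensional_subwordSpace [FiniteDimensional k E] (L : List ι) :
    FiniteDimensional k (subwordSpace E y L) := by
  induction L with
  | nil => assumption
  | cons a L ih =>
    rw [subwordSpace]
    infer_instance

lemma finrank_subwordSpace_le [FiniteDimensional k E] (L : List ι) :
    Module.finrank k (subwordSpace E y L) ≤ Module.finrank k E * 2 ^ L.length := by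
  induction L with
  | nil =>
    rw [List.length_nil, pow_zero, mul_one]
    exact le_rfl
  | cons a L ih =>
    rw [subwordSpace, List.length_cons, pow_succ]
    have h1 := Submodule.finrank_add_le_finrank_add_finrank (subwordSpace E y L)
      ((subwordSpace E y L).map (LinearMap.mulLeft k (y a)))
    have h2 := Submodule.finrank_map_le (LinearMap.mulLeft k (y a)) (subwordSpace E y L)
    linarith

end WordSpaces

/-! ### Upper bound for dim H by straightening words in the dual forms -/

section UpperBound

variable {k H : Type*} [Field k] [Ring H] [HopfAlgebra k H] [FiniteDimensional k H]
  {R : H ⊗[k] H →ₗ[k] k} {ι : Type*} [DecidableEq ι]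
  {g : ι → GroupLike k H} {x : ι → H} {ξ : ι → DualAlg k H}

variable (k H) in
/-- The span of the forms `groupDual`. -/
noncomputable def groupDualSpan : Submodule k (DualAlg k H) :=
  Submodule.span k (Set.range (groupDual k H))

omit [FiniteDimensional k H] in
lemma groupDual_mem_span (h : GroupLike k H) : groupDual k H h ∈ groupDualSpan k H :=
  Submodule.subset_span ⟨h, rfl⟩

lemma mem_groupDualSpan_sup (f : DualAlg k H) : f ∈ groupDualSpan k H ⊔ radPow k H 1 := by
  classical
  have := Fintype.ofFinite (GroupLike k H)
  have h1 : f - ∑ h : GroupLike k H, f (h : H) • groupDual k H h ∈ radPow k H 1 := by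
    rw [mem_radPow_one]
    intro h'
    rw [WithConv.ofConv_sub, LinearMap.sub_apply, dual_sum_apply]
    simp [groupDual_apply]
  have h2 : ∑ h : GroupLike k H, f (h : H) • groupDual k H h ∈ groupDualSpan k H :=
    Submodule.sum_mem _ fun h _ => Submodule.smul_mem _ _ (groupDual_mem_span h)
  exact Submodule.mem_sup.2 ⟨_, h2, _, h1, by abel⟩

namespace SkewPrimitiveSystem

variable (hS : SkewPrimitiveSystem R g x ξ)
include hS

omit [FiniteDimensional k H] in
lemma wordSpace_le_radPow (m : ℕ) : wordSpace (groupDualSpan k H) ξ m ≤ radPow k H m := by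
  induction m with
  | zero => exact fun f _ => mem_radPow_zero f
  | succ m ih =>
    refine iSup_le fun p => Submodule.map_le_iff_le_comap.2 fun t ht => ?_
    change ξ p * t ∈ radPow k H (m + 1)
    rw [add_comm]
    exact mul_mem_radPow (hS.dual_mem p) (ih ht)

lemma groupDual_mul_mem (m : ℕ) (h : GroupLike k H) {t : DualAlg k H}
    (ht : t ∈ wordSpace (groupDualSpan k H) ξ m) :
    groupDual k H h * t ∈ wordSpace (groupDualSpan k H) ξ m ⊔ radPow k H (m + 1) := by
  induction m generalizing h t with
  | zero => exact mem_groupDualSpan_sup _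
  | succ m ih =>
    induction ht using Submodule.iSup_induction' with
    | mem p t ht =>
      obtain ⟨t, ht, rfl⟩ := ht
      change groupDual k H h * (ξ p * t) ∈ _
      have e : groupDual k H h * (ξ p * t) =
          (groupDual k H h * ξ p - ξ p * groupDual k H ((g p)⁻¹ * h)) * t +
            ξ p * (groupDual k H ((g p)⁻¹ * h) * t) := by
        rw [sub_mul]
        simp only [mul_assoc]
        abel
      rw [e]
      refine Submodule.add_mem _ (Submodule.mem_sup_right ?_) ?_
      · rw [show m + 1 + 1 = 2 + m by ring]
        exact mul_mem_radPow (hS.groupDual_mul_dual_sub_mem p h) (hS.wordSpace_le_radPow m ht)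
      · obtain ⟨u, hu, r, hr, hur⟩ := Submodule.mem_sup.1 (ih ((g p)⁻¹ * h) ht)
        rw [← hur, mul_add]
        refine Submodule.add_mem_sup (Submodule.mem_iSup_of_mem p ⟨u, hu, rfl⟩) ?_
        rw [show m + 1 + 1 = 1 + (m + 1) by ring]
        exact mul_mem_radPow (hS.dual_mem p) hr
    | zero => simp
    | add a b _ _ ha hb =>
      rw [mul_add]
      exact Submodule.add_mem _ ha hb

/-- Write J^(1+m) as J·J^m, replace the first factor by a combination of products of some ξ_p with a
form dual to a group-like element, and push the latter through the remaining word by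
`groupDual_mul_mem`. -/
lemma radPow_le_wordSpace_sup [Fintype ι] (m : ℕ) :
    radPow k H m ≤ wordSpace (groupDualSpan k H) ξ m ⊔ radPow k H (m + 1) := by
  have := Fintype.ofFinite (GroupLike k H)
  induction m with
  | zero => exact fun f _ => mem_groupDualSpan_sup f
  | succ m ih =>
    rw [add_comm m 1, radPow_add]
    refine Submodule.mul_le.2 fun f hf t ht => ?_
    obtain ⟨u, hu, r, hr, rfl⟩ := Submodule.mem_sup.1 (ih ht)
    rw [mul_add]
    have e1 : 1 + m + 1 = 1 + (m + 1) := by ring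
    refine Submodule.add_mem _ ?_ (Submodule.mem_sup_right (by
      rw [e1]
      exact mul_mem_radPow hf hr))
    have h1 := hS.sub_sum_mem_radPow_two hf
    set F := ∑ p, ∑ h : GroupLike k H, f (x p * h) • (ξ p * groupDual k H h) with hF
    have e2 : f * u = (f - F) * u + F * u := by rw [← add_mul, sub_add_cancel]
    rw [e2]
    refine Submodule.add_mem _ (Submodule.mem_sup_right ?_) ?_
    · rw [show 1 + m + 1 = 2 + m by ring]
      exact mul_mem_radPow h1 (hS.wordSpace_le_radPow m hu)
    · rw [hF, Finset.sum_mul]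
      refine Submodule.sum_mem _ fun p _ => ?_
      rw [Finset.sum_mul]
      refine Submodule.sum_mem _ fun h _ => ?_
      rw [smul_mul_assoc, mul_assoc]
      refine Submodule.smul_mem _ _ ?_
      obtain ⟨v, hv, s, hs, hvs⟩ := Submodule.mem_sup.1 (hS.groupDual_mul_mem m h hu)
      rw [← hvs, mul_add]
      refine Submodule.add_mem_sup ?_ ?_
      · rw [add_comm 1 m]
        exact Submodule.mem_iSup_of_mem p ⟨v, hv, rfl⟩
      · rw [e1]
        exact mul_mem_radPow (hS.dual_mem p) hs

omit [FiniteDimensional k H] in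
lemma subwordLayer_le_radPow (L : List ι) (m : ℕ) :
    subwordLayer (groupDualSpan k H) ξ L m ≤ radPow k H m := by
  induction L generalizing m with
  | nil =>
    cases m with
    | zero => exact fun f _ => mem_radPow_zero f
    | succ m => exact bot_le
  | cons a L ih =>
    cases m with
    | zero => exact fun f _ => mem_radPow_zero f
    | succ m =>
      refine sup_le (ih _) (Submodule.map_le_iff_le_comap.2 fun t ht => ?_)
      change ξ a * t ∈ radPow k H (m + 1)
      rw [add_comm]
      exact mul_mem_radPow (hS.dual_mem a) (ih _ ht)

variable {c : ι → ι → k}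
  (hcomm : ∀ p q, ξ p * ξ q - c p q • (ξ q * ξ p) ∈ radPow k H 3)
  (hsq : ∀ p, ξ p * ξ p ∈ radPow k H 3)
include hcomm hsq

omit [FiniteDimensional k H] in
-- Insertion of one letter into an ordered word: ξ_p moves right past earlier letters by `hcomm`,
-- and drops out by `hsq` on meeting itself. Errors lie in J³ times a word of length one less, hence
-- one filtration step further.
lemma dual_mul_subwordLayer_mem (L : List ι) (m : ℕ) {p : ι} (hp : p ∈ L) {t : DualAlg k H}
    (ht : t ∈ subwordLayer (groupDualSpan k H) ξ L m) :
    ξ p * t ∈ subwordLayer (groupDualSpan k H) ξ L (m + 1) ⊔ radPow k H (m + 2) := by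
  induction L generalizing m t with
  | nil => simp at hp
  | cons a L ih =>
    have hL : ∀ u ∈ subwordLayer (groupDualSpan k H) ξ L m,
        ξ p * u ∈ subwordLayer (groupDualSpan k H) ξ (a :: L) (m + 1) ⊔ radPow k H (m + 2) := by
      intro u hu
      by_cases hpa : p = a
      · subst hpa
        exact Submodule.mem_sup_left (Submodule.mem_sup_right ⟨u, hu, rfl⟩)
      · exact sup_le_sup_right (c := radPow k H (m + 2)) le_sup_left (ih m ((List.mem_cons.1 hp).resolve_left hpa) hu)
    cases m with
    | zero =>
      refine hL t ht
    | succ m =>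
      obtain ⟨u, hu, w, ⟨v, hv, rfl⟩, rfl⟩ := Submodule.mem_sup.1 ht
      change ξ p * (u + ξ a * v) ∈ _
      rw [mul_add]
      refine Submodule.add_mem _ (hL u hu) ?_
      have hv' := hS.subwordLayer_le_radPow L m hv
      have e3 : m + 1 + 2 = 3 + m := by ring
      by_cases hpa : p = a
      · subst hpa
        rw [← mul_assoc, e3]
        exact Submodule.mem_sup_right (mul_mem_radPow (hsq p) hv')
      · have hpL := (List.mem_cons.1 hp).resolve_left hpa
        obtain ⟨s, hs, r, hr, hsr⟩ := Submodule.mem_sup.1 (ih m hpL hv)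
        have e : ξ p * (ξ a * v) = (ξ p * ξ a - c p a • (ξ a * ξ p)) * v +
            c p a • (ξ a * s + ξ a * r) := by
          rw [← mul_add, hsr, sub_mul, smul_mul_assoc]
          simp only [mul_assoc]
          abel
        rw [e]
        refine Submodule.add_mem _ (Submodule.mem_sup_right ?_) (Submodule.smul_mem _ _
          (Submodule.add_mem_sup ?_ ?_))
        · rw [e3]
          exact mul_mem_radPow (hcomm p a) hv'
        · exact Submodule.mem_sup_right ⟨s, hs, rfl⟩
        · rw [show m + 1 + 2 = 1 + (m + 2) by ring]
          exact mul_mem_radPow (hS.dual_mem a) hr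

lemma wordSpace_le_subwordLayer_sup {L : List ι} (hL : ∀ p, p ∈ L) (m : ℕ) :
    wordSpace (groupDualSpan k H) ξ m ≤
      subwordLayer (groupDualSpan k H) ξ L m ⊔ radPow k H (m + 1) := by
  induction m with
  | zero =>
    rw [subwordLayer_zero]
    exact le_sup_left
  | succ m ih =>
    refine iSup_le fun p => Submodule.map_le_iff_le_comap.2 fun t ht => ?_
    change ξ p * t ∈ subwordLayer (groupDualSpan k H) ξ L (m + 1) ⊔ radPow k H (m + 1 + 1)
    obtain ⟨u, hu, r, hr, rfl⟩ := Submodule.mem_sup.1 (ih ht)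
    rw [mul_add]
    refine Submodule.add_mem _ (hS.dual_mul_subwordLayer_mem hcomm hsq L m (hL p) hu)
      (Submodule.mem_sup_right ?_)
    rw [show m + 1 + 1 = 1 + (m + 1) by ring]
    exact mul_mem_radPow (hS.dual_mem p) hr

lemma finrank_le [Fintype ι] (hp : IsPointedCoalgebra k H) {L : List ι} (hL : ∀ p, p ∈ L) :
    Module.finrank k H ≤ Nat.card (GroupLike k H) * 2 ^ L.length := by
  have h1 : ∀ m, radPow k H m ≤ subwordSpace (groupDualSpan k H) ξ L ⊔ radPow k H (m + 1) := by
    intro m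
    refine (hS.radPow_le_wordSpace_sup m).trans (sup_le ?_ le_sup_right)
    exact (hS.wordSpace_le_subwordLayer_sup hcomm hsq hL m).trans
      (sup_le_sup_right (subwordLayer_le_subwordSpace L m) _)
  -- Iterating pushes the error into ever higher powers of J, which eventually vanish.
  have h2 : ∀ m, ⊤ ≤ subwordSpace (groupDualSpan k H) ξ L ⊔ radPow k H m := by
    intro m
    induction m with
    | zero => exact radPow_zero.symm.le.trans le_sup_right
    | succ m ih => exact ih.trans (sup_le le_sup_left (h1 m))
  obtain ⟨n, hn⟩ := exists_groupAnn_pow_eq_bot hp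
  have h3 := h2 n
  rw [radPow_eq_bot hn, sup_bot_eq, top_le_iff] at h3
  have h4 := finrank_subwordSpace_le (E := groupDualSpan k H) (y := ξ) L
  rw [h3, finrank_top] at h4
  have h5 : Module.finrank k (DualAlg k H) = Module.finrank k H :=
    (LinearEquiv.finrank_eq (WithConv.linearEquiv k (H →ₗ[k] k))).trans
      Subspace.dual_finrank_eq
  rw [h5] at h4
  refine h4.trans (Nat.mul_le_mul_right _ ?_)
  have := Fintype.ofFinite (GroupLike k H)
  rw [Nat.card_eq_fintype_card]
  exact finrank_range_le_card (groupDual k H)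

end SkewPrimitiveSystem

end UpperBound

/-! ### Decomposability of the second layer and quadratic relations between the dual forms -/

section SecondLayer

variable {k H : Type*} [Field k] [Ring H] [HopfAlgebra k H] [FiniteDimensional k H]
  {R : H ⊗[k] H →ₗ[k] k} {ι : Type*} [DecidableEq ι]
  {g : ι → GroupLike k H} {x : ι → H} {ξ : ι → DualAlg k H}

namespace SkewPrimitiveSystem

variable (hS : SkewPrimitiveSystem R g x ξ)
include hS

omit [FiniteDimensional k H] in
lemma dual_mul_mem (p q : ι) : ξ p * ξ q ∈ radPow k H 2 :=
  mul_mem_radPow (m := 1) (n := 1) (hS.dual_mem p) (hS.dual_mem q)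

/-- A homogeneous element of the second layer has the degree of a product of two of the `x p`. -/
lemma exists_degree_eq_mul [Fintype ι] {γ : GroupLike k H} {z : H} (hz : IsLayerPrimitive 2 γ z)
    (hz' : z ∉ corad k H 2) : ∃ p q, γ = g p * g q := by
  have h1 : ∃ f ∈ radPow k H 2, f z ≠ 0 := by
    by_contra! h
    exact hz' h
  obtain ⟨f, hf, hfz⟩ := h1
  obtain ⟨t, ht, r, hr, rfl⟩ := Submodule.mem_sup.1 (hS.radPow_le_wordSpace_sup 2 hf)
  have hrz : r z = 0 := hz.mem r hr
  have h2 : t z ≠ 0 := by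
    intro h
    apply hfz
    change t z + r z = 0
    rw [h, hrz, add_zero]
  have h3 : ∃ p q, (ξ p * ξ q) z ≠ 0 := by
    by_contra! h
    apply h2
    -- On z, of right degree 1, a form dual to a group-like element acts by a scalar modulo lower
    -- terms. Hence only the products ξ_p ξ_q matter.
    have key : wordSpace (groupDualSpan k H) ξ 2 ≤ ann (Submodule.span k {z}) := by
      refine iSup_le fun p => Submodule.map_le_iff_le_comap.2 (iSup_le fun q =>
        Submodule.map_le_iff_le_comap.2 (Submodule.span_le.2 ?_))
      rintro _ ⟨a, rfl⟩
      change ξ p * (ξ q * groupDual k H a) ∈ ann (Submodule.span k {z})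
      intro y hy
      obtain ⟨c, rfl⟩ := Submodule.mem_span_singleton.1 hy
      have h4 := hz.right (groupDual k H a)
      have h5 := mem_radPow_iff.1 (hS.dual_mul_mem p q) _ h4
      rw [map_sub, map_smul, h, smul_zero, sub_zero] at h5
      rw [← mul_assoc, map_smul, dual_mul_eq_actRight, h5, smul_zero]
    exact key ht z (Submodule.mem_span_singleton_self z)
  obtain ⟨p, q, hpq⟩ := h3
  refine ⟨p, q, ?_⟩
  have h4 : (groupDual k H γ * (ξ p * ξ q)) z = (ξ p * ξ q) z := by
    have := mem_radPow_iff.1 (hS.dual_mul_mem p q) _ (hz.left (groupDual k H γ))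
    rw [map_sub, map_smul, groupDual_self, one_smul, sub_eq_zero] at this
    rw [dual_mul_eq_actLeft, this]
  set a := (g q)⁻¹ * ((g p)⁻¹ * γ) with ha
  -- The form dual to γ fixes z on the left; moved across ξ_p ξ_q it becomes the form dual to a,
  -- which acts on the right by its value at 1. A nonzero pairing therefore forces a = 1.
  have h5 : groupDual k H γ * (ξ p * ξ q) - (ξ p * ξ q) * groupDual k H a ∈ radPow k H 3 := by
    have e : groupDual k H γ * (ξ p * ξ q) - (ξ p * ξ q) * groupDual k H a =
        (groupDual k H γ * ξ p - ξ p * groupDual k H ((g p)⁻¹ * γ)) * ξ q +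
          ξ p * (groupDual k H ((g p)⁻¹ * γ) * ξ q - ξ q * groupDual k H a) := by
      rw [sub_mul, mul_sub]
      simp only [mul_assoc]
      abel
    rw [e]
    exact Submodule.add_mem _
      (mul_mem_radPow (m := 2) (n := 1) (hS.groupDual_mul_dual_sub_mem p γ) (hS.dual_mem q))
      (mul_mem_radPow (m := 1) (n := 2) (hS.dual_mem p) (hS.groupDual_mul_dual_sub_mem q _))
  have h6 := hz.mem _ h5
  have h7 := mem_radPow_iff.1 (hS.dual_mul_mem p q) _ (hz.right (groupDual k H a))
  rw [map_sub, map_smul, sub_eq_zero] at h7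
  rw [WithConv.ofConv_sub, LinearMap.sub_apply, h4, dual_mul_eq_actRight (ξ p * ξ q), h7] at h6
  by_contra hne
  have h8 : groupDual k H a (1 : H) = 0 := by
    refine groupDual_ne (h := 1) fun h => hne ?_
    rw [ha, inv_mul_eq_one, eq_inv_mul_iff_mul_eq] at h
    exact h.symm
  rw [h8, zero_smul, sub_zero] at h6
  exact hpq h6

variable [CharZero k] (hR : IsCoquasitriangular R) (hp : IsPointedCoalgebra k H)
include hR hp

/-- The second layer of the coradical filtration consists of products of skew-primitives. -/
lemma corad_three_le [Fintype ι] : corad k H 3 ≤ corad k H 2 * corad k H 2 := by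
  have hle : corad k H 2 ≤ corad k H 2 * corad k H 2 := fun y hy => by
    simpa using Submodule.mul_mem_mul hy (groupLike_mem_corad (1 : GroupLike k H) one_le_two)
  refine corad_succ_le_of_isLayerPrimitive hle (fun g y hy => ?_) fun γ z hz => ?_
  · induction hy using Submodule.mul_induction_on' with
    | mem_mul_mem a ha b hb =>
      rw [mul_assoc]
      exact Submodule.mul_mem_mul ha (mul_groupLike_mem_corad g hb)
    | add a _ b _ ha hb =>
      rw [add_mul]
      exact Submodule.add_mem _ ha hb
  · by_cases hz2 : z ∈ corad k H 2
    · exact hle hz2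
    obtain ⟨p, q, rfl⟩ := hS.exists_degree_eq_mul hz hz2
    set γ := g p * g q with hγ
    -- By multiplicativity R(γ,γ) = R(g_p,g_p) R(g_q,g_q) R(g_p,g_q) R(g_q,g_p) = (-1)(-1)·1.
    have hone : R ((γ : H) ⊗ₜ[k] (γ : H)) = 1 := by
      have h1 : R ((γ : H) ⊗ₜ[k] (γ : H)) =
          R ((g p : H) ⊗ₜ[k] (γ : H)) * R ((g q : H) ⊗ₜ[k] (γ : H)) :=
        hR.mul_left_groupLike (g p : H) (g q : H) γ
      have h2 : ∀ h : GroupLike k H, R ((h : H) ⊗ₜ[k] (γ : H)) =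
          R ((h : H) ⊗ₜ[k] (g q : H)) * R ((h : H) ⊗ₜ[k] (g p : H)) := fun h =>
        hR.mul_right_groupLike (g p : H) (g q : H) h
      rw [h1, h2, h2, hS.apply_self, hS.apply_self]
      linear_combination hS.symm p (g q)
    have hcomm : z * (γ : H) - (γ : H) * z ∈ corad k H 2 := by
      have h1 := hR.groupLike_mul_actRight γ z
      have h2 := hz.right (rightForm R (γ : H))
      have h3 := hz.left (rightForm R (γ : H))
      rw [rightForm_apply, hR.one_left_groupLike, one_smul] at h2
      rw [rightForm_apply, hone, one_smul] at h3
      have e : z * (γ : H) - (γ : H) * z =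
          (γ : H) * (actRight (rightForm R (γ : H)) z - z) -
            (actLeft (rightForm R (γ : H)) z - z) * (γ : H) := by
        rw [mul_sub, sub_mul, h1]
        abel
      rw [e]
      exact Submodule.sub_mem _ (groupLike_mul_mem_corad _ h2) (mul_groupLike_mem_corad _ h3)
    obtain ⟨s, hs, hΔ⟩ := hz.exists_comul one_le_two
    rw [← perp_ann (corad k H 2 * corad k H 2)]
    intro f hf
    exact dual_apply_eq_zero_of_comul hp hz.mem hΔ hs one_le_two hcomm f
      fun a ha b hb => hf _ (Submodule.mul_mem_mul ha hb)

omit hp in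
lemma groupLike_mul (h : GroupLike k H) (p : ι) :
    (h : H) * x p = R ((g p : H) ⊗ₜ[k] (h : H)) • (x p * (h : H)) :=
  hR.groupLike_mul_normalized (hS.apply_self p) (hS.mem p) h

/-- By `corad_three_le` a form lies in J³ as soon as it kills products of two elements of `corad k H
2`. This turns the quadratic relations into a check on the elements x_p x_q h. -/
lemma mem_radPow_three [Fintype ι] {f : DualAlg k H} (hf : f ∈ radPow k H 2)
    (hf' : ∀ p q (h : GroupLike k H), f (x p * (x q * h)) = 0) : f ∈ radPow k H 3 := by
  obtain ⟨h1, h2⟩ := (hS.mem_radPow_two_iff f).1 hf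
  have key : corad k H 2 * corad k H 2 ≤ LinearMap.ker f.ofConv := by
    refine (mul_le_mul' hS.corad_two_le hS.corad_two_le).trans ?_
    rw [Submodule.span_mul_span, Submodule.span_le]
    rintro _ ⟨a, ha, b, hb, rfl⟩
    change f (a * b) = 0
    rcases ha with ⟨c, rfl⟩ | ⟨⟨p, c⟩, rfl⟩ <;> rcases hb with ⟨d, rfl⟩ | ⟨⟨q, d⟩, rfl⟩ 
    · rw [← GroupLike.val_mul]
      exact h1 _
    · dsimp only
      rw [← mul_assoc, hS.groupLike_mul hR, smul_mul_assoc, map_smul, mul_assoc,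
        ← GroupLike.val_mul, h2, smul_zero]
    · dsimp only
      rw [mul_assoc, ← GroupLike.val_mul]
      exact h2 _ _
    · dsimp only
      rw [mul_assoc, ← mul_assoc (c : H), hS.groupLike_mul hR, smul_mul_assoc, mul_smul_comm,
        map_smul, mul_assoc, ← GroupLike.val_mul, hf', smul_zero]
  exact mem_radPow_iff.2 fun y hy => key (hS.corad_three_le hR hp hy)

omit hp in
lemma dual_mul_dual_apply (p q r s : ι) (h : GroupLike k H) :
    (ξ p * ξ q) (x r * (x s * h)) = (if q = s then 1 else 0) * (if p = r then 1 else 0) +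
      (if q = r then 1 else 0) * (if p = s then 1 else 0) * R ((g p : H) ⊗ₜ[k] (g q : H)) := by
  have hΔ : comul (R := k) (x r) = x r ⊗ₜ[k] (1 : H) + (g r : H) ⊗ₜ[k] x r + 0 := by
    rw [add_zero]
    exact (hS.mem r).1
  have h1 : ξ p ((g r : H) * (x s * h)) =
      R ((g s : H) ⊗ₜ[k] (g r : H)) * if p = s then 1 else 0 := by
    rw [← mul_assoc, hS.groupLike_mul hR, smul_mul_assoc, map_smul, mul_assoc,
      ← GroupLike.val_mul, hS.dual_mul, smul_eq_mul]
  rw [dual_mul_eq_actRight, actRight_mul_of_comul hΔ, zero_mul, map_zero, add_zero,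
    actRight_skewPrimitive_mul (hS.mem s).1, actRight_skewPrimitive_mul (hS.mem s).1,
    hS.dual_groupLike, hS.dual_mul, dualMulLeft_apply, hS.dual_mul, zero_smul, zero_add,
    map_add, mul_smul_comm, map_smul, mul_add, map_add, mul_smul_comm, mul_smul_comm, map_smul,
    map_smul, h1, ← GroupLike.val_mul, ← GroupLike.val_mul, hS.dual_groupLike, hS.dual_mul,
    smul_zero, add_zero, smul_eq_mul, smul_eq_mul]
  by_cases h2 : q = r
  · by_cases h3 : p = s
    · subst h2 h3
      simp
    · simp [h3]
  · simp [h2]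

lemma dual_mul_dual_sub_mem [Fintype ι] (p q : ι) :
    ξ p * ξ q - R ((g p : H) ⊗ₜ[k] (g q : H)) • (ξ q * ξ p) ∈ radPow k H 3 := by
  refine hS.mem_radPow_three hR hp (Submodule.sub_mem _ (hS.dual_mul_mem p q)
    (Submodule.smul_mem _ _ (hS.dual_mul_mem q p))) fun r s h => ?_
  change (ξ p * ξ q) (x r * (x s * h)) -
    R ((g p : H) ⊗ₜ[k] (g q : H)) * (ξ q * ξ p) (x r * (x s * h)) = 0
  rw [hS.dual_mul_dual_apply hR, hS.dual_mul_dual_apply hR]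
  linear_combination (-(if q = s then (1 : k) else 0) * (if p = r then 1 else 0)) *
    hS.symm p (g q)

/-- The commutation relation for q = p has coefficient R(g_p,g_p) = -1, so it says 2ξ_p² ∈ J³. -/
lemma dual_mul_self_mem [Fintype ι] (p : ι) : ξ p * ξ p ∈ radPow k H 3 := by
  have h := hS.dual_mul_dual_sub_mem hR hp p p
  rw [hS.apply_self, neg_smul, one_smul, sub_neg_eq_add, ← two_smul k] at h
  exact (Submodule.smul_mem_iff _ two_ne_zero).1 h

end SkewPrimitiveSystem

end SecondLayer

/-! ### Lower bound for dim H by skew derivations -/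

section LowerBound

variable {k H : Type*} [Field k] [Ring H] [HopfAlgebra k H] [FiniteDimensional k H]
  {R : H ⊗[k] H →ₗ[k] k} {ι : Type*} [DecidableEq ι]
  {g : ι → GroupLike k H} {x : ι → H} {ξ : ι → DualAlg k H}

namespace SkewPrimitiveSystem

variable (hS : SkewPrimitiveSystem R g x ξ)
include hS

lemma subwordLayer_le_corad (L : List ι) (m : ℕ) :
    subwordLayer (corad k H 1) x L m ≤ corad k H (m + 1) := by
  induction L generalizing m with
  | nil =>
    cases m with
    | zero => exact le_rfl
    | succ m => exact bot_le
  | cons a L ih =>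
    cases m with
    | zero => exact ih 0
    | succ m =>
      refine sup_le (ih _) (Submodule.map_le_iff_le_comap.2 fun t ht => ?_)
      exact mul_mem_corad (show 2 + (m + 1) ≤ m + 1 + 1 + 1 by omega) (hS.mem_corad a) (ih m ht)

/-- Modulo lower terms ξ_p acts as the skew derivation ∂/∂x_p: the form y ↦ ξ_p(x_q y) is constant
on G, hence a scalar modulo J. -/
lemma actRight_mul_sub_mem (p q : ι) {m : ℕ} {u : H} (hu : u ∈ corad k H (m + 1)) :
    actRight (ξ p) (x q * u) - x q * actRight (ξ p) u -
      (if p = q then (1 : k) else 0) • ((g q : H) * u) ∈ corad k H m := by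
  have hΔ : comul (R := k) (x q) = x q ⊗ₜ[k] (1 : H) + (g q : H) ⊗ₜ[k] x q + 0 := by
    rw [add_zero]
    exact (hS.mem q).1
  have e : actRight (ξ p) (x q * u) - x q * actRight (ξ p) u -
      (if p = q then (1 : k) else 0) • ((g q : H) * u) =
      (g q : H) * actRight (dualMulLeft (x q) (ξ p) - (if p = q then (1 : k) else 0) • 1) u := by
    rw [actRight_mul_of_comul hΔ, zero_mul, map_zero, actRight_sub, actRight_smul, actRight_one,
      mul_sub, mul_smul_comm]
    abel
  rw [e]
  refine groupLike_mul_mem_corad _ (actRight_mem_corad ?_ hu)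
  rw [mem_radPow_one]
  intro h
  change ξ p (x q * h) - (if p = q then (1 : k) else 0) * (1 : DualAlg k H) (h : H) = 0
  rw [hS.dual_mul, dual_one_groupLike, mul_one, sub_self]

/-- The derivative in a variable absent from the word vanishes to leading order, so the filtration
index drops by two instead of one. For `m = 0` the truncated subtraction gives `corad k H 0 = ⊥`. -/
lemma actRight_subwordLayer_mem {L : List ι} {a : ι} (ha : a ∉ L) (m : ℕ) {u : H}
    (hu : u ∈ subwordLayer (corad k H 1) x L m) : actRight (ξ a) u ∈ corad k H (m - 1) := by
  induction L generalizing m u with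
  | nil =>
    cases m with
    | zero => exact actRight_mem_corad (m := 0) (hS.dual_mem a) hu
    | succ m =>
      rw [(Submodule.mem_bot k).1 hu, map_zero]
      exact Submodule.zero_mem _
  | cons b L ih =>
    rw [List.mem_cons, not_or] at ha
    cases m with
    | zero => exact ih ha.2 0 hu
    | succ m =>
      obtain ⟨u₁, hu₁, w, ⟨v, hv, rfl⟩, rfl⟩ := Submodule.mem_sup.1 hu
      change actRight (ξ a) (u₁ + x b * v) ∈ corad k H m
      rw [map_add]
      refine Submodule.add_mem _ (ih ha.2 (m + 1) hu₁) ?_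
      have h1 := hS.actRight_mul_sub_mem a b (hS.subwordLayer_le_corad L m hv)
      rw [if_neg ha.1, zero_smul, sub_zero] at h1
      have h2 := ih ha.2 m hv
      have h3 : x b * actRight (ξ a) v ∈ corad k H m := by
        cases m with
        | zero =>
          rw [Nat.zero_sub, corad_zero, Submodule.mem_bot] at h2
          rw [h2, mul_zero]
          exact Submodule.zero_mem _
        | succ m => exact mul_mem_corad (by omega) (hS.mem_corad b) h2
      have := Submodule.add_mem _ h1 h3
      rwa [sub_add_cancel] at this

/-- Applying ξ_a isolates g_a·v modulo lower terms, so v lies in too small a step of the filtration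
and vanishes by `hL`; then so does u. -/
lemma eq_zero_of_add_mem_corad {L : List ι} {a : ι} (ha : a ∉ L) {m : ℕ}
    (hL : ∀ m, subwordLayer (corad k H 1) x L m ⊓ corad k H m = ⊥) {u v : H}
    (hu : u ∈ subwordLayer (corad k H 1) x L (m + 1)) (hv : v ∈ subwordLayer (corad k H 1) x L m)
    (huv : u + x a * v ∈ corad k H (m + 1)) : u = 0 ∧ v = 0 := by
  have hv0 : v = 0 := by
    have h1 := hS.actRight_mul_sub_mem a a (hS.subwordLayer_le_corad L m hv)
    rw [if_pos rfl, one_smul] at h1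
    have h2 := hS.actRight_subwordLayer_mem ha m hv
    have h3 : x a * actRight (ξ a) v ∈ corad k H m := by
      cases m with
      | zero =>
        rw [Nat.zero_sub, corad_zero, Submodule.mem_bot] at h2
        rw [h2, mul_zero]
        exact Submodule.zero_mem _
      | succ m => exact mul_mem_corad (by omega) (hS.mem_corad a) h2
    have h4 : actRight (ξ a) u ∈ corad k H m := hS.actRight_subwordLayer_mem ha (m + 1) hu
    have h5 : actRight (ξ a) (u + x a * v) ∈ corad k H m :=
      actRight_mem_corad (hS.dual_mem a) huv
    rw [map_add] at h5
    have h6 : (g a : H) * v ∈ corad k H m := by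
      have := Submodule.sub_mem _ (Submodule.sub_mem _ (Submodule.sub_mem _ h5 h4) h3) h1
      convert this using 1
      abel
    have h7 := groupLike_mul_mem_corad (g a)⁻¹ h6
    rw [← mul_assoc, ← GroupLike.val_mul, inv_mul_cancel, GroupLike.val_one, one_mul] at h7
    have h8 : v ∈ subwordLayer (corad k H 1) x L m ⊓ corad k H m := ⟨hv, h7⟩
    rwa [hL, Submodule.mem_bot] at h8
  refine ⟨?_, hv0⟩
  rw [hv0, mul_zero, add_zero] at huv
  have h8 : u ∈ subwordLayer (corad k H 1) x L (m + 1) ⊓ corad k H (m + 1) := ⟨hu, huv⟩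
  rwa [hL, Submodule.mem_bot] at h8

lemma subwordLayer_inf_corad {L : List ι} (hL : L.Nodup) (m : ℕ) :
    subwordLayer (corad k H 1) x L m ⊓ corad k H m = ⊥ := by
  induction L generalizing m with
  | nil =>
    cases m with
    | zero => rw [corad_zero, inf_bot_eq]
    | succ m => exact bot_inf_eq _
  | cons a L ih =>
    rw [List.nodup_cons] at hL
    cases m with
    | zero => rw [corad_zero, inf_bot_eq]
    | succ m =>
      rw [eq_bot_iff]
      rintro w ⟨hw, hw'⟩
      obtain ⟨u, hu, w, ⟨v, hv, rfl⟩, rfl⟩ := Submodule.mem_sup.1 hw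
      obtain ⟨rfl, rfl⟩ := hS.eq_zero_of_add_mem_corad hL.1 (ih hL.2) hu hv hw'
      simp

lemma finrank_subwordLayer {L : List ι} (hL : L.Nodup) (m : ℕ) :
    Module.finrank k (subwordLayer (corad k H 1) x L m) =
      Nat.card (GroupLike k H) * L.length.choose m := by
  induction L generalizing m with
  | nil =>
    cases m with
    | zero =>
      have := Fintype.ofFinite (GroupLike k H)
      rw [List.length_nil, Nat.choose_self, mul_one, subwordLayer, corad_one,
        finrank_span_eq_card (linearIndep_groupLikeVal (R := k) (A := H)),
        Nat.card_eq_fintype_card]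
    | succ m =>
      rw [List.length_nil, Nat.choose_zero_succ, mul_zero]
      exact finrank_bot k H
  | cons a L ih =>
    have hL' := List.nodup_cons.1 hL
    cases m with
    | zero =>
      have := ih hL'.2 0
      rw [Nat.choose_zero_right] at this ⊢
      exact this
    | succ m =>
      have hdis : Disjoint (subwordLayer (corad k H 1) x L (m + 1))
          ((subwordLayer (corad k H 1) x L m).map (LinearMap.mulLeft k (x a))) := by
        rw [Submodule.disjoint_def]
        rintro u hu ⟨v, hv, hvu⟩
        refine (hS.eq_zero_of_add_mem_corad hL'.1 (hS.subwordLayer_inf_corad hL'.2)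
          (Submodule.neg_mem _ hu) hv ?_ ).1 |> neg_eq_zero.1
        change x a * v = u at hvu
        rw [hvu, neg_add_cancel]
        exact Submodule.zero_mem _
      have hinj : Module.finrank k
          ((subwordLayer (corad k H 1) x L m).map (LinearMap.mulLeft k (x a))) =
          Module.finrank k (subwordLayer (corad k H 1) x L m) := by
        rw [← LinearMap.range_domRestrict]
        refine LinearMap.finrank_range_of_inj ?_
        rintro ⟨v, hv⟩ ⟨w, hw⟩ hvw
        have h1 := (hS.eq_zero_of_add_mem_corad hL'.1 (hS.subwordLayer_inf_corad hL'.2)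
          (Submodule.zero_mem _) (Submodule.sub_mem _ hv hw) (by
            change x a * v = x a * w at hvw
            rw [mul_sub, hvw, sub_self, add_zero]
            exact Submodule.zero_mem _)).2
        exact Subtype.ext (sub_eq_zero.1 h1)
      have h1 := Submodule.finrank_sup_add_finrank_inf_eq (subwordLayer (corad k H 1) x L (m + 1))
        ((subwordLayer (corad k H 1) x L m).map (LinearMap.mulLeft k (x a)))
      rw [hdis.eq_bot, finrank_bot, add_zero, hinj, ih hL'.2, ih hL'.2] at h1
      rw [subwordLayer, h1, List.length_cons, Nat.choose_succ_succ]
      ring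

/-- The subwords of a word without repetitions are as independent as possible. -/
lemma le_finrank_subwordSpace {L : List ι} (hL : L.Nodup) :
    Nat.card (GroupLike k H) * 2 ^ L.length ≤
      Module.finrank k (subwordSpace (corad k H 1) x L) := by
  -- The layers add up directly: the sum of those below N lies in `corad k H N`, which meets layer N
  -- trivially.
  have key : ∀ N, ∃ U : Submodule k H, U ≤ subwordSpace (corad k H 1) x L ∧ U ≤ corad k H N ∧
      Module.finrank k U = ∑ m ∈ Finset.range N, Nat.card (GroupLike k H) * L.length.choose m := by
    intro N
    induction N with
    | zero => exact ⟨⊥, bot_le, bot_le, by simp⟩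
    | succ N ih =>
      obtain ⟨U, hU, hU', hfin⟩ := ih
      refine ⟨U ⊔ subwordLayer (corad k H 1) x L N,
        sup_le hU (subwordLayer_le_subwordSpace L N),
        sup_le (hU'.trans (corad_mono N.le_succ)) (hS.subwordLayer_le_corad L N), ?_⟩
      have hinf : U ⊓ subwordLayer (corad k H 1) x L N = ⊥ := by
        rw [eq_bot_iff, ← hS.subwordLayer_inf_corad hL N]
        exact fun y hy => ⟨hy.2, hU' hy.1⟩
      have h1 := Submodule.finrank_sup_add_finrank_inf_eq U (subwordLayer (corad k H 1) x L N)
      rw [hinf, finrank_bot, add_zero, hfin, hS.finrank_subwordLayer hL] at h1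
      rw [h1, Finset.sum_range_succ]
  obtain ⟨U, hU, -, hfin⟩ := key (L.length + 1)
  rw [← Finset.mul_sum, Nat.sum_range_choose] at hfin
  rw [← hfin]
  exact Submodule.finrank_mono hU

end SkewPrimitiveSystem

end LowerBound

/-! ### Construction of a system from bases of normalized skew-primitives -/

section Existence

variable {k H : Type*} [Field k] [CharZero k] [Ring H] [HopfAlgebra k H] [FiniteDimensional k H]
  {R : H ⊗[k] H →ₗ[k] k}

namespace IsCoquasitriangular

variable (hR : IsCoquasitriangular R) {g : GroupLike k H}
  (hg : R ((g : H) ⊗ₜ[k] (g : H)) = -1)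
include hR hg

omit [FiniteDimensional k H] in
lemma skewPrimitives_le_sup :
    skewPrimitives k (1 : H) (g : H) ≤
      Submodule.span k {(1 : H) - (g : H)} ⊔ normalizedPrimitives R g := by
  intro x hx
  rw [← add_sub_cancel ((R (x ⊗ₜ[k] (g : H)) / 2) • ((1 : H) - (g : H))) x]
  refine Submodule.add_mem_sup (Submodule.smul_mem _ _ (Submodule.mem_span_singleton_self _))
    (mem_normalizedPrimitives.2
      ⟨Submodule.sub_mem _ hx (Submodule.smul_mem _ _ (one_sub_mem_skewPrimitives g)), ?_⟩)
  rw [TensorProduct.sub_tmul, map_sub, ← TensorProduct.smul_tmul', map_smul,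
    hR.apply_one_sub hg, smul_eq_mul, div_mul_cancel₀ _ two_ne_zero, sub_self]

lemma eq_zero_of_mem_normalizedPrimitives {x : H} (hx : x ∈ normalizedPrimitives R g)
    (hx' : x ∈ corad k H 1) : x = 0 := by
  obtain ⟨hx1, hx2⟩ := mem_normalizedPrimitives.1 hx
  obtain ⟨c, rfl⟩ := Submodule.mem_span_singleton.1 (mem_span_of_mem_skewPrimitives hx1 hx')
  rw [← TensorProduct.smul_tmul', map_smul, hR.apply_one_sub hg, smul_eq_mul, mul_eq_zero] at hx2
  rw [hx2.resolve_right two_ne_zero, zero_smul]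

/-- Normalized primitives meet kG trivially, so coordinate forms extend to forms on H that factor
through the quotient by kG. -/
lemma exists_dual_basis {ι : Type*} [DecidableEq ι]
    (b : Module.Basis ι k (normalizedPrimitives R g)) :
    ∃ f : ι → DualAlg k H, (∀ i, f i ∈ radPow k H 1) ∧
      ∀ i j, f i (b j : H) = if i = j then 1 else 0 := by
  let ψ : normalizedPrimitives R g →ₗ[k] H ⧸ corad k H 1 :=
    (corad k H 1).mkQ ∘ₗ (normalizedPrimitives R g).subtype
  have hψ : LinearMap.ker ψ = ⊥ := by
    rw [LinearMap.ker_eq_bot']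
    rintro ⟨x, hx⟩ h
    exact Subtype.ext (hR.eq_zero_of_mem_normalizedPrimitives hg hx
      ((Submodule.Quotient.mk_eq_zero _).1 h))
  obtain ⟨π, hπ⟩ := LinearMap.exists_leftInverse_of_injective ψ hψ
  refine ⟨fun i => .toConv (b.coord i ∘ₗ π ∘ₗ (corad k H 1).mkQ), fun i => ?_, fun i j => ?_⟩
  · rw [mem_radPow_one]
    intro h
    change b.coord i (π ((corad k H 1).mkQ (h : H))) = 0
    rw [Submodule.mkQ_apply, (Submodule.Quotient.mk_eq_zero _).2 (groupLike_mem_corad_one h),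
      map_zero, map_zero]
  · change b.coord i (π (ψ (b j))) = _
    rw [show π (ψ (b j)) = b j from LinearMap.congr_fun hπ (b j), Module.Basis.coord_apply,
      Module.Basis.repr_self, Finsupp.single_apply]
    simp only [eq_comm]

end IsCoquasitriangular

omit [CharZero k] in
/-- The first layer of the coradical filtration consists of skew-primitives. -/
lemma corad_two_le_of_skewPrimitives_le {Q : Submodule k H} (hQ : corad k H 1 ≤ Q)
    (hmul : ∀ g : GroupLike k H, ∀ y ∈ Q, y * (g : H) ∈ Q)
    (h : ∀ g : GroupLike k H, skewPrimitives k (1 : H) (g : H) ≤ Q) : corad k H 2 ≤ Q := by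
  refine corad_succ_le_of_isLayerPrimitive hQ hmul fun g z hz => ?_
  obtain ⟨x, hx, hxz⟩ := hz.exists_skewPrimitive
  rw [← sub_sub_cancel x z]
  exact Submodule.sub_mem _ (h g hx) (hQ hxz)

lemma exists_skewPrimitiveSystem (hR : IsCoquasitriangular R) (hp : IsPointedCoalgebra k H) :
    ∃ (t : ℕ) (g : Fin t → GroupLike k H) (r : Fin t → ℕ) (x : (Σ i : Fin t, Fin (r i)) → H)
      (ξ : (Σ i : Fin t, Fin (r i)) → DualAlg k H),
      Function.Injective g ∧
      (∀ h : GroupLike k H, h ∈ Set.range g ↔ Nontrivial (ArrowSpace k (1 : H) (h : H))) ∧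
      (∀ i, r i = Module.finrank k (ArrowSpace k (1 : H) (g i : H))) ∧
      SkewPrimitiveSystem R (fun p => g p.1) x ξ := by
  classical
  have := Fintype.ofFinite {h : GroupLike k H // Nontrivial (ArrowSpace k (1 : H) (h : H))}
  set e := (Fintype.equivFin {h : GroupLike k H // Nontrivial (ArrowSpace k (1 : H) (h : H))}).symm
  set g : Fin (Fintype.card {h : GroupLike k H // Nontrivial (ArrowSpace k (1 : H) (h : H))}) →
    GroupLike k H := fun i => (e i).1 with hgdef
  have hinj : Function.Injective g := Subtype.val_injective.comp e.injective
  have hrange : ∀ h : GroupLike k H,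
      h ∈ Set.range g ↔ Nontrivial (ArrowSpace k (1 : H) (h : H)) := fun h => by
    refine ⟨?_, fun hh => ⟨e.symm ⟨h, hh⟩, by simp [hgdef]⟩⟩
    rintro ⟨i, rfl⟩
    exact (e i).2
  have hself : ∀ i, R ((g i : H) ⊗ₜ[k] (g i : H)) = -1 := fun i => by
    obtain ⟨x, hx, hx'⟩ := nontrivial_arrowSpace_one_iff.1 ((hrange (g i)).1 ⟨i, rfl⟩)
    exact hR.apply_self_eq_neg_one hp hx hx'
  have hsymm : ∀ i (h : GroupLike k H),
      R ((g i : H) ⊗ₜ[k] (h : H)) * R ((h : H) ⊗ₜ[k] (g i : H)) = 1 := fun i h => by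
    obtain ⟨x, hx, hx'⟩ := nontrivial_arrowSpace_one_iff.1 ((hrange (g i)).1 ⟨i, rfl⟩)
    exact hR.apply_mul_apply_swap hx hx' h
  have hfin : ∀ i, Module.finrank k (normalizedPrimitives R (g i)) =
      Module.finrank k (ArrowSpace k (1 : H) (g i : H)) := fun i =>
    (hR.nonempty_normalizedPrimitives_equiv (hself i)).some.finrank_eq
  let b := fun i => Module.finBasisOfFinrankEq k (normalizedPrimitives R (g i)) (hfin i)
  choose f hf hfb using fun i => hR.exists_dual_basis (hself i) (b i)
  choose ξ hξ1 hξ2 hξ3 using fun p : Σ i, Fin (Module.finrank k (ArrowSpace k (1 : H) (g i : H))) =>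
    exists_invariant_dual (g p.1) (f p.1 p.2) (hf p.1 p.2)
  refine ⟨_, g, fun i => Module.finrank k (ArrowSpace k (1 : H) (g i : H)),
    fun p => (b p.1 p.2 : H), ξ, hinj, hrange, fun i => rfl, fun p => hself p.1,
    fun p => hsymm p.1, fun p => (b p.1 p.2).2, hξ1, ?_, ?_⟩
  · rintro ⟨i, i'⟩ ⟨j, j'⟩ h
    by_cases hij : i = j
    · subst hij
      rw [hξ2 ⟨i, i'⟩ _ (b i j').2.1, hfb]
      simp
    · rw [hξ3 ⟨i, i'⟩ (g j) (fun h => hij (hinj h).symm) _ (b j j').2.1, if_neg]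
      exact fun h => hij (congrArg Sigma.fst h)
  · refine corad_two_le_of_skewPrimitives_le ?_ (fun h y hy => ?_) fun h => ?_
    · rw [corad_one]
      exact Submodule.span_mono Set.subset_union_left
    · induction hy using Submodule.span_induction with
      | mem y hy =>
        rcases hy with ⟨a, rfl⟩ | ⟨⟨p, a⟩, rfl⟩
        · exact Submodule.subset_span (Or.inl ⟨a * h, rfl⟩)
        · exact Submodule.subset_span (Or.inr ⟨(p, a * h), by simp [mul_assoc]⟩)
      | zero => rw [zero_mul]; exact Submodule.zero_mem _
      | add y z _ _ hy hz => rw [add_mul]; exact Submodule.add_mem _ hy hz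
      | smul c y _ hy => rw [smul_mul_assoc]; exact Submodule.smul_mem _ _ hy
    · have hsub : ∀ h : GroupLike k H, (1 : H) - (h : H) ∈ Submodule.span k
          (Set.range (GroupLike.val : GroupLike k H → H) ∪ Set.range fun ph :
            (Σ i, Fin (Module.finrank k (ArrowSpace k (1 : H) (g i : H)))) × GroupLike k H =>
              (b ph.1.1 ph.1.2 : H) * (ph.2 : H)) := fun h =>
        Submodule.sub_mem _ (Submodule.subset_span (Or.inl ⟨1, rfl⟩))
          (Submodule.subset_span (Or.inl ⟨h, rfl⟩))
      by_cases hh : h ∈ Set.range g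
      · obtain ⟨i, rfl⟩ := hh
        refine (hR.skewPrimitives_le_sup (hself i)).trans (sup_le ?_ ?_)
        · exact (Submodule.span_singleton_le_iff_mem _ _).2 (hsub _)
        · intro y hy
          have h1 := congrArg Subtype.val ((b i).sum_repr ⟨y, hy⟩)
          rw [Submodule.coe_sum] at h1
          rw [show y = _ from h1.symm]
          refine Submodule.sum_mem _ fun i' _ => Submodule.smul_mem _ _
            (Submodule.subset_span (Or.inr ⟨(⟨i, i'⟩, 1), ?_⟩))
          simp
      · rw [hrange, nontrivial_arrowSpace_iff, not_not] at hh
        exact hh.trans ((Submodule.span_singleton_le_iff_mem _ _).2 (hsub h))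

end Existence

/-! ### Lexicographic order of the generators -/

section SigmaList

variable {t : ℕ} {r : Fin t → ℕ}

/-- The lexicographically ordered list of all pairs `(i, i')`. -/
def sigmaList (r : Fin t → ℕ) : List (Σ i : Fin t, Fin (r i)) :=
  (List.ofFn fun i : Fin t => List.ofFn fun i' : Fin (r i) => ⟨i, i'⟩).flatten

lemma mem_sigmaList (p : Σ i : Fin t, Fin (r i)) : p ∈ sigmaList r := by
  rw [sigmaList, List.mem_flatten]
  exact ⟨_, (List.mem_ofFn' _ _).2 ⟨p.1, rfl⟩, (List.mem_ofFn' _ _).2 ⟨p.2, rfl⟩⟩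

lemma nodup_sigmaList : (sigmaList r).Nodup := by
  rw [sigmaList, List.nodup_flatten]
  constructor
  · intro l hl
    obtain ⟨i, rfl⟩ := (List.mem_ofFn' _ _).1 hl
    exact List.nodup_ofFn.2 fun a b h => by simpa using h
  · rw [List.pairwise_ofFn]
    intro i j hij
    rw [List.disjoint_left]
    rintro p hp hq
    obtain ⟨a, rfl⟩ := (List.mem_ofFn' _ _).1 hp
    obtain ⟨b, hb⟩ := (List.mem_ofFn' _ _).1 hq
    exact hij.ne' (congrArg Sigma.fst hb)

lemma orderedMonomial_eq {H : Type*} [Ring H] (x : (Σ i : Fin t, Fin (r i)) → H)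
    (σ : (Σ i : Fin t, Fin (r i)) → Fin 2) :
    orderedMonomial x σ = ((sigmaList r).map fun p => x p ^ (σ p : ℕ)).prod := by
  rw [orderedMonomial, sigmaList, List.map_flatten, List.prod_flatten, List.map_map, List.map_ofFn]
  congr 2
  funext i
  simp [List.map_ofFn, Function.comp_def]

end SigmaList

/-! ### Relations in H and the basis of ordered monomials -/

section PBW

variable {k H : Type*} [Field k] [CharZero k] [Ring H] [HopfAlgebra k H] [FiniteDimensional k H]
  {R : H ⊗[k] H →ₗ[k] k} {ι : Type*} [DecidableEq ι]
  {g : ι → GroupLike k H} {x : ι → H} {ξ : ι → DualAlg k H}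

namespace SkewPrimitiveSystem

variable (hS : SkewPrimitiveSystem R g x ξ) (hR : IsCoquasitriangular R)
include hS hR

lemma mul_groupLike (p : ι) (h : GroupLike k H) :
    x p * (h : H) = R ((h : H) ⊗ₜ[k] (g p : H)) • ((h : H) * x p) := by
  rw [hS.groupLike_mul hR, smul_smul, mul_comm (R _), hS.symm, one_smul]

lemma mul_mul_sub (p q : ι) :
    x q * x p - R ((g p : H) ⊗ₜ[k] (g q : H)) • (x p * x q) =
      R (x p ⊗ₜ[k] x q) • (1 - (g p : H) * (g q : H)) :=
  hR.normalized_mul_normalized (hS.apply_self p) (hS.apply_self q) (hS.symm q) (hS.mem p) (hS.mem q)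

lemma sq_eq (p : ι) :
    x p ^ 2 = (R (x p ⊗ₜ[k] x p) / 2) • (1 - (g p : H) ^ 2) := by
  have h := hS.mul_mul_sub hR p p
  rw [hS.apply_self, neg_smul, one_smul, sub_neg_eq_add, ← two_smul k, ← sq, ← sq] at h
  rw [div_eq_inv_mul, mul_smul, ← h, smul_smul, inv_mul_cancel₀ two_ne_zero, one_smul]

lemma subwordSpace_le_span {L : List ι} (hL : L.Nodup) :
    subwordSpace (corad k H 1) x L ≤ Submodule.span k
      (Set.range fun hσ : GroupLike k H × (ι → Fin 2) =>
        (hσ.1 : H) * (L.map fun p => x p ^ (hσ.2 p : ℕ)).prod) := by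
  induction L with
  | nil =>
    rw [subwordSpace, corad_one]
    refine Submodule.span_mono ?_
    rintro _ ⟨h, rfl⟩
    exact ⟨(h, 0), by simp⟩
  | cons a L ih =>
    rw [List.nodup_cons] at hL
    -- The exponent at a is free because a does not occur in L; setting it to 0 or 1 omits or
    -- inserts x_a.
    have hupd : ∀ (σ : ι → Fin 2) (c : Fin 2),
        (L.map fun p => x p ^ (Function.update σ a c p : ℕ)) = L.map fun p => x p ^ (σ p : ℕ) :=
      fun σ c => List.map_congr_left fun p hp => by
        have hpa : p ≠ a := by
          rintro rfl
          exact hL.1 hp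
        rw [Function.update_of_ne hpa]
    refine sup_le ((ih hL.2).trans (Submodule.span_le.2 ?_))
      (Submodule.map_le_iff_le_comap.2 ((ih hL.2).trans (Submodule.span_le.2 ?_)))
    · rintro _ ⟨⟨h, σ⟩, rfl⟩
      refine Submodule.subset_span ⟨(h, Function.update σ a 0), ?_⟩
      simp [hupd]
    · rintro _ ⟨⟨h, σ⟩, rfl⟩
      rw [SetLike.mem_coe, Submodule.mem_comap, LinearMap.mulLeft_apply]
      dsimp only
      rw [← mul_assoc, hS.mul_groupLike hR, smul_mul_assoc, mul_assoc]
      refine Submodule.smul_mem _ _ (Submodule.subset_span ⟨(h, Function.update σ a 1), ?_⟩)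
      simp [hupd]

variable [Fintype ι] (hp : IsPointedCoalgebra k H)
include hp

lemma finrank_eq {L : List ι} (hL : L.Nodup) (hL' : ∀ p, p ∈ L) :
    Module.finrank k H = Nat.card (GroupLike k H) * 2 ^ L.length :=
  le_antisymm (hS.finrank_le (hS.dual_mul_dual_sub_mem hR hp) (hS.dual_mul_self_mem hR hp) hp hL')
    ((hS.le_finrank_subwordSpace hL).trans (Submodule.finrank_le _))

lemma subwordSpace_eq_top {L : List ι} (hL : L.Nodup) (hL' : ∀ p, p ∈ L) :
    subwordSpace (corad k H 1) x L = ⊤ :=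
  Submodule.eq_top_of_finrank_eq (le_antisymm (Submodule.finrank_le _)
    ((hS.finrank_eq hR hp hL hL').trans_le (hS.le_finrank_subwordSpace hL)))

lemma exists_basis {L : List ι} (hL : L.Nodup) (hL' : ∀ p, p ∈ L) :
    ∃ b : Module.Basis (GroupLike k H × (ι → Fin 2)) k H,
      ∀ h σ, b (h, σ) = (h : H) * (L.map fun p => x p ^ (σ p : ℕ)).prod := by
  have := Fintype.ofFinite (GroupLike k H)
  have hlen : L.length = Fintype.card ι := by
    rw [← List.toFinset_card_of_nodup hL, ← Finset.card_univ]
    congr 1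
    exact Finset.eq_univ_iff_forall.2 fun p => List.mem_toFinset.2 (hL' p)
  refine ⟨basisOfTopLeSpanOfCardEqFinrank (fun hσ : GroupLike k H × (ι → Fin 2) =>
    (hσ.1 : H) * (L.map fun p => x p ^ (hσ.2 p : ℕ)).prod) ?_ ?_, fun h σ => ?_⟩
  · rw [← hS.subwordSpace_eq_top hR hp hL hL']
    exact hS.subwordSpace_le_span hR hL
  · rw [hS.finrank_eq hR hp hL hL', Fintype.card_prod, Fintype.card_fun, Fintype.card_fin, hlen,
      Nat.card_eq_fintype_card]
  · rw [coe_basisOfTopLeSpanOfCardEqFinrank]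

end SkewPrimitiveSystem

end PBW

/-! ### Connectedness of the quiver and generation of G -/

section Generation

variable {k H : Type*} [Field k] [Ring H] [HopfAlgebra k H]

/-- An arrow from a to b translates to one from 1 to ba⁻¹, so an undirected path from 1 to h writes
h as a product of generators and their inverses. -/
lemma closure_eq_top_of_hasConnectedQuiver (hconn : HasConnectedQuiver k H)
    {S : Set (GroupLike k H)}
    (hS : ∀ h : GroupLike k H, Nontrivial (ArrowSpace k (1 : H) (h : H)) → h ∈ S) :
    Subgroup.closure S = ⊤ := by
  have key : ∀ a b : GroupLike k H, Relation.EqvGen (fun c d : GroupLike k H =>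
      Nontrivial (ArrowSpace k (c : H) (d : H))) a b → b * a⁻¹ ∈ Subgroup.closure S := by
    intro a b hab
    induction hab with
    | rel a b h => exact Subgroup.subset_closure (hS _ (nontrivial_arrowSpace_translate h))
    | refl a => rw [mul_inv_cancel]; exact one_mem _
    | symm a b _ h => simpa using inv_mem h
    | trans a b c _ _ h1 h2 => simpa [mul_assoc] using mul_mem h2 h1
  refine (Subgroup.eq_top_iff' _).2 fun h => ?_
  simpa using key 1 h (hconn 1 h)

end Generation

/-! ### Straightening of words in an algebra with skew-commutation relations -/

section SubwordSpaceStability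

variable {k A ι : Type*} [Field k] [Ring A] [Algebra k A] {E : Submodule k A} {y : ι → A}

lemma mul_mem_subwordSpace_of_skewCommute {z : A} (hE : ∀ u ∈ E, z * u ∈ E)
    (hz : ∀ p, ∃ c : k, z * y p = c • (y p * z)) (L : List ι) {u : A}
    (hu : u ∈ subwordSpace E y L) : z * u ∈ subwordSpace E y L := by
  induction L generalizing u with
  | nil => exact hE u hu
  | cons a L ih =>
    obtain ⟨v, hv, _, ⟨w, hw, rfl⟩, rfl⟩ := Submodule.mem_sup.1 hu
    obtain ⟨c, hc⟩ := hz a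
    have e : z * (v + LinearMap.mulLeft k (y a) w) =
        z * v + LinearMap.mulLeft k (y a) (c • (z * w)) := by
      rw [LinearMap.mulLeft_apply, LinearMap.mulLeft_apply, mul_add, ← mul_assoc, hc,
        smul_mul_assoc, mul_smul_comm, mul_assoc]
    rw [e]
    exact Submodule.add_mem_sup (ih hv) ⟨_, Submodule.smul_mem _ _ (ih hw), rfl⟩

/-- Induction on the word: y_p is commuted past its first letter, or squared if it equals that
letter. The error terms must preserve the space for every tail of the word, hence the quantification
over `L` in both hypotheses. -/
lemma mul_mem_subwordSpace
    (hsq : ∀ p L, ∀ u ∈ subwordSpace E y L, y p * y p * u ∈ subwordSpace E y L)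
    (hcomm : ∀ p q, p ≠ q → ∃ c : k, ∀ L, ∀ u ∈ subwordSpace E y L,
      (y q * y p - c • (y p * y q)) * u ∈ subwordSpace E y L)
    {L : List ι} {p : ι} (hp : p ∈ L) {u : A}
    (hu : u ∈ subwordSpace E y L) : y p * u ∈ subwordSpace E y L := by
  induction L generalizing u with
  | nil => simp at hp
  | cons a L ih =>
    obtain ⟨v, hv, _, ⟨w, hw, rfl⟩, rfl⟩ := Submodule.mem_sup.1 hu
    rw [LinearMap.mulLeft_apply, mul_add]
    by_cases hpa : p = a
    · subst hpa
      rw [← mul_assoc, add_comm]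
      exact Submodule.add_mem_sup (hsq p L w hw) ⟨v, hv, rfl⟩
    · have hpL := (List.mem_cons.1 hp).resolve_left hpa
      obtain ⟨c, hc⟩ := hcomm a p (Ne.symm hpa)
      have e : y p * v + y p * (y a * w) =
          (y p * v + (y p * y a - c • (y a * y p)) * w) +
            LinearMap.mulLeft k (y a) (c • (y p * w)) := by
        rw [LinearMap.mulLeft_apply, sub_mul, smul_mul_assoc, mul_smul_comm, mul_assoc, mul_assoc]
        abel
      rw [e]
      exact Submodule.add_mem_sup (Submodule.add_mem _ (ih hpL hv) (hc L w hw))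
        ⟨_, Submodule.smul_mem _ _ (ih hpL hw), rfl⟩

lemma subwordSpace_le_subalgebra
    {B : Subalgebra k A} (hE : E ≤ Subalgebra.toSubmodule B) (hy : ∀ p, y p ∈ B)
    (L : List ι) : subwordSpace E y L ≤ Subalgebra.toSubmodule B := by
  induction L with
  | nil => exact hE
  | cons a L ih =>
    exact sup_le ih (Submodule.map_le_iff_le_comap.2 fun u hu => B.mul_mem (hy a) (ih hu))

end SubwordSpaceStability

/-! ### Dimension bound for the presented algebra -/

section Presentation

variable {k G : Type*} [Field k] [Group G] {t : ℕ} {r : Fin t → ℕ} {g : Fin t → G}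
  {q : Fin t → Fin t → k} {μ : (Σ i : Fin t, Fin (r i)) → k}
  {lam : (Σ i : Fin t, Fin (r i)) → (Σ i : Fin t, Fin (r i)) → k}

local notation "PresAlg" => RingQuot (PresRel g q μ lam)
local notation "presMap" => RingQuot.mkAlgHom k (PresRel g q μ lam)

lemma exists_word [Finite G] (hg : Subgroup.closure (Set.range g) = ⊤) (h : G) :
    ∃ v : List (Fin t), (v.map g).prod = h := by
  have h1 : h ∈ Submonoid.closure (Set.range g) := by
    rw [← Subgroup.closure_toSubmonoid_of_finite, hg]
    exact Subgroup.mem_top h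
  obtain ⟨l, hl, rfl⟩ := Submonoid.exists_list_of_mem_closure h1
  clear h1
  induction l with
  | nil => exact ⟨[], rfl⟩
  | cons a l ih =>
    obtain ⟨v, hv⟩ := ih fun y hy => hl y (List.mem_cons_of_mem a hy)
    obtain ⟨i, rfl⟩ := hl a List.mem_cons_self
    exact ⟨i :: v, by rw [List.map_cons, List.prod_cons, List.prod_cons, hv]⟩

variable (g q μ lam) in
/-- The span of the words in the group generators of the presented algebra. -/
def groupWordSpan : Submodule k PresAlg :=
  Submodule.span k (Set.range fun v : List (Fin t) => presMap (v.map (symG k r)).prod)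

lemma presMap_word_eq {v w : List (Fin t)} (h : (v.map g).prod = (w.map g).prod) :
    presMap (v.map (symG k r)).prod = presMap (w.map (symG k r)).prod :=
  RingQuot.mkAlgHom_rel k (PresRel.group v w h)

lemma finrank_groupWordSpan_le [Finite G] (hg : Subgroup.closure (Set.range g) = ⊤) :
    FiniteDimensional k (groupWordSpan g q μ lam) ∧
      Module.finrank k (groupWordSpan g q μ lam) ≤ Nat.card G := by
  have := Fintype.ofFinite G
  choose w hw using exists_word hg
  have h1 : groupWordSpan g q μ lam =
      Submodule.span k (Set.range fun h : G => presMap ((w h).map (symG k r)).prod) := by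
    refine le_antisymm (Submodule.span_mono ?_) (Submodule.span_mono ?_)
    · rintro _ ⟨v, rfl⟩
      exact ⟨(v.map g).prod, presMap_word_eq (hw _)⟩
    · rintro _ ⟨h, rfl⟩
      exact ⟨w h, rfl⟩
  rw [h1, Nat.card_eq_fintype_card]
  exact ⟨FiniteDimensional.span_of_finite k (Set.finite_range _), finrank_range_le_card _⟩

lemma symG_mul_groupWordSpan (i : Fin t) {u : PresAlg} (hu : u ∈ groupWordSpan g q μ lam) :
    presMap (symG k r i) * u ∈ groupWordSpan g q μ lam := by
  induction hu using Submodule.span_induction with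
  | mem u hu =>
    obtain ⟨v, rfl⟩ := hu
    refine Submodule.subset_span ⟨i :: v, ?_⟩
    simp
  | zero => rw [mul_zero]; exact Submodule.zero_mem _
  | add u v _ _ hu hv => rw [mul_add]; exact Submodule.add_mem _ hu hv
  | smul c u _ hu => rw [mul_smul_comm]; exact Submodule.smul_mem _ _ hu

lemma symX_mul_symG (i : Fin t) (p : Σ i : Fin t, Fin (r i)) :
    presMap (symX k p) * presMap (symG k r i) =
      q i p.1 • (presMap (symG k r i) * presMap (symX k p)) := by
  rw [← map_mul, ← map_mul, ← map_smul]
  exact RingQuot.mkAlgHom_rel k (PresRel.cross i p)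

lemma symX_mul_self (p : Σ i : Fin t, Fin (r i)) :
    presMap (symX k p) * presMap (symX k p) = μ p • (1 - presMap (symG k r p.1) ^ 2) := by
  rw [← map_mul, ← sq, ← map_pow, ← map_one (presMap), ← map_sub, ← map_smul]
  exact RingQuot.mkAlgHom_rel k (PresRel.square p)

lemma symX_mul_sub {p p' : Σ i : Fin t, Fin (r i)} (h : p ≠ p') :
    presMap (symX k p') * presMap (symX k p) -
        q p.1 p'.1 • (presMap (symX k p) * presMap (symX k p')) =
      lam p p' • (1 - presMap (symG k r p.1) * presMap (symG k r p'.1)) := by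
  rw [← map_mul, ← map_mul, ← map_mul, ← map_one (presMap), ← map_sub, ← map_smul, ← map_smul,
    ← map_sub]
  exact RingQuot.mkAlgHom_rel k (PresRel.link p p' h)

variable (hq : ∀ i j, q i j ≠ 0)
include hq

lemma symG_mul_subwordSpace (i : Fin t) (L : List (Σ i : Fin t, Fin (r i))) {u : PresAlg}
    (hu : u ∈ subwordSpace (groupWordSpan g q μ lam) (fun p => presMap (symX k p)) L) :
    presMap (symG k r i) * u ∈
      subwordSpace (groupWordSpan g q μ lam) (fun p => presMap (symX k p)) L := by
  refine mul_mem_subwordSpace_of_skewCommute (fun u hu => symG_mul_groupWordSpan i hu)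
    (fun p => ⟨(q i p.1)⁻¹, ?_⟩) L hu
  rw [symX_mul_symG, smul_smul, inv_mul_cancel₀ (hq _ _), one_smul]

lemma symX_mul_subwordSpace (p : Σ i : Fin t, Fin (r i)) {L : List (Σ i : Fin t, Fin (r i))}
    (hp : p ∈ L) {u : PresAlg}
    (hu : u ∈ subwordSpace (groupWordSpan g q μ lam) (fun p => presMap (symX k p)) L) :
    presMap (symX k p) * u ∈
      subwordSpace (groupWordSpan g q μ lam) (fun p => presMap (symX k p)) L := by
  have key : ∀ (c : k) (i j : Fin t) (L : List (Σ i : Fin t, Fin (r i))),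
      ∀ u ∈ subwordSpace (groupWordSpan g q μ lam) (fun p => presMap (symX k p)) L,
        (c • (1 - presMap (symG k r i) * presMap (symG k r j))) * u ∈
          subwordSpace (groupWordSpan g q μ lam) (fun p => presMap (symX k p)) L := by
    intro c i j L u hu
    rw [smul_mul_assoc, sub_mul, one_mul, mul_assoc]
    exact Submodule.smul_mem _ _ (Submodule.sub_mem _ hu
      (symG_mul_subwordSpace hq i L (symG_mul_subwordSpace hq j L hu)))
  refine mul_mem_subwordSpace (fun p L u hu => ?_)
    (fun p p' h => ⟨q p.1 p'.1, fun L u hu => ?_⟩) hp hu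
  · rw [symX_mul_self, sq]
    exact key _ _ _ L u hu
  · rw [symX_mul_sub h]
    exact key _ _ _ L u hu

/-- The space contains 1 and is stable under left multiplication by all generators, so it is a left
ideal containing 1. -/
lemma subwordSpace_groupWordSpan_eq_top {L : List (Σ i : Fin t, Fin (r i))} (hL : ∀ p, p ∈ L) :
    subwordSpace (groupWordSpan g q μ lam) (fun p => presMap (symX k p)) L = ⊤ := by
  have key : ∀ w : PresGen k r,
      ∀ u ∈ subwordSpace (groupWordSpan g q μ lam) (fun p => presMap (symX k p)) L,
        presMap w * u ∈ subwordSpace (groupWordSpan g q μ lam) (fun p => presMap (symX k p)) L := by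
    intro w
    induction w using FreeAlgebra.induction with
    | grade0 c =>
      intro u hu
      rw [AlgHom.commutes, ← Algebra.smul_def]
      exact Submodule.smul_mem _ _ hu
    | grade1 s =>
      rcases s with i | p
      · exact fun u hu => symG_mul_subwordSpace hq i L hu
      · exact fun u hu => symX_mul_subwordSpace hq p (hL p) hu
    | mul a b ha hb =>
      intro u hu
      rw [map_mul, mul_assoc]
      exact ha _ (hb _ hu)
    | add a b ha hb =>
      intro u hu
      rw [map_add, add_mul]
      exact Submodule.add_mem _ (ha _ hu) (hb _ hu)
  refine (Submodule.eq_top_iff').2 fun u => ?_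
  obtain ⟨w, rfl⟩ := RingQuot.mkAlgHom_surjective k (PresRel g q μ lam) u
  rw [← mul_one (presMap w)]
  exact key w 1 (le_subwordSpace L (Submodule.subset_span ⟨[], by simp⟩))

/-- The ordered monomials span the presented algebra. -/
lemma finrank_presAlg_le [Finite G] (hg : Subgroup.closure (Set.range g) = ⊤)
    {L : List (Σ i : Fin t, Fin (r i))} (hL : ∀ p, p ∈ L) :
    FiniteDimensional k PresAlg ∧ Module.finrank k PresAlg ≤ Nat.card G * 2 ^ L.length := by
  obtain ⟨h1, h2⟩ := finrank_groupWordSpan_le (q := q) (μ := μ) (lam := lam) hg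
  have h3 := subwordSpace_groupWordSpan_eq_top (g := g) (μ := μ) (lam := lam) hq hL
  have h4 := finrank_subwordSpace_le (E := groupWordSpan g q μ lam)
    (y := fun p => presMap (symX k p)) L
  have h5 := finiteDimensional_subwordSpace (E := groupWordSpan g q μ lam)
    (y := fun p => presMap (symX k p)) L
  rw [h3] at h4 h5
  rw [finrank_top] at h4
  exact ⟨Module.finite_def.2 (Module.finite_def.1 (Module.Finite.equiv
    (Submodule.topEquiv (R := k) (M := PresAlg)))), h4.trans (Nat.mul_le_mul_right _ h2)⟩

end Presentation

/-! ### The presentation of H -/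

section Main

variable {k H : Type*} [Field k] [CharZero k] [Ring H] [HopfAlgebra k H] [FiniteDimensional k H]
  {R : H ⊗[k] H →ₗ[k] k} {t : ℕ} {r : Fin t → ℕ} {g : Fin t → GroupLike k H}
  {x : (Σ i : Fin t, Fin (r i)) → H} {ξ : (Σ i : Fin t, Fin (r i)) → DualAlg k H}

lemma SkewPrimitiveSystem.exists_presentation
    (hS : SkewPrimitiveSystem R (fun p : Σ i : Fin t, Fin (r i) => g p.1) x ξ)
    (hR : IsCoquasitriangular R) (hp : IsPointedCoalgebra k H)
    (hg : Subgroup.closure (Set.range g) = ⊤) :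
    ∃ φ : RingQuot (PresRel g (fun i j => R ((g i : H) ⊗ₜ[k] (g j : H)))
        (fun p => R (x p ⊗ₜ[k] x p) / 2) fun p p' => R (x p ⊗ₜ[k] x p')) ≃ₐ[k] H,
      (∀ i, φ (RingQuot.mkAlgHom k _ (symG k r i)) = (g i : H)) ∧
        ∀ p, φ (RingQuot.mkAlgHom k _ (symX k p)) = x p := by
  let F : PresGen k r →ₐ[k] H := FreeAlgebra.lift k (Sum.elim (fun i => (g i : H)) x)
  have hFG : ∀ i, F (symG k r i) = (g i : H) := fun i => FreeAlgebra.lift_ι_apply _ _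
  have hFX : ∀ p, F (symX k p) = x p := fun p => FreeAlgebra.lift_ι_apply _ _
  have hFw : ∀ v : List (Fin t), F (v.map (symG k r)).prod = ((v.map g).prod : GroupLike k H) := by
    intro v
    induction v with
    | nil => simp
    | cons i v ih => simp [hFG, ih]
  have hF : ∀ ⦃a b⦄, PresRel g (fun i j => R ((g i : H) ⊗ₜ[k] (g j : H)))
      (fun p => R (x p ⊗ₜ[k] x p) / 2) (fun p p' => R (x p ⊗ₜ[k] x p')) a b → F a = F b := by
    intro a b hab
    cases hab with
    | group v w h => rw [hFw, hFw, h]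
    | cross i p =>
      rw [map_mul, map_smul, map_mul, hFG, hFX]
      exact hS.mul_groupLike hR p (g i)
    | square p =>
      rw [map_pow, map_smul, map_sub, map_one, map_pow, hFG, hFX]
      exact hS.sq_eq hR p
    | link p p' h =>
      rw [map_sub, map_mul, map_smul, map_smul, map_mul, map_sub, map_one, map_mul, hFG, hFG, hFX,
        hFX]
      exact hS.mul_mul_sub hR p p'
  let φ := RingQuot.liftAlgHom k ⟨F, hF⟩
  have hφ : ∀ w, φ (RingQuot.mkAlgHom k _ w) = F w := fun w =>
    RingQuot.liftAlgHom_mkAlgHom_apply k F hF w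
  -- The image contains kG and all x_p, hence all ordered words. Injectivity then comes from
  -- equality of dimensions.
  have hsurj : Function.Surjective φ := by
    rw [← AlgHom.range_eq_top, ← Algebra.toSubmodule_eq_top, eq_top_iff,
      ← hS.subwordSpace_eq_top hR hp nodup_sigmaList mem_sigmaList]
    refine subwordSpace_le_subalgebra (B := φ.range) ?_
      (fun p => φ.mem_range.2 ⟨_, (hφ _).trans (hFX p)⟩) _
    rw [corad_one, Submodule.span_le]
    rintro _ ⟨h, rfl⟩
    obtain ⟨v, rfl⟩ := exists_word hg h
    exact φ.mem_range.2 ⟨_, (hφ _).trans (hFw v)⟩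
  obtain ⟨h1, h2⟩ := finrank_presAlg_le (g := g) (μ := fun p => R (x p ⊗ₜ[k] x p) / 2)
    (lam := fun p p' => R (x p ⊗ₜ[k] x p')) (q := fun i j => R ((g i : H) ⊗ₜ[k] (g j : H)))
    (fun i j => hR.apply_groupLike_ne_zero _ _) hg (mem_sigmaList (r := r))
  have h3 : Module.finrank k (RingQuot (PresRel g (fun i j => R ((g i : H) ⊗ₜ[k] (g j : H)))
      (fun p => R (x p ⊗ₜ[k] x p) / 2) fun p p' => R (x p ⊗ₜ[k] x p'))) = Module.finrank k H :=
    le_antisymm (h2.trans_eq (hS.finrank_eq hR hp nodup_sigmaList mem_sigmaList).symm)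
      (LinearMap.finrank_le_finrank_of_surjective (f := φ.toLinearMap) hsurj)
  have hinj : Function.Injective φ :=
    (LinearMap.injective_iff_surjective_of_finrank_eq_finrank (f := φ.toLinearMap) h3).2 hsurj
  exact ⟨AlgEquiv.ofBijective φ ⟨hinj, hsurj⟩, fun i => (hφ _).trans (hFG i),
    fun p => (hφ _).trans (hFX p)⟩

end Main

end CoquasitriangularPointed

theorem theorem6p4 {k : Type*} [Field k] [IsAlgClosed k] [CharZero k]
    {H : Type*} [Ring H] [HopfAlgebra k H] [FiniteDimensional k H]
    (R : H ⊗[k] H →ₗ[k] k) (hR : IsCoquasitriangular R)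
    (hpointed : IsPointedCoalgebra k H) (hconn : HasConnectedQuiver k H)
    (hG : Nontrivial (GroupLike k H)) :
    ∃ (t : ℕ) (g : Fin t → GroupLike k H) (r : Fin t → ℕ)
      (x : (Σ i : Fin t, Fin (r i)) → H)
      (μ : (Σ i : Fin t, Fin (r i)) → k)
      (lam : (Σ i : Fin t, Fin (r i)) → (Σ i : Fin t, Fin (r i)) → k),
      -- the `g_i` are the distinct targets of the arrows starting at `1`, with multiplicity `r_i`
      Function.Injective g ∧
      (∀ h : GroupLike k H, h ∈ Set.range g ↔ Nontrivial (ArrowSpace k (1 : H) (h : H))) ∧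
      (∀ i, r i = Module.finrank k (ArrowSpace k (1 : H) (g i : H))) ∧
      -- the `g_i` generate `G`, and the `x_{i,i'}` are `(1,g_i)`-primitive
      Subgroup.closure (Set.range g) = ⊤ ∧
      (∀ p, x p ∈ skewPrimitives k (1 : H) (g p.1 : H)) ∧
      -- `H` is presented by these generators and the relations listed in `PresRel`
      (∃ φ : RingQuot (PresRel g (fun i j => R ((g i : H) ⊗ₜ[k] (g j : H))) μ lam) ≃ₐ[k] H,
        (∀ i, φ (RingQuot.mkAlgHom k _ (symG k r i)) = (g i : H)) ∧
        (∀ p, φ (RingQuot.mkAlgHom k _ (symX k p)) = x p)) ∧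
      -- the PBW basis
      (∃ b : Module.Basis (GroupLike k H × ((Σ i : Fin t, Fin (r i)) → Fin 2)) k H,
        ∀ h σ, b (h, σ) = (h : H) * orderedMonomial x σ) := by
  obtain ⟨t, g, r, x, ξ, hinj, hrange, hr, hS⟩ := exists_skewPrimitiveSystem hR hpointed
  have hcl : Subgroup.closure (Set.range g) = ⊤ :=
    closure_eq_top_of_hasConnectedQuiver hconn fun h hh => (hrange h).2 hh
  -- The scalars are values of R: `comm` at x_p ⊗ x_p' gives λ = R(x_p, x_p'), and for p = p' its
  -- left side is 2x_p², whence the factor 1/2 in μ.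
  refine ⟨t, g, r, x, fun p => R (x p ⊗ₜ[k] x p) / 2, fun p p' => R (x p ⊗ₜ[k] x p'), hinj, hrange,
    hr, hcl, fun p => (hS.mem p).1, hS.exists_presentation hR hpointed hcl, ?_⟩
  obtain ⟨b, hb⟩ := hS.exists_basis hR hpointed nodup_sigmaList mem_sigmaList
  exact ⟨b, fun h σ => by rw [hb, orderedMonomial_eq]⟩
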